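/- **Theorem 4.12.** For an integer matrix $A\in\mathbb Z^{m\times n}$ ($m\ge1$) with columns $a_1,\dots,a_n$, let $L=\sum_{i,j}\bigl(1+\lceil\log_2(|A_{ij}|+1)\rceil\bigr)$ be its encoding length. Write $\|v\|_Q=\sqrt{v^\top Qv}$, and let $\varepsilon=\frac1{11m}$ and $\theta=\theta_A=\frac1{m^2\Delta_A^2}$, where $\Delta_A$ is the maximum of $\prod_{j\in B}\|a_j\|$ over all sets $B$ of indices of linearly independent columns. The *Maximum Support Image Algorithm* works on a current matrix, which we also call $A$ (columns $a_i$, $i\in T$), and on matrices $R,Q,U$. It starts with the input matrix without its zero columns (so $T$ is the set of indices of the nonzero columns) and with $R=Q=I_m$, $U=I_m$, and repeats the following round. 1. If $T=\emptyset$, return $\bar y=0$ and stop. 2. Call a first order method with input $A,Q,\varepsilon$. It returns vectors $x$ and $y$ such that $A^\top Qy>0$, or $x\ge0$, $\sum_{i\in T} x_i=1$, $y=\sum_{i\in T} x_ia_i/\|a_i\|_Q$ and $\|y\|_Q\le\varepsilon$. 3. If $A^\top Qy>0$, return $\bar y=UQy$ and stop. Otherwise replace $R$ by $\frac1{1+\varepsilon}\bigl(R+\sum_{i\in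 T}\frac{x_i}{\|a_i\|_Q^2}a_ia_i^\top\bigr)$ and then $Q$ by $R^{-1}$. 4. As long as some $k\in T$ has $\|a_k\|_Q<\theta\|a_k\|$: choose any such $k$, compute a matrix $W$ whose columns form an orthonormal basis of $a_k^\perp$, replace $A$ by $W^\top A$, delete its zero columns and remove their indices from $T$, replace $R$ by $W^\top RW$ and $U$ by $UW$, and recompute $Q=R^{-1}$. The first order methods considered are as follows. Put $b_i=a_i/\|a_i\|_Q$, $\langle u,v\rangle_Q=u^\top Qv$, $Bx=\sum_{i\in T}x_ib_i$, and for $y\in\mathbb R^r$ (with $r$ the current number of rows) and $\mu>0$ let $x_\mu(y)$ be the vector with coordinates proportional to $\exp(-\langle b_i,y\rangle_Q/\mu)$, with sum $1$. * *Von Neumann*: start with $x$ the first unit vector and $y=Bx$. While $\|y\|_Q>\varepsilon$ and some $k$ has $\langle a_k,y\rangle_Q\le0$, choose any such $k$, let $\lambda=\langle y-b_k,y\rangle_Q/\|y-b_k\|_Q^2$, and replace $x$ by $(1-\lambda)x+\lambda e_k$ and $y$ by $(1-\lambda)y+\lambda b_k$. Return $(x,y)$. * *Smoothed Perceptron*: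 start with $y_0=B(\frac1{|T|},\dots,\frac1{|T|})$, $\mu_0=2$, $x_0=x_{\mu_0}(y_0)$. For $k=0,1,2,\dots$: if $\langle b_i,y_k\rangle_Q>0$ for all $i$, return $(x_k,y_k)$; if $\|Bx_k\|_Q\le\varepsilon$, return $(x_k,Bx_k)$; otherwise, with $\tau=\frac2{k+3}$, set $y_{k+1}=(1-\tau)(y_k+\tau Bx_k)+\tau^2Bx_{\mu_k}(y_k)$, $\mu_{k+1}=(1-\tau)\mu_k$ and $x_{k+1}=(1-\tau)x_k+\tau x_{\mu_{k+1}}(y_{k+1})$. * *Mirror Prox*, for $\max_{\|u\|_Q\le1}\min_x\langle u,Bx\rangle_Q$ over the simplex in $x$: with $\tau=\sqrt{2\log\max(2,|T|)}$ and $\sigma=1/\tau$, let $\mathrm{Prox}_{u,x}(u',x')$ be the pair of the projection of $u+\sigma Bx'$ onto the unit ball of $\|\cdot\|_Q$ and the vector with coordinates proportional to $x_i\exp(-\tau\langle b_i,u'\rangle_Q)$, with sum $1$. Start with $u_0=0$, $x_0=(\frac1{|T|},\dots,\frac1{|T|})$, and for $j=0,1,2,\dots$ let $(v_j,w_j)=\mathrm{Prox}_{u_j,x_j}(u_j,x_j)$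 and $(u_{j+1},x_{j+1})=\mathrm{Prox}_{u_j,x_j}(v_j,w_j)$, and let $(\bar u,\bar x)$ be the average of $(v_0,w_0),\dots,(v_j,w_j)$. If $\langle b_i,\bar u\rangle_Q>0$ for all $i$, return $(\bar x,\bar u)$; if $\|B\bar x\|_Q\le\varepsilon$, return $(\bar x,B\bar x)$. Operations are counted in exact real arithmetic: each of $+,-,\times,\div,\sqrt{\ }$, each comparison and each use of an integer constant is one operation, and so are, in the last two methods, $\exp$ and $\log$. The computations of $\theta_A$ (by the greedy algorithm), of $R^{-1}$ (by Gauss–Jordan elimination), of $W$ (from a Householder reflection) and of all matrix products are included; for von Neumann, $A^\top QA$ is computed once per call, and $A^\top Qy$ is updated along with $x$ and $y$. There is an absolute constant $C$ such that for all $m\ge1$ and $n$ and every $A\in\mathbb Z^{m\times n}$ of rank $m$ the following hold. (a) With the von Neumann algorithm as first order method, and however the free choices of indices $k$ are made, the Maximum Support Image Algorithm terminates after at most $C\,m^2n^2L$ arithmetic operations, and its output $\bar y$ is a solution of $A^\top y\ge0$ of maximum support for the input matrix $A$: $A^\top\bar y\ge0$, and for every $z$ with $A^\top z\ge0$ the support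 of $A^\top z$ is contained in that of $A^\top\bar y$. In particular, $\bar y$ satisfies the maximum number of strict inequalities. (b) If $n\ge2$, the same holds with the Smoothed Perceptron or with Mirror Prox as first order method, with at most $C\,m^3n\sqrt{\log n}\,L$ arithmetic operations. -/

import Mathlib

/- A unit-cost model of real arithmetic, the maximum support image algorithm with its three
possible first order subroutines as step-counted programs, and the notions of the claim. -/

namespace MaxSupport

/-- A value together with the number of arithmetic operations spent on computing it. -/
structure Timed (α : Type) where
  val : α
  cost : ℕ

instance : Monad Timed where
  pure a := ⟨a, 0⟩
  bind x f := ⟨(f x.val).val, x.cost + (f x.val).cost⟩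

/-- The number instructions of the machine. Programs below are written for an arbitrary type `K`
with these instructions, so they can touch numbers only through them, and each use is charged.
Copying of data, indexing and loop control are free. The claim is about the instance `K = ℝ`. -/
class RealRAM (K : Type) where
  lit : ℤ → Timed K
  add : K → K → Timed K
  sub : K → K → Timed K
  mul : K → K → Timed K
  div : K → K → Timed K
  sqrt : K → Timed K
  le : K → K → Timed Bool

/-- The machine with two more instructions, needed only by the entropy-based subroutines. -/
class ExpRealRAM (K : Type) extends RealRAM K where
  exp : K → Timed K
  log : K → Timed K

/-- Exact real arithmetic, every instruction at unit cost. -/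
noncomputable instance instRealRAMReal : RealRAM ℝ where
  lit z := ⟨(z : ℝ), 1⟩
  add x y := ⟨x + y, 1⟩
  sub x y := ⟨x - y, 1⟩
  mul x y := ⟨x * y, 1⟩
  div x y := ⟨x / y, 1⟩
  sqrt x := ⟨Real.sqrt x, 1⟩
  le x y := ⟨@decide (x ≤ y) (Classical.propDecidable _), 1⟩

noncomputable instance instExpRealRAMReal : ExpRealRAM ℝ where
  exp x := ⟨Real.exp x, 1⟩
  log x := ⟨Real.log x, 1⟩

section Programs

open RealRAM

/-! ### Control structures -/

/-- Compute the entries of a vector one after the other. -/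
def vec {K : Type} {p : ℕ} (f : Fin p → Timed K) : Timed (Fin p → K) :=
  ⟨fun i => (f i).val, ∑ i, (f i).cost⟩

/-- Compute the entries of a matrix one after the other. -/
def mat {K : Type} {p q : ℕ} (f : Fin p → Fin q → Timed K) : Timed (Matrix (Fin p) (Fin q) K) :=
  ⟨Matrix.of fun i j => (f i j).val, ∑ i, ∑ j, (f i j).cost⟩

/-- The members of a list that pass a test. -/
def filterT {α : Type} (test : α → Timed Bool) : List α → Timed (List α)
  | [] => pure []
  | a :: l => do
    let b ← test a
    let rest ← filterT test l
    pure (if b then a :: rest else rest)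

/-- Do all members of a list pass a test? -/
def allT {α : Type} (test : α → Timed Bool) : List α → Timed Bool
  | [] => pure true
  | a :: l => do
    let b ← test a
    let rest ← allT test l
    pure (b && rest)

/-- `while true do`: a round either continues with a new loop state (`Sum.inl`) or leaves the loop
with a result (`Sum.inr`); `none` means that the budget of rounds was too small, here or in an
inner loop. The budget has no other effect on the computation. -/
def loop {σ β : Type} (round : σ → Timed (Option (σ ⊕ β))) : ℕ → σ → Timed (Option β)
  | 0, _ => pure none
  | fuel + 1, s => do
    let o ← round s
    match o with
    | none => pure none
    | some (Sum.inl s') => loop round fuel s'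
    | some (Sum.inr b) => pure (some b)

/-- An arbitrary member of the nonempty list `k :: l`; the number `c` says which. -/
def pick {α : Type} (c : ℕ) (k : α) (l : List α) : α :=
  (k :: l).getD (c % (l.length + 1)) k

/-! ### Linear algebra -/

variable {K : Type} [RealRAM K]

def sumT {p : ℕ} (f : Fin p → Timed K) : Timed K :=
  (List.finRange p).foldlM (fun s i => do let v ← f i; add s v) =<< lit 0

def dot {p : ℕ} (u v : Fin p → K) : Timed K :=
  sumT fun i => mul (u i) (v i)

def matMul {p q s : ℕ} (A : Matrix (Fin p) (Fin q) K) (B : Matrix (Fin q) (Fin s) K) :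
    Timed (Matrix (Fin p) (Fin s) K) :=
  mat fun i j => sumT fun l => mul (A i l) (B l j)

def matVec {p q : ℕ} (A : Matrix (Fin p) (Fin q) K) (v : Fin q → K) : Timed (Fin p → K) :=
  vec fun i => dot (A i) v

def idMat (p : ℕ) : Timed (Matrix (Fin p) (Fin p) K) :=
  mat fun i j => if i = j then lit 1 else lit 0

/-- `x > 0` -/
def isPos (x : K) : Timed Bool := do
  let z ← lit 0
  let b ← le x z
  pure (!b)

/-- `x = 0` -/
def isZero (x : K) : Timed Bool := do
  let z ← lit 0
  let b ← le x z
  let c ← le z x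
  pure (b && c)

/-- Are all coordinates of a vector positive? -/
def allPos {p : ℕ} (v : Fin p → K) : Timed Bool :=
  allT (fun i => isPos (v i)) (List.finRange p)

/-- Indices of the columns that are not the zero vector. -/
def nonzeroColumns {p q : ℕ} (A : Matrix (Fin p) (Fin q) K) : Timed (List (Fin q)) :=
  filterT (fun j => do
    let b ← allT (fun i => isZero (A i j)) (List.finRange p)
    pure (!b)) (List.finRange q)

/-- `‖v‖_Q`, the square root of `vᵀ Q v` -/
def normQ {p : ℕ} (Q : Matrix (Fin p) (Fin p) K) (v : Fin p → K) : Timed K := do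
  let w ← matVec Q v
  let s ← dot v w
  sqrt s

/-- The Gauss–Jordan exchange step at the diagonal position `p`: it solves the `p`-th of the
equations `v = M u` for `u_p` and substitutes the result into the other equations. -/
def exchange {r : ℕ} (M : Matrix (Fin r) (Fin r) K) (p : Fin r) :
    Timed (Matrix (Fin r) (Fin r) K) := do
  let one ← lit 1
  let zero ← lit 0
  mat fun i j =>
    if i = p then
      if j = p then div one (M p p)
      else do let c ← div (M p j) (M p p); sub zero c
    else
      if j = p then div (M i p) (M p p)
      else do
        let c ← mul (M i p) (M p j)
        let d ← div c (M p p)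
        sub (M i j) d

/-- Inverse of a positive definite matrix: Gauss–Jordan exchange at all diagonal positions. -/
def inverse {r : ℕ} (M : Matrix (Fin r) (Fin r) K) : Timed (Matrix (Fin r) (Fin r) K) :=
  (List.finRange r).foldlM exchange M

/-- An orthonormal basis (the columns of the result) of the orthogonal complement of a nonzero
vector `a`, in closed form: with `v = a ± ‖a‖ e₀`, the Householder matrix `I - 2 v vᵀ / (vᵀ v)`
maps `a` to a multiple of `e₀`; drop its first column. -/
def complementBasis {r : ℕ} (a : Fin (r + 1) → K) : Timed (Matrix (Fin (r + 1)) (Fin r) K) := do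
  let one ← lit 1
  let two ← lit 2
  let zero ← lit 0
  let aa ← dot a a
  let nrm ← sqrt aa
  let b ← le zero (a 0)
  let h ← if b then add (a 0) nrm else sub (a 0) nrm
  let v : Fin (r + 1) → K := fun i => if i = 0 then h else a i
  let s ← dot v v
  mat fun i j => do
    let c ← mul (v i) (v j.succ)
    let d ← mul two c
    let e ← div d s
    if i = j.succ then sub one e else sub zero e

/-! ### The threshold -/

/-- Of the indices in a list, one with the largest weight. -/
def argMax {q : ℕ} (w : Fin q → K) : List (Fin q) → Timed (Option (Fin q))
  | [] => pure none
  | k :: l => do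
    let o ← argMax w l
    match o with
    | none => pure (some k)
    | some i => do
      let b ← le (w i) (w k)
      pure (some (if b then k else i))

/-- One step of the greedy algorithm for `Δ_A²`, the maximum of `∏_{j ∈ B} ‖a_j‖²` over all sets
`B` of linearly independent columns. The columns of `M` are those of `A` after elimination of the
columns chosen so far, so a column of `M` is nonzero if and only if the column of `A` is
independent of the chosen ones. Among these, the longest column of `A` is chosen next;
`w j = ‖a_j‖²`, and `P` is the product of the `w j` over the chosen columns. -/
def greedyStep {m n : ℕ} (w : Fin n → K) (s : Matrix (Fin m) (Fin n) K × K) :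
    Timed (Matrix (Fin m) (Fin n) K × K) := do
  let live ← nonzeroColumns s.1
  let o ← argMax w live
  match o with
  | none => pure s
  | some k => do
    let v : Fin m → K := fun i => s.1 i k
    let q ← dot v v
    let c ← vec fun j => do
      let d ← dot v (fun i => s.1 i j)
      div d q
    let M ← mat fun i j => do
      let d ← mul (c j) (v i)
      sub (s.1 i j) d
    let P ← mul s.2 (w k)
    pure (M, P)

/-- `θ_A = 1 / (m² Δ_A²)` -/
def threshold {m n : ℕ} (A : Matrix (Fin m) (Fin n) K) : Timed K := do
  let one ← lit 1
  let w ← vec fun j => dot (fun i => A i j) (fun i => A i j)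
  let s ← (List.finRange m).foldlM (fun s _ => greedyStep w s) (A, one)
  let mm ← lit m
  let d ← mul mm mm
  let e ← mul d s.2
  div one e

/-! ### First order methods

A method is given a matrix `A` with nonzero columns `a_i`, a positive definite `Q` and `ε > 0`, and
works with the vectors `a_i / ‖a_i‖_Q`, of length 1 for the scalar product `⟨u, v⟩_Q = uᵀ Q v`.
It returns `(x, y)` such that `Aᵀ Q y > 0`, or `x` is a vector of convex coefficients with
`y = ∑ x_i a_i / ‖a_i‖_Q` and `‖y‖_Q ≤ ε`. The first argument is the number of earlier calls,
the second one the budget of rounds. -/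

abbrev FirstOrderMethod (K : Type) : Type :=
  ℕ → ℕ → (r t : ℕ) → Matrix (Fin r) (Fin (t + 1)) K → Matrix (Fin r) (Fin r) K → K →
    Timed (Option ((Fin (t + 1) → K) × (Fin r → K)))

/-- Round `j` of the von Neumann algorithm, with `F = Aᵀ Q A`, `d i = ‖a_i‖_Q`, and with
`z = Aᵀ Q y` maintained along with `x` and `y`. The choice of the index `k` with
`⟨a_k, y⟩_Q ≤ 0` is arbitrary: `c j` decides. -/
def vonNeumannRound {r t : ℕ} (c : ℕ → ℕ) (A : Matrix (Fin r) (Fin (t + 1)) K)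
    (F : Matrix (Fin (t + 1)) (Fin (t + 1)) K) (d : Fin (t + 1) → K) (ε : K)
    (st : ℕ × (Fin (t + 1) → K) × (Fin r → K) × (Fin (t + 1) → K)) :
    Timed (Option ((ℕ × (Fin (t + 1) → K) × (Fin r → K) × (Fin (t + 1) → K)) ⊕
      ((Fin (t + 1) → K) × (Fin r → K)))) :=
  match st with
  | (j, x, y, z) => do
    -- `s = ‖y‖_Q²`, the sum of `x_i ⟨a_i, y⟩_Q / ‖a_i‖_Q`
    let s ← sumT fun i => do
      let e ← div (z i) (d i)
      mul (x i) e
    let nrm ← sqrt s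
    let small ← le nrm ε
    if small then pure (some (Sum.inr (x, y)))
    else do
      let cand ← filterT (fun i => do let b ← isPos (z i); pure (!b)) (List.finRange (t + 1))
      match cand with
      | [] => pure (some (Sum.inr (x, y)))
      | k₀ :: ks => do
        let k := pick (c j) k₀ ks
        let one ← lit 1
        let two ← lit 2
        -- `h = ⟨a_k / ‖a_k‖_Q, y⟩_Q`, and `l = (s - h) / (s - 2 h + 1)` is the step length
        let h ← div (z k) (d k)
        let num ← sub s h
        let h₂ ← mul two h
        let e₁ ← sub s h₂
        let den ← add e₁ one
        let l ← div num den
        let l₁ ← sub one l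
        let ld ← div l (d k)
        let x' ← vec fun i => do
          let u ← mul l₁ (x i)
          if i = k then add u l else pure u
        let y' ← vec fun i => do
          let u ← mul l₁ (y i)
          let v ← mul ld (A i k)
          add u v
        let z' ← vec fun i => do
          let u ← mul l₁ (z i)
          let v ← mul ld (F i k)
          add u v
        pure (some (Sum.inl (j + 1, x', y', z')))

/-- The von Neumann algorithm. The numbers `c s j` resolve the choices in the `s`-th call. -/
def vonNeumann (c : ℕ → ℕ → ℕ) : FirstOrderMethod K := fun calls fuel r t A Q ε => do
  let QA ← matMul Q A
  let F ← matMul A.transpose QA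
  let d ← vec fun i => sqrt (F i i)
  let x ← vec fun i : Fin (t + 1) => if i = 0 then lit 1 else lit 0
  let y ← vec fun i : Fin r => div (A i 0) (d 0)
  let z ← vec fun i => div (F i 0) (d 0)
  loop (vonNeumannRound (c calls) A F d ε) fuel (0, x, y, z)

/-- The matrices `B` with columns `a_i / ‖a_i‖_Q`, and `Q B`. -/
def normalizedColumns {r t : ℕ} (A : Matrix (Fin r) (Fin t) K) (Q : Matrix (Fin r) (Fin r) K) :
    Timed (Matrix (Fin r) (Fin t) K × Matrix (Fin r) (Fin t) K) := do
  let QA ← matMul Q A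
  let d ← vec fun i : Fin t => do
    let s ← dot (fun l => A l i) (fun l => QA l i)
    sqrt s
  let B ← mat fun l i => div (A l i) (d i)
  let QB ← mat fun l i => div (QA l i) (d i)
  pure (B, QB)

/-- `v / ∑ v_i` -/
def normalizeSum {t : ℕ} (v : Fin t → K) : Timed (Fin t → K) := do
  let s ← sumT fun i => pure (v i)
  vec fun i => div (v i) s

/-- The vector with `t` coordinates `1 / t`. -/
def uniform (t : ℕ) : Timed (Fin t → K) := do
  let one ← lit 1
  let tt ← lit t
  let u ← div one tt
  pure fun _ => u

/-- The minimizer over the simplex of `⟨g, x⟩ + μ ∑ x_i log x_i`: the normalized vector with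
coordinates `exp (-g_i / μ)`. -/
def softMin {K : Type} [ExpRealRAM K] {t : ℕ} (μ : K) (g : Fin t → K) : Timed (Fin t → K) := do
  let zero ← lit 0
  let e ← vec fun i => do
    let u ← sub zero (g i)
    let v ← div u μ
    ExpRealRAM.exp v
  normalizeSum e

/-- Round `k` of the smoothed perceptron, on the matrix `B` of normalized columns; the iterates are
`x` (in the simplex), `y` and the smoothing parameter `μ`. -/
def smoothedPerceptronRound {K : Type} [ExpRealRAM K] {r t : ℕ} (B QB : Matrix (Fin r) (Fin t) K)
    (Q : Matrix (Fin r) (Fin r) K) (ε : K) (st : ℕ × (Fin t → K) × (Fin r → K) × K) :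
    Timed (Option ((ℕ × (Fin t → K) × (Fin r → K) × K) ⊕ ((Fin t → K) × (Fin r → K)))) :=
  match st with
  | (k, x, y, μ) => do
    let g ← matVec QB.transpose y
    let feas ← allPos g
    if feas then pure (some (Sum.inr (x, y)))
    else do
      let p ← matVec B x
      let nrm ← normQ Q p
      let small ← le nrm ε
      if small then pure (some (Sum.inr (x, p)))
      else do
        let one ← lit 1
        let two ← lit 2
        let kk ← lit (k + 3)
        -- step length `τ = 2 / (k + 3)`
        let τ ← div two kk
        let τ₁ ← sub one τ
        let τ₂ ← mul τ τ
        let xs ← softMin μ g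
        let q ← matVec B xs
        -- `y' = (1 - τ) (y + τ B x) + τ² B x_μ(y)`
        let y' ← vec fun i => do
          let u ← mul τ (p i)
          let v ← add (y i) u
          let w ← mul τ₁ v
          let e ← mul τ₂ (q i)
          add w e
        let μ' ← mul τ₁ μ
        let g' ← matVec QB.transpose y'
        let xs' ← softMin μ' g'
        -- `x' = (1 - τ) x + τ x_{μ'}(y')`
        let x' ← vec fun i => do
          let u ← mul τ₁ (x i)
          let v ← mul τ (xs' i)
          add u v
        pure (some (Sum.inl (k + 1, x', y', μ')))

/-- The smoothed perceptron, with entropy smoothing. -/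
def smoothedPerceptron {K : Type} [ExpRealRAM K] : FirstOrderMethod K :=
  fun _ fuel _ t A Q ε => do
    let (B, QB) ← normalizedColumns A Q
    let u ← uniform (t + 1)
    let y ← matVec B u
    let μ ← lit 2
    let g ← matVec QB.transpose y
    let x ← softMin μ g
    loop (smoothedPerceptronRound B QB Q ε) fuel (0, x, y, μ)

/-- The prox step from the point `(u, x)` of the product of the unit ball of `‖·‖_Q` with the
simplex, for the saddle point problem `max_u min_x ⟨u, B x⟩_Q`, along the gradients at the point
`(u₁, x₁)`: a step `σ` in `u` with the Euclidean distance of `⟨·,·⟩_Q`, a step `τ` in `x` with the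
entropy distance. -/
def proxStep {K : Type} [ExpRealRAM K] {r t : ℕ} (B QB : Matrix (Fin r) (Fin t) K)
    (Q : Matrix (Fin r) (Fin r) K) (σ τ : K) (u : Fin r → K) (x : Fin t → K)
    (u₁ : Fin r → K) (x₁ : Fin t → K) : Timed ((Fin r → K) × (Fin t → K)) := do
  let zero ← lit 0
  let one ← lit 1
  let p ← matVec B x₁
  let v ← vec fun i => do
    let e ← mul σ (p i)
    add (u i) e
  let nrm ← normQ Q v
  let inside ← le nrm one
  let u' ← if inside then pure v else vec fun i => div (v i) nrm
  let g ← matVec QB.transpose u₁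
  let w ← vec fun i => do
    let a ← mul τ (g i)
    let b ← sub zero a
    let e ← ExpRealRAM.exp b
    mul (x i) e
  let x' ← normalizeSum w
  pure (u', x')

/-- Round `j` of mirror prox: an extrapolation step to `(v, w)`, a step from the old point along
the gradients at `(v, w)`, and a test of the average of all extrapolated points so far, whose sums
are `su` and `sx`. -/
def mirrorProxRound {K : Type} [ExpRealRAM K] {r t : ℕ} (B QB : Matrix (Fin r) (Fin t) K)
    (Q : Matrix (Fin r) (Fin r) K) (ε σ τ : K)
    (st : ℕ × (Fin r → K) × (Fin t → K) × (Fin r → K) × (Fin t → K)) :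
    Timed (Option ((ℕ × (Fin r → K) × (Fin t → K) × (Fin r → K) × (Fin t → K)) ⊕
      ((Fin t → K) × (Fin r → K)))) :=
  match st with
  | (j, u, x, su, sx) => do
    let (v, w) ← proxStep B QB Q σ τ u x u x
    let (u', x') ← proxStep B QB Q σ τ u x v w
    let su' ← vec fun i => add (su i) (v i)
    let sx' ← vec fun i => add (sx i) (w i)
    let jj ← lit (j + 1)
    let ua ← vec fun i => div (su' i) jj
    let xa ← vec fun i => div (sx' i) jj
    let g ← matVec QB.transpose ua
    let feas ← allPos g
    if feas then pure (some (Sum.inr (xa, ua)))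
    else do
      let p ← matVec B xa
      let nrm ← normQ Q p
      let small ← le nrm ε
      if small then pure (some (Sum.inr (xa, p)))
      else pure (some (Sum.inl (j + 1, u', x', su', sx')))

/-- Mirror prox for feasibility problems, with the step lengths `τ = √(2 log N)` and `σ = 1 / τ`,
where `N` is the number of columns (or 2, if there is only one column). -/
def mirrorProx {K : Type} [ExpRealRAM K] : FirstOrderMethod K :=
  fun _ fuel r t A Q ε => do
    let (B, QB) ← normalizedColumns A Q
    let one ← lit 1
    let two ← lit 2
    let nn ← lit (max 2 (t + 1))
    let a ← ExpRealRAM.log nn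
    let b ← mul two a
    let τ ← sqrt b
    let σ ← div one τ
    let u ← vec fun _ : Fin r => lit 0
    let s ← vec fun _ : Fin (t + 1) => lit 0
    let x ← uniform (t + 1)
    loop (mirrorProxRound B QB Q ε σ τ) fuel (0, u, x, u, s)

/-! ### The maximum support image algorithm -/

/-- The variables of the algorithm: the current matrix `A` with `rows` rows and `cols` columns
(deleted columns are not in it any more, so `T = ∅` means `cols = 0`), the matrices `R` and `Q`,
the orthonormal basis `U`, and the number of first order calls so far. -/
structure State (K : Type) (m : ℕ) where
  calls : ℕ
  rows : ℕ
  cols : ℕ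
  A : Matrix (Fin rows) (Fin cols) K
  R : Matrix (Fin rows) (Fin rows) K
  Q : Matrix (Fin rows) (Fin rows) K
  U : Matrix (Fin m) (Fin rows) K

/-- The inner loop: as long as there is a column with `‖a_k‖_Q / ‖a_k‖ < θ`, select such a column
(any one: the number `c r` decides, where `r + 1` is the current number of rows) and remove it. That
is: take an orthonormal basis `W` of the complement of `a_k`, replace `A` by `Wᵀ A` without its zero
columns, `R` by `Wᵀ R W`, `U` by `U W`, and recompute `Q`. A matrix without rows has no nonzero
columns, so the loop ends there at the latest. -/
def removeShort {m : ℕ} (c : ℕ → ℕ) (θ : K) (calls : ℕ) : (r t : ℕ) → Matrix (Fin r) (Fin t) K →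
    Matrix (Fin r) (Fin r) K → Matrix (Fin r) (Fin r) K → Matrix (Fin m) (Fin r) K →
    Timed (State K m)
  | 0, t, A, R, Q, U => pure ⟨calls, 0, t, A, R, Q, U⟩
  | r + 1, t, A, R, Q, U => do
    let QA ← matMul Q A
    let short ← filterT (fun k => do
      let s ← dot (fun i => A i k) (fun i => QA i k)
      let nq ← sqrt s
      let e ← dot (fun i => A i k) (fun i => A i k)
      let ne ← sqrt e
      let ratio ← div nq ne
      let b ← le θ ratio
      pure (!b)) (List.finRange t)
    match short with
    | [] => pure ⟨calls, r + 1, t, A, R, Q, U⟩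
    | k₀ :: ks => do
      let k := pick (c r) k₀ ks
      let W ← complementBasis fun i => A i k
      let WA ← matMul W.transpose A
      let keep ← nonzeroColumns WA
      let RW ← matMul R W
      let R' ← matMul W.transpose RW
      let U' ← matMul U W
      let Q' ← inverse R'
      removeShort c θ calls r keep.length (WA.submatrix id keep.get) R' Q' U'

/-- The rescaled matrix `(R + ∑ (x_i / ‖a_i‖_Q²) a_i a_iᵀ) / (1 + ε)`. -/
def rescale {r t : ℕ} (ε : K) (A : Matrix (Fin r) (Fin t) K) (R Q : Matrix (Fin r) (Fin r) K)
    (x : Fin t → K) : Timed (Matrix (Fin r) (Fin r) K) := do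
  let QA ← matMul Q A
  let w ← vec fun i => do
    let s ← dot (fun l => A l i) (fun l => QA l i)
    div (x i) s
  let one ← lit 1
  let e ← add one ε
  mat fun l k => do
    let s ← sumT fun i => do
      let a ← mul (A l i) (A k i)
      mul (w i) a
    let b ← add (R l k) s
    div b e

/-- One round of the main loop. -/
def mainRound {m : ℕ} (fom : FirstOrderMethod K) (c : ℕ → ℕ) (fuel : ℕ) (θ ε : K) :
    State K m → Timed (Option (State K m ⊕ (Fin m → K)))
  | ⟨_, _, 0, _, _, _, _⟩ => do
    let y ← vec fun _ => lit 0
    pure (some (Sum.inr y))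
  | ⟨calls, r, t + 1, A, R, Q, U⟩ => do
    let o ← fom calls fuel r t A Q ε
    match o with
    | none => pure none
    | some (x, y) => do
      let Qy ← matVec Q y
      let z ← matVec A.transpose Qy
      let feas ← allPos z
      if feas then do
        let ybar ← matVec U Qy
        pure (some (Sum.inr ybar))
      else do
        let R' ← rescale ε A R Q x
        let Q' ← inverse R'
        let s ← removeShort c θ (calls + 1) r (t + 1) A R' Q' U
        pure (some (Sum.inl s))

/-- The maximum support image algorithm for an integer matrix, with the first order method `fom`,
`ε = 1 / (11 m)`, and the choices of columns to be removed resolved by `c`. It starts with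
`Q = R = U = I`; zero columns of the input are deleted at once, as the algorithm does with the
zero columns that arise later. -/
def maxSupportImage {m n : ℕ} (fom : FirstOrderMethod K) (c : ℕ → ℕ)
    (A : Matrix (Fin m) (Fin n) ℤ) (fuel : ℕ) : Timed (Option (Fin m → K)) := do
  let A₀ ← mat fun i j => lit (A i j)
  let θ ← threshold A₀
  let one ← lit 1
  let d ← lit (11 * m)
  let ε ← div one d
  let keep ← nonzeroColumns A₀
  let I ← idMat m
  loop (mainRound fom c fuel θ ε) fuel ⟨0, m, keep.length, A₀.submatrix id keep.get, I, I, I⟩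

end Programs

/-- The program ends with the output `a` after `c` operations: it does so for every sufficiently
large budget of loop rounds. -/
def HaltsWith {α : Type} (prog : ℕ → Timed (Option α)) (a : α) (c : ℕ) : Prop :=
  ∃ N : ℕ, ∀ fuel ≥ N, prog fuel = ⟨some a, c⟩

/-- The support `{i | v i ≠ 0}` of a vector. -/
def supp {n : ℕ} (v : Fin n → ℝ) : Set (Fin n) := {i | v i ≠ 0}

/-- `y` is a solution of `Aᵀ y ≥ 0` of maximum support: the support of `Aᵀ y`, that is, the set of
strict inequalities, contains that of every other solution. -/
def IsMaxSupportSolution {m n : ℕ} (A : Matrix (Fin m) (Fin n) ℝ) (y : Fin m → ℝ) : Prop :=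
  0 ≤ A.transpose.mulVec y ∧
    ∀ z : Fin m → ℝ, 0 ≤ A.transpose.mulVec z →
      supp (A.transpose.mulVec z) ⊆ supp (A.transpose.mulVec y)

/-- The encoding length of an integer matrix, the total over its entries of one bit for the sign and
the number `⌈log₂ (|a| + 1)⌉` of binary digits of the absolute value. -/
def encodingLength {m n : ℕ} (A : Matrix (Fin m) (Fin n) ℤ) : ℕ :=
  ∑ i, ∑ j, (1 + Nat.size (A i j).natAbs)

/-- The integer matrix `A` as a real matrix. -/
def toReal {m n : ℕ} (A : Matrix (Fin m) (Fin n) ℤ) : Matrix (Fin m) (Fin n) ℝ :=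
  A.map fun z => (z : ℝ)

end MaxSupport

open MaxSupport

/-! The progress measure is `det R`. The ellipsoid of all `w` in the current subspace with `wᵀ R w ≤
1` always contains the solutions of length at most 1 (`form_rescale_le_one`): if `y = ∑ x_i a_i /
‖a_i‖_Q` has `‖y‖_Q ≤ ε`, then on such a solution the form added to `R` is `∑ x_i (a_i · w)² /
‖a_i‖_Q² ≤ ∑ x_i (a_i · w) / ‖a_i‖_Q = y · w ≤ ε`, which the division by `1 + ε` makes up for. Here
`0 ≤ a_i · w ≤ ‖a_i‖_Q` is used. At the same time the determinant grows by a factor of at least `2 /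
(1 + ε)^r ≥ 16 / 9` (`det_rescale_ge`).

This growth is limited. `R` has the form `α I + ∑ γ_i c_i c_iᵀ` with `α ≤ 1`, where the `c_i` are
the projected input columns, and then `γ_i ‖c_i‖_Q² ≤ 1` (`mul_inv_form_le_one`). As long as no
column is short, that is, `‖c_i‖_Q ≥ θ ‖c_i‖`, it follows that `R ≤ (1 + n / θ²) I`
(`form_le_of_long`).

A short column is orthogonal to all solutions (`IsValid.orthogonal_of_short`). Indeed, if a column
`a` is strictly positive on some solution, then by Cramer's rule and integrality it satisfies `a · y
≥ θ ‖a‖` for a solution `y` of length at most 1 (`exists_margin`), whereas the ellipsoid only allows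
`a · y ≤ ‖a‖_Q`. So the space can be cut down to the complement of the column. This multiplies `det
R` by exactly `‖a‖_Q² / ‖a‖²` (`det_complementBasis_conj`), hence loses at most a factor `M`, where
`R ≤ M I`. Altogether `(16 / 9)^calls ≤ M^m` with `M = 2^(11 L)`, so there are `O(m L)` calls
(`IsValid.pow_calls_le`). When a call returns `y` with `Aᵀ Q y > 0`, all remaining inequalities are
strict, and the input columns whose projection is zero vanish on every solution, so the support is
maximum.

In von Neumann's method `‖y‖_Q² ≤ 1 / (j + 1)` after `j` rounds, hence there are at most `121 m²`
steps of cost `O(n)`, after a preparation of cost `O(m n²)`. For the entropy-based methods,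
Pinsker's inequality makes the entropy strongly convex in the 1-norm while all normalized columns
have length 1. This gives `O(m √(log n))` rounds of cost `O(m n)`: for the smoothed perceptron by an
excessive gap invariant (`smoothedPerceptron_step`), for mirror prox by a telescoping regret bound
(`mirrorProx_step`). Full rank gives `m ≤ n`, and multiplying by the number of calls gives both
totals. -/

namespace MaxSupport

/-! ### Values and costs of the elementary programs over the reals -/

namespace Timed

variable {α β : Type}

@[ext] theorem ext' {x y : Timed α} (h : x.val = y.val) (h' : x.cost = y.cost) : x = y := by
  cases x; cases y; simp_all

@[simp] theorem pure_val (a : α) : (pure a : Timed α).val = a := rfl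
@[simp] theorem pure_cost (a : α) : (pure a : Timed α).cost = 0 := rfl
@[simp] theorem bind_val (x : Timed α) (f : α → Timed β) : (x >>= f).val = (f x.val).val := rfl
@[simp] theorem bind_cost (x : Timed α) (f : α → Timed β) :
    (x >>= f).cost = x.cost + (f x.val).cost := rfl

theorem ite_val {p : Prop} [Decidable p] (x y : Timed α) :
    (if p then x else y).val = if p then x.val else y.val := by split <;> rfl

theorem ite_cost {p : Prop} [Decidable p] (x y : Timed α) :
    (if p then x else y).cost = if p then x.cost else y.cost := by split <;> rfl

end Timed

open Timed

/-! ### Single machine instructions -/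

section Instructions

variable (x y : ℝ)

@[simp] theorem lit_val (z : ℤ) : (RealRAM.lit z : Timed ℝ).val = (z : ℝ) := rfl
@[simp] theorem lit_cost (z : ℤ) : (RealRAM.lit z : Timed ℝ).cost = 1 := rfl
@[simp] theorem add_val : (RealRAM.add x y).val = x + y := rfl
@[simp] theorem add_cost : (RealRAM.add x y).cost = 1 := rfl
@[simp] theorem sub_val : (RealRAM.sub x y).val = x - y := rfl
@[simp] theorem sub_cost : (RealRAM.sub x y).cost = 1 := rfl
@[simp] theorem mul_val : (RealRAM.mul x y).val = x * y := rfl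
@[simp] theorem mul_cost : (RealRAM.mul x y).cost = 1 := rfl
@[simp] theorem div_val : (RealRAM.div x y).val = x / y := rfl
@[simp] theorem div_cost : (RealRAM.div x y).cost = 1 := rfl
@[simp] theorem sqrt_val : (RealRAM.sqrt x).val = Real.sqrt x := rfl
@[simp] theorem sqrt_cost : (RealRAM.sqrt x).cost = 1 := rfl
@[simp] theorem le_val : (RealRAM.le x y).val = true ↔ x ≤ y := by
  classical
  change @decide (x ≤ y) (Classical.propDecidable _) = true ↔ _
  exact @decide_eq_true_iff _ (Classical.propDecidable _)
@[simp] theorem le_val_false : (RealRAM.le x y).val = false ↔ y < x := by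
  rw [← not_le, ← le_val, Bool.not_eq_true]
@[simp] theorem le_cost : (RealRAM.le x y).cost = 1 := rfl
@[simp] theorem exp_val : (ExpRealRAM.exp x).val = Real.exp x := rfl
@[simp] theorem exp_cost : (ExpRealRAM.exp x).cost = 1 := rfl
@[simp] theorem log_val : (ExpRealRAM.log x).val = Real.log x := rfl
@[simp] theorem log_cost : (ExpRealRAM.log x).cost = 1 := rfl

end Instructions

/-! ### Control structures and termination of loops -/

section Control

variable {K α : Type} {p q : ℕ}

@[simp] theorem vec_val (f : Fin p → Timed K) : (vec f).val = fun i => (f i).val := rfl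

@[simp] theorem vec_cost (f : Fin p → Timed K) : (vec f).cost = ∑ i, (f i).cost := rfl

theorem vec_cost_le {f : Fin p → Timed K} {c : ℕ} (h : ∀ i, (f i).cost ≤ c) :
    (vec f).cost ≤ p * c := by
  simpa using Finset.sum_le_sum fun i (_ : i ∈ Finset.univ) => h i

@[simp] theorem mat_val (f : Fin p → Fin q → Timed K) :
    (mat f).val = Matrix.of fun i j => (f i j).val := rfl

@[simp] theorem mat_cost (f : Fin p → Fin q → Timed K) :
    (mat f).cost = ∑ i, ∑ j, (f i j).cost := rfl

theorem mat_cost_le {f : Fin p → Fin q → Timed K} {c : ℕ} (h : ∀ i j, (f i j).cost ≤ c) :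
    (mat f).cost ≤ p * (q * c) := by
  rw [mat_cost]
  refine (Finset.sum_le_sum fun i _ => Finset.sum_le_sum fun j _ => h i j).trans ?_
  simp

theorem filterT_val (test : α → Timed Bool) (l : List α) :
    (filterT test l).val = l.filter fun a => (test a).val := by
  induction l with
  | nil => rfl
  | cons a l ih =>
    simp only [filterT, bind_val, pure_val, ih]
    cases h : (test a).val <;> simp [h]

theorem filterT_cost_le {test : α → Timed Bool} {c : ℕ} (h : ∀ a, (test a).cost ≤ c)
    (l : List α) : (filterT test l).cost ≤ l.length * c := by
  induction l with
  | nil => simp [filterT]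
  | cons a l ih =>
    simp only [filterT, bind_cost, pure_cost, List.length_cons, add_zero, add_mul, one_mul]
    have := h a
    omega

theorem allT_val (test : α → Timed Bool) (l : List α) :
    (allT test l).val = true ↔ ∀ a ∈ l, (test a).val = true := by
  induction l with
  | nil => simp [allT]
  | cons a l ih => simp [allT, ih]

theorem allT_cost_le {test : α → Timed Bool} {c : ℕ} (h : ∀ a, (test a).cost ≤ c)
    (l : List α) : (allT test l).cost ≤ l.length * c := by
  induction l with
  | nil => simp [allT]
  | cons a l ih =>
    simp only [allT, bind_cost, pure_cost, List.length_cons, add_zero, add_mul, one_mul]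
    have := h a
    omega

theorem pick_mem (c : ℕ) (k : α) (l : List α) : pick c k l ∈ k :: l := by
  unfold pick
  have h : c % (l.length + 1) < (k :: l).length := Nat.mod_lt _ (Nat.succ_pos _)
  rw [List.getD_eq_getElem _ _ h]
  exact List.getElem_mem h

/-- A loop whose rounds preserve an invariant, decrease a measure and pay for themselves from a
potential halts, independently of the budget once this is large enough. -/
theorem loop_halts {σ β : Type} {round : ℕ → σ → Timed (Option (σ ⊕ β))} {N : ℕ}
    (Inv : σ → Prop) (Post : β → Prop) (measure pot : σ → ℕ)
    (h : ∀ s, Inv s → ∃ o c, (∀ fuel ≥ N, round fuel s = ⟨some o, c⟩) ∧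
      (∀ s', o = Sum.inl s' → Inv s' ∧ measure s' < measure s ∧ c + pot s' ≤ pot s) ∧
      (∀ b, o = Sum.inr b → Post b ∧ c ≤ pot s)) (s : σ) (hs : Inv s) :
    ∃ b c, (∀ fuel ≥ N, ∀ k > measure s, loop (round fuel) k s = ⟨some b, c⟩) ∧
      Post b ∧ c ≤ pot s := by
  induction hk : measure s using Nat.strong_induction_on generalizing s with
  | _ k ih =>
    subst hk
    obtain ⟨o, c, hr, hl, hb⟩ := h s hs
    cases o with
    | inl s' =>
      obtain ⟨h1, h2, h3⟩ := hl s' rfl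
      obtain ⟨b, c', hc, hp, hle⟩ := ih _ h2 s' h1 rfl
      refine ⟨b, c + c', fun fuel hf k hk => ?_, hp, by omega⟩
      obtain ⟨k, rfl⟩ := Nat.exists_eq_succ_of_ne_zero (by omega : k ≠ 0)
      have := hc fuel hf k (by omega)
      simp only [loop]
      ext1 <;> simp [hr fuel hf, this]
    | inr b =>
      obtain ⟨h1, h2⟩ := hb b rfl
      refine ⟨b, c, fun fuel hf k hk => ?_, h1, h2⟩
      obtain ⟨k, rfl⟩ := Nat.exists_eq_succ_of_ne_zero (by omega : k ≠ 0)
      simp only [loop]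
      ext1 <;> simp [hr fuel hf]

end Control

/-! ### Sums, products, tests and norms -/

section LinearAlgebraPrograms

variable {p q s : ℕ}

theorem foldlM_sum_val_cost (f : Fin p → Timed ℝ) (l : List (Fin p)) (a : ℝ) :
    (l.foldlM (fun s i => do let v ← f i; RealRAM.add s v) a).val
        = a + (l.map fun i => (f i).val).sum ∧
      (l.foldlM (fun s i => do let v ← f i; RealRAM.add s v) a).cost
        = (l.map fun i => (f i).cost + 1).sum := by
  induction l generalizing a with
  | nil => simp
  | cons i l ih =>
    obtain ⟨h1, h2⟩ := ih (a + (f i).val)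
    constructor
    · simp only [List.foldlM_cons, bind_val, add_val, List.map_cons, List.sum_cons] at h1 ⊢
      rw [h1]; ring
    · simp only [List.foldlM_cons, bind_cost, bind_val, add_val, add_cost, List.map_cons,
        List.sum_cons] at h2 ⊢
      rw [h2]

@[simp] theorem sumT_val (f : Fin p → Timed ℝ) : (sumT f).val = ∑ i, (f i).val := by
  have h := (foldlM_sum_val_cost f (List.finRange p) ((0 : ℤ) : ℝ)).1
  rw [Int.cast_zero, zero_add, ← List.ofFn_eq_map, List.sum_ofFn] at h
  rw [← h]
  simp [sumT, Bind.bindLeft]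

@[simp] theorem sumT_cost (f : Fin p → Timed ℝ) :
    (sumT f).cost = 1 + ∑ i, ((f i).cost + 1) := by
  have h := (foldlM_sum_val_cost f (List.finRange p) ((0 : ℤ) : ℝ)).2
  rw [← List.ofFn_eq_map, List.sum_ofFn] at h
  rw [← h]
  simp [sumT, Bind.bindLeft]

@[simp] theorem dot_val (u v : Fin p → ℝ) : (dot u v).val = u ⬝ᵥ v := by
  simp [dot, dotProduct]

@[simp] theorem dot_cost (u v : Fin p → ℝ) : (dot u v).cost = 1 + p * 2 := by
  simp [dot]

@[simp] theorem matMul_val (A : Matrix (Fin p) (Fin q) ℝ) (B : Matrix (Fin q) (Fin s) ℝ) :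
    (matMul A B).val = A * B := by
  ext i j; simp [matMul, Matrix.mul_apply]

@[simp] theorem matMul_cost (A : Matrix (Fin p) (Fin q) ℝ) (B : Matrix (Fin q) (Fin s) ℝ) :
    (matMul A B).cost = p * (s * (1 + q * 2)) := by
  simp [matMul]

@[simp] theorem matVec_val (A : Matrix (Fin p) (Fin q) ℝ) (v : Fin q → ℝ) :
    (matVec A v).val = A.mulVec v := by
  ext i; simp [matVec, Matrix.mulVec]

@[simp] theorem matVec_cost (A : Matrix (Fin p) (Fin q) ℝ) (v : Fin q → ℝ) :
    (matVec A v).cost = p * (1 + q * 2) := by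
  simp [matVec]

@[simp] theorem idMat_val : (idMat p : Timed (Matrix (Fin p) (Fin p) ℝ)).val = 1 := by
  ext i j; simp [idMat, Timed.ite_val, Matrix.one_apply]

@[simp] theorem idMat_cost : (idMat p : Timed (Matrix (Fin p) (Fin p) ℝ)).cost = p * p := by
  simp [idMat, Timed.ite_cost]

@[simp] theorem isPos_val (x : ℝ) : (isPos x).val = true ↔ 0 < x := by
  simp [isPos]

@[simp] theorem isPos_val_false (x : ℝ) : (isPos x).val = false ↔ x ≤ 0 := by
  rw [← not_lt, ← isPos_val, Bool.not_eq_true]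

@[simp] theorem isPos_cost (x : ℝ) : (isPos x).cost = 2 := by
  simp [isPos]

@[simp] theorem isZero_val (x : ℝ) : (isZero x).val = true ↔ x = 0 := by
  simp [isZero, ← le_antisymm_iff]

@[simp] theorem isZero_cost (x : ℝ) : (isZero x).cost = 3 := by
  simp [isZero]

theorem allPos_val (v : Fin p → ℝ) : (allPos v).val = true ↔ ∀ i, 0 < v i := by
  simp [allPos, allT_val]

theorem allPos_cost_le (v : Fin p → ℝ) : (allPos v).cost ≤ p * 2 := by
  exact (allT_cost_le (c := 2) (fun i => (isPos_cost _).le) _).trans (by simp)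

theorem mem_nonzeroColumns (A : Matrix (Fin p) (Fin q) ℝ) (j : Fin q) :
    j ∈ (nonzeroColumns A).val ↔ A.col j ≠ 0 := by
  simp only [nonzeroColumns, filterT_val, List.mem_filter, List.mem_finRange, true_and,
    bind_val, pure_val, Bool.not_eq_true']
  rw [← Bool.not_eq_true, not_iff_not, allT_val]
  simp [funext_iff]

theorem nonzeroColumns_length_le (A : Matrix (Fin p) (Fin q) ℝ) :
    (nonzeroColumns A).val.length ≤ q := by
  simp only [nonzeroColumns, filterT_val]
  exact (List.length_filter_le _ _).trans (by simp)

theorem nonzeroColumns_cost_le (A : Matrix (Fin p) (Fin q) ℝ) :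
    (nonzeroColumns A).cost ≤ q * (p * 3) := by
  refine (filterT_cost_le (c := p * 3) (fun j => ?_) _).trans (by simp)
  simpa using allT_cost_le (test := fun i => isZero (A i j)) (fun i => (isZero_cost _).le)
    (List.finRange p)

@[simp] theorem normQ_val (Q : Matrix (Fin p) (Fin p) ℝ) (v : Fin p → ℝ) :
    (normQ Q v).val = √(v ⬝ᵥ Q.mulVec v) := by
  simp [normQ]

@[simp] theorem normQ_cost (Q : Matrix (Fin p) (Fin p) ℝ) (v : Fin p → ℝ) :
    (normQ Q v).cost = p * (1 + p * 2) + (1 + p * 2 + 1) := by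
  simp [normQ]

end LinearAlgebraPrograms

end MaxSupport

namespace MaxSupport

open Timed Matrix

/-! ### Gauss–Jordan inversion -/

theorem foldlM_val {α σ : Type} (f : σ → α → Timed σ) (l : List α) (a : σ) :
    (l.foldlM f a).val = l.foldl (fun s x => (f s x).val) a := by
  induction l generalizing a with
  | nil => rfl
  | cons x l ih => simp [List.foldlM_cons, ih]

theorem foldlM_cost_le {α σ : Type} {f : σ → α → Timed σ} {c : ℕ} (h : ∀ s x, (f s x).cost ≤ c)
    (l : List α) (a : σ) : (l.foldlM f a).cost ≤ l.length * c := by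
  induction l generalizing a with
  | nil => simp
  | cons x l ih =>
    simp only [List.foldlM_cons, bind_cost, List.length_cons, add_mul, one_mul]
    have := h a x
    have := ih (f a x).val
    omega

variable {r : ℕ}

theorem exchange_cost_le (M : Matrix (Fin r) (Fin r) ℝ) (p : Fin r) :
    (exchange M p).cost ≤ 2 + r * (r * 3) := by
  have h : ∀ i j, (if i = p then
      if j = p then RealRAM.div (1 : ℝ) (M p p)
      else do let c ← RealRAM.div (M p j) (M p p); RealRAM.sub (0 : ℝ) c
    else
      if j = p then RealRAM.div (M i p) (M p p)
      else do
        let c ← RealRAM.mul (M i p) (M p j)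
        let d ← RealRAM.div c (M p p)
        RealRAM.sub (M i j) d).cost ≤ 3 := by
    intro i j
    split_ifs <;> simp
  have := mat_cost_le h
  simp only [exchange, bind_cost, lit_cost, lit_val, Int.cast_one, Int.cast_zero]
  omega

theorem inverse_cost_le (M : Matrix (Fin r) (Fin r) ℝ) :
    (inverse M).cost ≤ r * (2 + r * (r * 3)) := by
  exact (foldlM_cost_le exchange_cost_le (List.finRange r) M).trans (by simp)

theorem exchange_val_apply (M : Matrix (Fin r) (Fin r) ℝ) (p i j : Fin r) :
    (exchange M p).val i j =
      if i = p then if j = p then 1 / M p p else -(M p j / M p p)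
      else if j = p then M i p / M p p else M i j - M i p * M p j / M p p := by
  simp only [exchange, bind_val, mat_val, of_apply, lit_val]
  split_ifs <;> simp

/-- Both equations say that `x_p = (y_p - a_p) / N_pp`, where `a` is the part of `N x` without the
variable `x_p`, and that the other rows hold with this value substituted. -/
theorem exchange_iff {N : Matrix (Fin r) (Fin r) ℝ} {p : Fin r} (hp : N p p ≠ 0)
    (x y : Fin r → ℝ) :
    y = N *ᵥ x ↔
      Function.update y p (x p) = (exchange N p).val *ᵥ Function.update x p (y p) := by
  set a : Fin r → ℝ := fun i => ∑ j ∈ Finset.univ.erase p, N i j * x j with ha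
  have h1 : ∀ i, (N *ᵥ x) i = N i p * x p + a i := fun i => by
    rw [mulVec, dotProduct, ← Finset.add_sum_erase _ _ (Finset.mem_univ p)]
  have h2 : ((exchange N p).val *ᵥ Function.update x p (y p)) p = (y p - a p) / N p p := by
    rw [mulVec, dotProduct, ← Finset.add_sum_erase _ _ (Finset.mem_univ p),
      Finset.sum_congr rfl (g := fun j => -(N p j * x j) * (N p p)⁻¹)]
    · rw [← Finset.sum_mul, Finset.sum_neg_distrib]
      simp only [exchange_val_apply, if_true, Function.update_self, ha]
      ring
    · intro j hj
      have hj := Finset.ne_of_mem_erase hj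
      simp only [exchange_val_apply, if_true, if_neg hj, Function.update_of_ne hj]
      ring
  have h3 : ∀ i ≠ p, ((exchange N p).val *ᵥ Function.update x p (y p)) i
      = N i p * ((y p - a p) / N p p) + a i := fun i hi => by
    rw [mulVec, dotProduct, ← Finset.add_sum_erase _ _ (Finset.mem_univ p),
      Finset.sum_congr rfl (g := fun j => N i j * x j - N i p / N p p * (N p j * x j))]
    · rw [Finset.sum_sub_distrib, ← Finset.mul_sum]
      simp only [exchange_val_apply, if_true, if_neg hi, Function.update_self, ha]
      ring
    · intro j hj
      have hj := Finset.ne_of_mem_erase hj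
      simp only [exchange_val_apply, if_neg hi, if_neg hj, Function.update_of_ne hj]
      ring
  constructor
  · intro h
    have hx : x p = (y p - a p) / N p p := by
      rw [eq_div_iff hp, congrFun h p, h1]; ring
    funext i
    by_cases hi : i = p
    · subst hi; rw [h2, Function.update_self, hx]
    · rw [h3 i hi, Function.update_of_ne hi, ← hx, congrFun h i, h1]
  · intro h
    have hx : x p = (y p - a p) / N p p := by
      rw [← h2, ← h, Function.update_self]
    funext i
    by_cases hi : i = p
    · subst hi; rw [h1, hx]; field_simp; ring
    · rw [h1, hx, ← h3 i hi, ← h, Function.update_of_ne hi]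

/-- `N` arises from `M` by exchanging the variables in `S`. -/
def IsExchanged (M N : Matrix (Fin r) (Fin r) ℝ) (S : Finset (Fin r)) : Prop :=
  ∀ u v : Fin r → ℝ, v = M *ᵥ u ↔
    (fun i => if i ∈ S then u i else v i) = N *ᵥ fun i => if i ∈ S then v i else u i

/-- No search for pivots is needed. Feeding the unit vector `e_p` into `N` yields a pair `v = M u`
with `u_i v_i = 0` for all `i ≠ p`, so `uᵀ M u` is the pivot `N p p`, and `u ≠ 0` because `u_p = 1`.
-/
theorem IsExchanged.pivot_pos {M N : Matrix (Fin r) (Fin r) ℝ} {S : Finset (Fin r)}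
    (h : IsExchanged M N S) (hM : M.PosDef) {p : Fin r} (hp : p ∉ S) : 0 < N p p := by
  set e : Fin r → ℝ := Pi.single p 1
  set o := N *ᵥ e with ho
  set u : Fin r → ℝ := fun i => if i ∈ S then o i else e i with hu
  set v : Fin r → ℝ := fun i => if i ∈ S then e i else o i with hv
  have hvu : v = M *ᵥ u := by
    rw [h u v]
    have h1 : (fun i => if i ∈ S then u i else v i) = o := by
      funext i; by_cases hi : i ∈ S <;> simp [hu, hv, hi]
    have h2 : (fun i => if i ∈ S then v i else u i) = e := by
      funext i; by_cases hi : i ∈ S <;> simp [hu, hv, hi]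
    rw [h1, h2]
  have hu0 : u ≠ 0 := fun h0 => by
    have := congrFun h0 p
    simp [hu, hp, e] at this
  have hpos := hM.dotProduct_mulVec_pos hu0
  rw [← hvu] at hpos
  have hsum : star u ⬝ᵥ v = o p := by
    rw [dotProduct, Finset.sum_eq_single p]
    · simp [hu, hv, hp, e]
    · intro i _ hi
      by_cases hiS : i ∈ S <;> simp [hu, hv, hiS, e, Pi.single_eq_of_ne hi]
    · simp
  rw [hsum, ho] at hpos
  simpa [e] using hpos

theorem IsExchanged.step {M N : Matrix (Fin r) (Fin r) ℝ} {S : Finset (Fin r)}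
    (h : IsExchanged M N S) (hM : M.PosDef) {p : Fin r} (hp : p ∉ S) :
    IsExchanged M (exchange N p).val (insert p S) := by
  intro u v
  rw [h u v, exchange_iff (h.pivot_pos hM hp).ne']
  have h1 : ∀ a b : Fin r → ℝ,
      Function.update (fun i => if i ∈ S then a i else b i) p (if p ∈ S then b p else a p)
        = fun i => if i ∈ insert p S then a i else b i := by
    intro a b; funext i
    by_cases hi : i = p
    · subst hi; simp [hp]
    · simp [hi]
  rw [h1 u v, h1 v u]

/-- After exchange of all variables, `v = M u` is equivalent to `u = N v`, hence `N M` fixes every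
unit vector. -/
theorem inverse_val {M : Matrix (Fin r) (Fin r) ℝ} (hM : M.PosDef) : (inverse M).val = M⁻¹ := by
  have key : ∀ (l : List (Fin r)) (N : Matrix (Fin r) (Fin r) ℝ) (S : Finset (Fin r)),
      IsExchanged M N S → l.Nodup → (∀ p ∈ l, p ∉ S) →
      IsExchanged M (l.foldl (fun s x => (exchange s x).val) N) (S ∪ l.toFinset) := by
    intro l
    induction l with
    | nil => intro N S h _ _; simpa using h
    | cons p l ih =>
      intro N S h hl hS
      have := ih _ _ (h.step hM (hS p (by simp))) (List.nodup_cons.1 hl).2 (by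
        intro q hq
        rw [Finset.mem_insert, not_or]
        exact ⟨fun hqp => (List.nodup_cons.1 hl).1 (hqp ▸ hq), hS q (by simp [hq])⟩)
      simpa [List.toFinset_cons, Finset.union_insert, Finset.insert_union] using this
  have h := key (List.finRange r) M ∅ (fun u v => by simp) (List.nodup_finRange r) (by simp)
  rw [inverse, foldlM_val]
  set N := (List.finRange r).foldl (fun s x => (exchange s x).val) M
  symm
  refine inv_eq_left_inv (ext_of_mulVec_single fun i => ?_)
  have := (h (Pi.single i 1) _).1 rfl
  simp only [Finset.empty_union, List.mem_toFinset, List.mem_finRange, if_true] at this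
  rw [one_mulVec, ← mulVec_mulVec]
  exact this.symm

/-! ### The Householder basis of an orthogonal complement -/

theorem complementBasis_cost_le (a : Fin (r + 1) → ℝ) :
    (complementBasis a).cost ≤ 8 + 4 * (r + 1) + (r + 1) * (r * 4) := by
  simp only [complementBasis, bind_cost, lit_cost, lit_val, dot_cost, sqrt_cost,
    le_cost]
  split_ifs <;>
  · simp [Timed.ite_cost]
    ring_nf
    omega

/-- A Householder reflection whose first column is a multiple of `a`. -/
theorem complementBasis_val {a : Fin (r + 1) → ℝ} (ha : a ≠ 0) :
    ∃ (H : Matrix (Fin (r + 1)) (Fin (r + 1)) ℝ) (β : ℝ), β * β = a ⬝ᵥ a ∧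
      H * H = 1 ∧ Hᵀ = H ∧ β • H.col 0 = a ∧
        (complementBasis a).val = H.submatrix id Fin.succ := by
  have haa : 0 < a ⬝ᵥ a := by
    have := dotProduct_star_self_pos_iff.2 ha
    simpa using this
  -- `κ = ±‖a‖` carries the sign of `a 0`. Since `v ⬝ᵥ v = 2 κ (κ + a 0)`, this choice keeps the
  -- Householder vector away from zero.
  obtain ⟨κ, hκ, hpos, hval⟩ : ∃ κ : ℝ, κ * κ = a ⬝ᵥ a ∧ 0 < κ * (κ + a 0) ∧
      (complementBasis a).val =
        (let v : Fin (r + 1) → ℝ := fun i => if i = 0 then a 0 + κ else a i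
         of fun (i : Fin (r + 1)) (j : Fin r) =>
          (if i = j.succ then 1 else 0) - 2 * (v i * v j.succ) / (v ⬝ᵥ v)) := by
    have hn := Real.mul_self_sqrt haa.le
    have hn0 := Real.sqrt_pos.2 haa
    by_cases h0 : 0 ≤ a 0
    · refine ⟨√(a ⬝ᵥ a), hn, by positivity, ?_⟩
      have hb : (RealRAM.le ((0 : ℤ) : ℝ) (a 0)).val = true := by simpa using h0
      simp only [complementBasis, bind_val, lit_val, dot_val, sqrt_val, hb, if_true, add_val]
      ext i j
      simp only [mat_val, of_apply, bind_val, mul_val, div_val]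
      split_ifs <;> simp
    · refine ⟨-√(a ⬝ᵥ a), by simpa using hn, by nlinarith, ?_⟩
      have hb : (RealRAM.le ((0 : ℤ) : ℝ) (a 0)).val = false := by simpa using h0
      simp only [complementBasis, bind_val, lit_val, dot_val, sqrt_val, hb, sub_val,
        Bool.false_eq_true, if_false]
      ext i j
      simp only [mat_val, of_apply, bind_val, mul_val, div_val, ← sub_eq_add_neg]
      split_ifs <;> simp
  set v : Fin (r + 1) → ℝ := fun i => if i = 0 then a 0 + κ else a i with hv
  have hva : v = a + κ • Pi.single 0 1 := by
    funext i
    by_cases hi : i = 0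
    · subst hi; simp [hv]
    · simp [hv, hi]
  have hvv : v ⬝ᵥ v = 2 * (κ * (κ + a 0)) := by
    rw [hva]
    simp [add_dotProduct, ← hκ]
    ring
  have hvv0 : v ⬝ᵥ v ≠ 0 := by rw [hvv]; positivity
  have hκ0 : κ ≠ 0 := fun h => by simp [h] at hpos
  refine ⟨1 - (2 / (v ⬝ᵥ v)) • vecMulVec v v, -κ, by rw [← hκ]; ring, ?_, ?_, ?_, ?_⟩
  · have : vecMulVec v v * vecMulVec v v = (v ⬝ᵥ v) • vecMulVec v v := by
      rw [vecMulVec_mul_vecMulVec, vecMulVec_smul]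
    simp only [sub_mul, mul_sub, one_mul, mul_one, Matrix.smul_mul, Matrix.mul_smul, this, smul_smul]
    rw [div_mul_cancel₀ _ hvv0]
    module
  · ext i j
    simp [vecMulVec_apply, one_apply, eq_comm, mul_comm]
  · funext i
    have h0 : κ + a 0 ≠ 0 := fun h => by simp [h] at hpos
    have hv0 : v 0 = κ + a 0 := by simp [hv, add_comm]
    have hvi : v i = a i + κ * (1 : Matrix (Fin (r + 1)) (Fin (r + 1)) ℝ) i 0 := by
      rw [hva]; simp [one_apply, Pi.single_apply]
    simp only [Pi.smul_apply, col_apply, Matrix.sub_apply, Matrix.smul_apply, vecMulVec_apply, smul_eq_mul,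
      hvv, hv0, hvi]
    field_simp
    ring
  · rw [hval]
    ext i j
    simp [vecMulVec_apply, one_apply, mul_div_right_comm]

variable {a : Fin (r + 1) → ℝ}

theorem complementBasis_transpose_mul_self (ha : a ≠ 0) :
    (complementBasis a).valᵀ * (complementBasis a).val = 1 := by
  obtain ⟨H, β, -, hH, hT, -, hW⟩ := complementBasis_val ha
  rw [hW, transpose_submatrix, hT, ← submatrix_mul _ _ _ _ _ Function.bijective_id, hH]
  ext i j
  simp [one_apply]

/-- The first column of the reflection `H` is parallel to `a`, so `H w` has first coordinate zero
for `w ⊥ a`. Therefore the dropped column contributes nothing to `H (H w) = w`. -/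
theorem complementBasis_mulVec_transpose_mulVec (ha : a ≠ 0) {w : Fin (r + 1) → ℝ}
    (hw : a ⬝ᵥ w = 0) :
    (complementBasis a).val *ᵥ (complementBasis a).valᵀ *ᵥ w = w := by
  obtain ⟨H, β, hβ, hH, hT, hcol, hW⟩ := complementBasis_val ha
  have hβ0 : β ≠ 0 := fun h => by
    rw [h, zero_mul] at hβ
    exact ha (dotProduct_self_eq_zero.1 hβ.symm)
  have h0 : (H *ᵥ w) 0 = 0 := by
    have : β * (H.col 0 ⬝ᵥ w) = 0 := by rw [← smul_eq_mul, ← smul_dotProduct, hcol, hw]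
    have h2 := (mul_eq_zero.1 this).resolve_left hβ0
    rw [← h2, mulVec]
    congr 1
    funext j
    rw [col_apply, ← transpose_apply H, hT]
  have h1 : w = H *ᵥ H *ᵥ w := by rw [mulVec_mulVec, hH, one_mulVec]
  conv_rhs => rw [h1]
  funext i
  rw [hW]
  simp only [mulVec, dotProduct] at h0 ⊢
  rw [Fin.sum_univ_succ (n := r), h0]
  simp only [submatrix_apply, transpose_apply, id, mul_zero, zero_add]
  refine Finset.sum_congr rfl fun j _ => ?_
  congr 1
  refine Finset.sum_congr rfl fun k _ => ?_
  rw [← transpose_apply H, hT]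

/-- The compressed matrix is the minor of `H R H` without row and column 0, hence the corresponding
entry of the adjugate. That entry is `det R` times `(H R⁻¹ H) 0 0`, and column 0 of `H` is `a / β`
with `β² = ‖a‖²`. -/
theorem det_complementBasis_conj (ha : a ≠ 0) {R : Matrix (Fin (r + 1)) (Fin (r + 1)) ℝ}
    (hR : IsUnit R.det) :
    ((complementBasis a).valᵀ * (R * (complementBasis a).val)).det * (a ⬝ᵥ a)
      = R.det * (a ⬝ᵥ R⁻¹ *ᵥ a) := by
  obtain ⟨H, β, hβ, hH, hT, hcol, hW⟩ := complementBasis_val ha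
  have hdet : H.det * H.det = 1 := by rw [← det_mul, hH, det_one]
  have hsub : (complementBasis a).valᵀ * (R * (complementBasis a).val)
      = (H * R * H).submatrix Fin.succ Fin.succ := by
    rw [hW, transpose_submatrix, hT, Matrix.mul_assoc,
      submatrix_mul H (R * H) Fin.succ id Fin.succ Function.bijective_id,
      submatrix_mul R H id id Fin.succ Function.bijective_id, submatrix_id_id]
  have hadj := adjugate_fin_succ_eq_det_submatrix (H * R * H) 0 0
  simp only [Fin.val_zero, add_zero, pow_zero, one_mul, Fin.succAbove_zero] at hadj
  rw [hsub]
  change ((H * R * H).submatrix Fin.succ Fin.succ).det * _ = _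
  have hinv : (H * R * H)⁻¹ = H * R⁻¹ * H := by
    refine inv_eq_left_inv ?_
    calc H * R⁻¹ * H * (H * R * H) = H * R⁻¹ * (H * H) * R * H := by
          simp only [Matrix.mul_assoc]
      _ = 1 := by rw [hH, Matrix.mul_one, Matrix.mul_assoc H, nonsing_inv_mul _ hR,
          Matrix.mul_one, hH]
  have hdet2 : (H * R * H).det = R.det := by
    rw [det_mul, det_mul]; linear_combination R.det * hdet
  have hunit : IsUnit (H * R * H).det := by rwa [hdet2]
  have h3 : (H * R * H).adjugate = R.det • (H * R⁻¹ * H) := by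
    rw [← hinv, inv_def, smul_smul, ← hdet2, Ring.mul_inverse_cancel _ hunit, one_smul]
  rw [← hadj, h3, ← hβ, Matrix.smul_apply, smul_eq_mul, mul_assoc]
  congr 1
  have h4 : (H * R⁻¹ * H) 0 0 = H.col 0 ⬝ᵥ R⁻¹ *ᵥ H.col 0 := by
    rw [Matrix.mul_assoc, mul_apply, dotProduct]
    exact Finset.sum_congr rfl fun j _ => congrArg (· * _) (congrFun₂ hT j 0)
  rw [h4]
  conv_rhs => rw [← hcol]
  simp only [smul_dotProduct, mulVec_smul, dotProduct_smul, smul_eq_mul]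
  ring

end MaxSupport

namespace MaxSupport

open Timed Matrix

/-! ### The greedy algorithm -/

theorem argMax_val {q : ℕ} (w : Fin q → ℝ) (l : List (Fin q)) :
    ((argMax w l).val = none ∧ l = []) ∨
      ∃ k ∈ l, (argMax w l).val = some k ∧ ∀ j ∈ l, w j ≤ w k := by
  induction l with
  | nil => left; simp [argMax]
  | cons k l ih =>
    right
    rcases ih with ⟨h, rfl⟩ | ⟨i, hi, h, hmax⟩
    · exact ⟨k, by simp, by simp [argMax], by simp⟩
    · rcases le_or_gt (w i) (w k) with hik | hik
      · refine ⟨k, by simp, ?_, ?_⟩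
        · simp [argMax, h, (le_val _ _).2 hik]
        · intro j hj
          rcases List.mem_cons.1 hj with rfl | hj
          · exact le_rfl
          · exact (hmax j hj).trans hik
      · refine ⟨i, by simp [hi], ?_, ?_⟩
        · simp [argMax, h, (le_val_false _ _).2 hik]
        · intro j hj
          rcases List.mem_cons.1 hj with rfl | hj
          · exact hik.le
          · exact hmax j hj

theorem argMax_cost_le {q : ℕ} (w : Fin q → ℝ) (l : List (Fin q)) :
    (argMax w l).cost ≤ l.length := by
  induction l with
  | nil => simp [argMax]
  | cons k l ih =>
    simp only [argMax, bind_cost, List.length_cons]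
    cases (argMax w l).val <;> simp <;> omega

variable {m n : ℕ}

theorem greedyStep_cost_le (w : Fin n → ℝ) (s : Matrix (Fin m) (Fin n) ℝ × ℝ) :
    (greedyStep w s).cost ≤ 7 * (m * n) + 3 * n + 2 * m + 2 := by
  have h1 := nonzeroColumns_cost_le s.1
  have h2 := argMax_cost_le w (nonzeroColumns s.1).val
  have h3 := nonzeroColumns_length_le s.1
  simp only [greedyStep, bind_cost]
  cases (argMax w (nonzeroColumns s.1).val).val with
  | none => simp only [pure_cost]; nlinarith
  | some k =>
    simp
    nlinarith

/-- The coefficients `c` stay unspecified: the analysis needs only that multiples of the pivot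
column are subtracted, that zero columns stay zero and that the pivot column becomes zero. -/
theorem greedyStep_val (w : Fin n → ℝ) (M : Matrix (Fin m) (Fin n) ℝ) (P : ℝ) :
    ((greedyStep w (M, P)).val = (M, P) ∧ ∀ j, M.col j = 0) ∨
      ∃ (k : Fin n) (c : Fin n → ℝ) (M' : Matrix (Fin m) (Fin n) ℝ),
        (greedyStep w (M, P)).val = (M', P * w k) ∧ M.col k ≠ 0 ∧
        (∀ j, M.col j ≠ 0 → w j ≤ w k) ∧ (∀ j, M'.col j = M.col j - c j • M.col k) ∧
        (∀ j, M.col j = 0 → M'.col j = 0) ∧ M'.col k = 0 := by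
  rcases argMax_val w (nonzeroColumns M).val with ⟨h, hl⟩ | ⟨k, hk, h, hmax⟩
  · left
    refine ⟨by simp [greedyStep, h], fun j => ?_⟩
    by_contra hj
    have := (mem_nonzeroColumns M j).2 hj
    simp [hl] at this
  · right
    have hk0 := (mem_nonzeroColumns M k).1 hk
    set c : Fin n → ℝ := fun j => (M.col k ⬝ᵥ M.col j) / (M.col k ⬝ᵥ M.col k)
    have hM' : ∀ j, (of fun i j => M i j - c j * M i k : Matrix (Fin m) (Fin n) ℝ).col j
        = M.col j - c j • M.col k := fun j => by
      funext i; simp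
    refine ⟨k, c, of fun i j => M i j - c j * M i k, ?_, hk0,
      fun j hj => hmax j ((mem_nonzeroColumns M j).2 hj), hM', fun j hj => ?_, ?_⟩
    · simp only [greedyStep, bind_val, h, dot_val, vec_val, mat_val, mul_val, sub_val, div_val,
        pure_val]
      rfl
    · rw [hM', hj]; simp [c, hj]
    · rw [hM']
      have : c k = 1 := div_self fun h0 => hk0 (dotProduct_self_eq_zero.1 h0)
      simp [this]

/-- The exchange property behind the greedy algorithm: elimination of `v` costs an independent
family at most one member. If `b` is such that `v` is not in the span of the others, then in a
relation among the `f j - c j • v` with `j ≠ b` the total coefficient of `v` must vanish, which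
leaves a relation among the `f j`. -/
theorem exists_exchange {ι V : Type*} [DecidableEq ι] [AddCommGroup V] [Module ℝ V] {f : ι → V}
    {B : Finset ι} (hB : LinearIndepOn ℝ f (B : Set ι)) (hne : B.Nonempty) {v : V} (hv : v ≠ 0)
    (c : ι → ℝ) :
    ∃ b ∈ B, LinearIndepOn ℝ (fun j => f j - c j • v) (B.erase b : Set ι) := by
  rw [linearIndepOn_finset_iff] at hB
  -- Otherwise `v ≠ 0` has a representation that uses some `j`, and another one that avoids `j`.
  -- Their difference is a nontrivial relation.
  obtain ⟨b, hb, hvb⟩ : ∃ b ∈ B, ∀ g : ι → ℝ, ∑ j ∈ B.erase b, g j • f j ≠ v := by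
    by_contra! h
    obtain ⟨b, hb⟩ := hne
    obtain ⟨g, hg⟩ := h b hb
    obtain ⟨j, hj, hgj⟩ : ∃ j ∈ B.erase b, g j • f j ≠ 0 := by
      by_contra! h0
      exact hv (by rw [← hg, Finset.sum_eq_zero h0])
    obtain ⟨hjb, hjB⟩ := Finset.mem_erase.1 hj
    obtain ⟨g', hg'⟩ := h j hjB
    have h1 : ∀ (i : ι), i ∈ B → ∀ g : ι → ℝ,
        ∑ l ∈ B, (if l = i then 0 else g l) • f l = ∑ l ∈ B.erase i, g l • f l := by
      intro i hi g
      rw [← Finset.add_sum_erase _ _ hi, if_pos rfl, zero_smul, zero_add]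
      exact Finset.sum_congr rfl fun l hl => by rw [if_neg (Finset.ne_of_mem_erase hl)]
    have h2 := hB (fun l => (if l = b then 0 else g l) - (if l = j then 0 else g' l)) (by
      simp only [sub_smul, Finset.sum_sub_distrib]
      rw [h1 b hb, h1 j hjB, hg, hg', sub_self]) j hjB
    simp only [if_neg hjb, if_true, sub_zero] at h2
    exact hgj (by rw [h2, zero_smul])
  refine ⟨b, hb, ?_⟩
  rw [linearIndepOn_finset_iff]
  intro g hg
  simp only [smul_sub, smul_smul, Finset.sum_sub_distrib, ← Finset.sum_smul] at hg
  set γ := ∑ j ∈ B.erase b, g j * c j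
  have hγ : γ = 0 := by
    by_contra hγ
    refine hvb (fun j => γ⁻¹ * g j) ?_
    simp only [mul_smul, ← Finset.smul_sum]
    rw [sub_eq_zero.1 hg, smul_smul, inv_mul_cancel₀ hγ, one_smul]
  rw [hγ, zero_smul, sub_zero] at hg
  intro i hi
  have := hB (fun l => if l = b then 0 else g l) (by
    rw [← Finset.add_sum_erase _ _ hb, if_pos rfl, zero_smul, zero_add, ← hg]
    exact Finset.sum_congr rfl fun l hl => by rw [if_neg (Finset.ne_of_mem_erase hl)]) i
      (Finset.mem_of_mem_erase hi)
  simpa [Finset.ne_of_mem_erase hi] using this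

/-- Each greedy step is charged to the member of `B` that the exchange property gives up: it was
available, so its weight is at most that of the chosen column. Once `B` is used up, further factors
do no harm because weights of nonzero columns are at least 1. -/
theorem greedy_ge {w : Fin n → ℝ} (N : ℕ) : ∀ (M : Matrix (Fin m) (Fin n) ℝ) (P : ℝ)
    (B : Finset (Fin n)), 0 < P → (∀ j, M.col j ≠ 0 → 1 ≤ w j) →
    LinearIndepOn ℝ M.col (B : Set (Fin n)) → B.card ≤ N →
    P * ∏ j ∈ B, w j ≤ ((fun s => (greedyStep w s).val)^[N] (M, P)).2 := by
  induction N with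
  | zero =>
    intro M P B _ _ _ hc
    simp [Finset.card_eq_zero.1 (Nat.le_zero.1 hc)]
  | succ N ih =>
    intro M P B hP hw hB hc
    rw [Function.iterate_succ_apply]
    rcases greedyStep_val w M P with ⟨h, h0⟩ | ⟨k, c, M', h, hk, hmax, hM', hzero, -⟩
    · rw [h]
      have : B = ∅ := by
        by_contra hne
        obtain ⟨b, hb⟩ := Finset.nonempty_iff_ne_empty.2 hne
        exact hB.ne_zero hb (h0 b)
      subst this
      exact ih M P ∅ hP hw hB (by simp)
    · rw [h]
      have hwk := hw k hk
      have hw' : ∀ j, M'.col j ≠ 0 → 1 ≤ w j := fun j hj => hw j (mt (hzero j) hj)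
      have hPk : 0 < P * w k := by positivity
      rcases B.eq_empty_or_nonempty with rfl | hne
      · have := ih M' (P * w k) ∅ hPk hw' (by simp) (by simp)
        simp only [Finset.prod_empty, mul_one] at this ⊢
        nlinarith
      · obtain ⟨b, hb, hB'⟩ := exists_exchange hB hne hk c
        have h1 := ih M' (P * w k) (B.erase b) hPk hw' (by
          have : M'.col = fun j => M.col j - c j • M.col k := funext hM'
          rwa [this]) (by rw [Finset.card_erase_of_mem hb]; omega)
        refine le_trans ?_ h1
        rw [← Finset.mul_prod_erase _ _ hb, ← mul_assoc]
        refine mul_le_mul_of_nonneg_right ?_ (Finset.prod_nonneg fun j hj => ?_)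
        · exact mul_le_mul_of_nonneg_left (hmax b (hB.ne_zero hb)) hP.le
        · linarith [hw j (hB.ne_zero (Finset.mem_of_mem_erase hj))]

theorem one_le_prod {ι : Type*} {s : Finset ι} {f : ι → ℝ} (h : ∀ i ∈ s, 1 ≤ f i) :
    1 ≤ ∏ i ∈ s, f i :=
  Finset.prod_induction f (1 ≤ ·) (fun _ _ => one_le_mul_of_one_le_of_one_le) le_rfl h

/-- A chosen column becomes zero and is never chosen again, so every index contributes at most one
factor. -/
theorem greedy_le {w e : Fin n → ℝ} (N : ℕ) : ∀ (M : Matrix (Fin m) (Fin n) ℝ) (P : ℝ)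
    (S : Finset (Fin n)), 0 < P → (∀ j, M.col j ≠ 0 → 0 < w j) → (∀ j, w j ≤ e j) →
    (∀ j, 1 ≤ e j) → (∀ j, M.col j ≠ 0 → j ∈ S) →
    ((fun s => (greedyStep w s).val)^[N] (M, P)).2 ≤ P * ∏ j ∈ S, e j := by
  induction N with
  | zero =>
    intro M P S hP _ _ he _
    exact le_mul_of_one_le_right hP.le (one_le_prod fun j _ => he j)
  | succ N ih =>
    intro M P S hP hw hwe he hS
    rw [Function.iterate_succ_apply]
    rcases greedyStep_val w M P with ⟨h, h0⟩ | ⟨k, c, M', h, hk, hmax, hM', hzero, hk'⟩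
    · rw [h]
      exact ih M P S hP hw hwe he hS
    · rw [h]
      refine (ih M' (P * w k) (S.erase k) (mul_pos hP (hw k hk))
        (fun j hj => hw j (mt (hzero j) hj)) hwe he fun j hj => ?_).trans ?_
      · refine Finset.mem_erase.2 ⟨fun hjk => hj (hjk ▸ hk'), hS j (mt (hzero j) hj)⟩
      · rw [← Finset.mul_prod_erase _ _ (hS k hk), ← mul_assoc]
        refine mul_le_mul_of_nonneg_right ?_ (Finset.prod_nonneg fun j hj => ?_)
        · exact mul_le_mul_of_nonneg_left (hwe k) hP.le
        · linarith [he j]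

theorem foldl_const {α β : Type*} (f : α → α) (l : List β) (a : α) :
    l.foldl (fun s _ => f s) a = f^[l.length] a := by
  induction l generalizing a with
  | nil => rfl
  | cons b l ih => rw [List.foldl_cons, ih, List.length_cons, Function.iterate_succ_apply]

/-- The squared length of a column of an integer matrix. -/
noncomputable def colSq (A : Matrix (Fin m) (Fin n) ℤ) (j : Fin n) : ℝ :=
  (toReal A).col j ⬝ᵥ (toReal A).col j

theorem colSq_eq (A : Matrix (Fin m) (Fin n) ℤ) (j : Fin n) :
    colSq A j = ((∑ i, A i j * A i j : ℤ) : ℝ) := by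
  simp [colSq, dotProduct, toReal]

theorem one_le_colSq {A : Matrix (Fin m) (Fin n) ℤ} {j : Fin n} (h : (toReal A).col j ≠ 0) :
    1 ≤ colSq A j := by
  have h0 : 0 < colSq A j := by
    have := dotProduct_star_self_pos_iff.2 h
    simpa [colSq] using this
  rw [colSq_eq] at h0 ⊢
  exact_mod_cast h0

/-! ### Encoding length and the size of the threshold -/

theorem one_add_sq_le (a : ℤ) : (1 : ℝ) + a * a ≤ 4 ^ (1 + Nat.size a.natAbs) := by
  have h : a.natAbs + 1 ≤ 2 ^ Nat.size a.natAbs := Nat.lt_size_self _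
  have h' : ((a.natAbs : ℝ) + 1) ≤ 2 ^ Nat.size a.natAbs := by exact_mod_cast h
  have h2 : (a : ℝ) * a = (a.natAbs : ℝ) * a.natAbs := by
    rw [← Int.cast_mul, ← Int.natAbs_mul_self' a, Int.cast_mul, Int.cast_natCast]
  have h3 : (4 : ℝ) ^ (1 + Nat.size a.natAbs)
      = 4 * (2 ^ Nat.size a.natAbs * 2 ^ Nat.size a.natAbs) := by
    rw [pow_add, ← mul_pow]; norm_num
  have h4 : (0 : ℝ) ≤ a.natAbs := by positivity
  rw [h2, h3]
  nlinarith

theorem prod_one_add_le_encodingLength (A : Matrix (Fin m) (Fin n) ℤ) :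
    ∏ j, ∏ i, ((1 : ℝ) + A i j * A i j) ≤ 4 ^ encodingLength A := by
  rw [Finset.prod_comm, encodingLength, ← Finset.prod_pow_eq_pow_sum]
  refine Finset.prod_le_prod (fun i _ => Finset.prod_nonneg fun j _ => ?_) fun i _ => ?_
  · nlinarith [mul_self_nonneg (A i j : ℝ)]
  rw [← Finset.prod_pow_eq_pow_sum]
  exact Finset.prod_le_prod (fun j _ => by nlinarith [mul_self_nonneg (A i j : ℝ)])
    fun j _ => one_add_sq_le _

theorem one_add_sum_le_prod {ι : Type*} (s : Finset ι) {f : ι → ℝ} (hf : ∀ i ∈ s, 0 ≤ f i) :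
    1 + ∑ i ∈ s, f i ≤ ∏ i ∈ s, (1 + f i) := by
  classical
  induction s using Finset.induction_on with
  | empty => simp
  | insert a s ha ih =>
    rw [Finset.sum_insert ha, Finset.prod_insert ha]
    have h1 := hf a (by simp)
    have h2 := ih fun i hi => hf i (by simp [hi])
    have h3 : 0 ≤ ∑ i ∈ s, f i := Finset.sum_nonneg fun i hi => hf i (by simp [hi])
    nlinarith

/-- The computed threshold is `1 / (m² P)`, where `P` is at least the product of the squared lengths
of any independent columns, and at most exponential in the encoding length. -/
theorem exists_threshold (A : Matrix (Fin m) (Fin n) ℤ) :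
    ∃ P : ℝ, (threshold (toReal A)).val = 1 / (m * m * P) ∧ 1 ≤ P ∧ P ≤ 4 ^ encodingLength A ∧
      ∀ B : Finset (Fin n), LinearIndepOn ℝ (toReal A).col (B : Set (Fin n)) →
        ∏ j ∈ B, colSq A j ≤ P := by
  have hw : ∀ j, (toReal A).col j ≠ 0 → 1 ≤ colSq A j := fun j => one_le_colSq
  have hB : ∀ B : Finset (Fin n), LinearIndepOn ℝ (toReal A).col (B : Set (Fin n)) →
      ∏ j ∈ B, colSq A j ≤ ((fun s => (greedyStep (colSq A) s).val)^[m] (toReal A, 1)).2 := by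
    intro B hB
    -- Independent vectors in dimension `m` number at most `m`, so `m` greedy steps suffice.
    have hc : B.card ≤ m := by
      have := LinearIndependent.fintype_card_le_finrank hB
      simpa using this
    simpa using greedy_ge m (toReal A) 1 B one_pos hw hB hc
  refine ⟨((fun s => (greedyStep (colSq A) s).val)^[m] (toReal A, 1)).2, ?_, ?_, ?_, hB⟩
  · simp only [threshold, bind_val, lit_val, vec_val, dot_val, mul_val, div_val, foldlM_val,
      foldl_const, List.length_finRange, Int.cast_one, Int.cast_natCast]
    rfl
  · simpa using hB ∅ (by simp)
  · refine (greedy_le (e := fun j => ∏ i, ((1 : ℝ) + A i j * A i j)) m (toReal A) 1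
      Finset.univ one_pos (fun j hj => by linarith [hw j hj]) (fun j => ?_) (fun j => ?_)
      fun j _ => Finset.mem_univ j).trans ?_
    · have := one_add_sum_le_prod Finset.univ (f := fun i => (A i j : ℝ) * A i j)
        fun i _ => mul_self_nonneg _
      have h2 : colSq A j = ∑ i, (A i j : ℝ) * A i j := rfl
      linarith
    · exact one_le_prod fun i _ => by nlinarith [mul_self_nonneg (A i j : ℝ)]
    · rw [one_mul]; exact prod_one_add_le_encodingLength A

theorem threshold_cost_le (A : Matrix (Fin m) (Fin n) ℝ) :
    (threshold A).cost ≤ 5 + n * (1 + m * 2) + m * (7 * (m * n) + 3 * n + 2 * m + 2) := by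
  have h := foldlM_cost_le (f := fun s (_ : Fin m) =>
    greedyStep (fun j => (fun i => A i j) ⬝ᵥ fun i => A i j) s)
    (fun s _ => greedyStep_cost_le _ s) (List.finRange m) (A, ((1 : ℤ) : ℝ))
  rw [List.length_finRange] at h
  simp only [threshold, bind_cost, lit_val, lit_cost, vec_val, vec_cost, dot_val,
    dot_cost, mul_cost, div_cost, Finset.sum_const, Finset.card_univ, Fintype.card_fin,
    smul_eq_mul]
  omega

end MaxSupport

namespace MaxSupport

open Timed Matrix

variable {m n : ℕ}

/-! ### Solutions that satisfy a strict inequality by a margin -/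

/-- A weak form of Hadamard's inequality: in the Leibniz expansion the sum over permutations is
enlarged to a sum over all maps, which factors into the 1-norms of the rows. -/
theorem abs_det_le_prod_sum {ι : Type*} [Fintype ι] [DecidableEq ι] (X : Matrix ι ι ℝ) :
    |X.det| ≤ ∏ i, ∑ j, |X i j| := by
  rw [← det_transpose, det_apply]
  refine (Finset.abs_sum_le_sum_abs _ _).trans ?_
  have h1 : ∀ σ : Equiv.Perm ι,
      |Equiv.Perm.sign σ • ∏ i, Xᵀ (σ i) i| = ∏ i, |X i (σ i)| := by
    intro σ
    rw [← Finset.abs_prod]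
    rcases Int.units_eq_one_or (Equiv.Perm.sign σ) with h | h <;> simp [h, transpose_apply]
  simp only [h1]
  rw [Finset.prod_univ_sum, Fintype.piFinset_univ]
  calc ∑ σ : Equiv.Perm ι, ∏ i, |X i (σ i)|
      = ∑ f ∈ Finset.univ.image (fun σ : Equiv.Perm ι => (σ : ι → ι)), ∏ i, |X i (f i)| := by
        rw [Finset.sum_image]
        intro a _ b _ h
        exact DFunLike.coe_injective h
    _ ≤ _ := Finset.sum_le_sum_of_subset_of_nonneg (Finset.subset_univ _)
        fun f _ _ => Finset.prod_nonneg fun i _ => abs_nonneg _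

theorem eq_zero_of_orthogonal_of_rank {A : Matrix (Fin m) (Fin n) ℝ} (hA : A.rank = m)
    {d : Fin m → ℝ} (hd : ∀ j, A.col j ⬝ᵥ d = 0) : d = 0 := by
  have h1 := Aᵀ.mulVecLin.finrank_range_add_finrank_ker
  rw [← rank, rank_transpose, hA, Module.finrank_fin_fun] at h1
  have h2 : LinearMap.ker Aᵀ.mulVecLin = ⊥ := Submodule.finrank_eq_zero.1 (by omega)
  rw [LinearMap.ker_eq_bot'] at h2
  exact h2 d (funext hd)

/-- A solution with `a_i · y > 0` can be chosen such that its tight constraints together with `i`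
determine it up to scaling. -/
theorem exists_tight {A : Matrix (Fin m) (Fin n) ℝ} (hA : A.rank = m) {i : Fin n}
    {z : Fin m → ℝ} (hz : ∀ j, 0 ≤ A.col j ⬝ᵥ z) (hi : 0 < A.col i ⬝ᵥ z) :
    ∃ y : Fin m → ℝ, (∀ j, 0 ≤ A.col j ⬝ᵥ y) ∧ 0 < A.col i ⬝ᵥ y ∧
      ∀ d : Fin m → ℝ, A.col i ⬝ᵥ d = 0 → (∀ j, A.col j ⬝ᵥ y = 0 → A.col j ⬝ᵥ d = 0) → d = 0 := by
  classical
  induction hk : (Finset.univ.filter fun j => A.col j ⬝ᵥ z ≠ 0).card using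
    Nat.strong_induction_on generalizing z with
  | _ k ih =>
    subst hk
    by_cases hdone : ∀ d : Fin m → ℝ, A.col i ⬝ᵥ d = 0 →
        (∀ j, A.col j ⬝ᵥ z = 0 → A.col j ⬝ᵥ d = 0) → d = 0
    · exact ⟨z, hz, hi, hdone⟩
    push Not at hdone
    obtain ⟨d, hdi, hdz, hd0, j₀, hj₀⟩ : ∃ d : Fin m → ℝ, A.col i ⬝ᵥ d = 0 ∧
        (∀ j, A.col j ⬝ᵥ z = 0 → A.col j ⬝ᵥ d = 0) ∧ d ≠ 0 ∧ ∃ j, A.col j ⬝ᵥ d < 0 := by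
      obtain ⟨d, hdi, hdz, hd0⟩ := hdone
      obtain ⟨j, hj⟩ : ∃ j, A.col j ⬝ᵥ d ≠ 0 := by
        by_contra! h
        exact hd0 (eq_zero_of_orthogonal_of_rank hA h)
      rcases hj.lt_or_gt with hj | hj
      · exact ⟨d, hdi, hdz, hd0, j, hj⟩
      · refine ⟨-d, by simp [hdi], fun l hl => by simp [hdz l hl], by simpa using hd0, j, ?_⟩
        simpa using hj
    -- Move from `z` along `d` until the first constraint `l` becomes tight. Tight constraints stay
    -- tight and the value at `i` does not change, since `d` is orthogonal to these columns, so the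
    -- number of constraints that are not tight drops.
    obtain ⟨l, hl, hmin⟩ := Finset.exists_min_image
      (Finset.univ.filter fun j => A.col j ⬝ᵥ d < 0)
      (fun j => (A.col j ⬝ᵥ z) / -(A.col j ⬝ᵥ d)) ⟨j₀, by simpa using hj₀⟩
    simp only [Finset.mem_filter, Finset.mem_univ, true_and] at hl hmin
    set t := (A.col l ⬝ᵥ z) / -(A.col l ⬝ᵥ d) with ht
    have ht0 : 0 ≤ t := div_nonneg (hz l) (by linarith)
    have hadd : ∀ j, A.col j ⬝ᵥ (z + t • d) = A.col j ⬝ᵥ z + t * (A.col j ⬝ᵥ d) := fun j => by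
      rw [dotProduct_add, dotProduct_smul, smul_eq_mul]
    have hl0 : A.col l ⬝ᵥ (z + t • d) = 0 := by
      rw [hadd, ht, div_neg, neg_mul, div_mul_cancel₀ _ hl.ne, add_neg_cancel]
    refine ih _ (Finset.card_lt_card ?_) (z := z + t • d) (fun j => ?_) ?_ rfl
    · rw [Finset.ssubset_iff_of_subset]
      · refine ⟨l, ?_, by simpa using hl0⟩
        simp only [Finset.mem_filter, Finset.mem_univ, true_and]
        exact fun h => hl.ne (hdz l h)
      · intro j
        simp only [Finset.mem_filter, Finset.mem_univ, true_and]
        exact fun h h' => h (by rw [hadd, h', hdz j h']; ring)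
    · rw [hadd]
      rcases le_or_gt 0 (A.col j ⬝ᵥ d) with h | h
      · have := hz j
        positivity
      · have := hmin j h
        rw [le_div_iff₀ (by linarith)] at this
        linarith
    · rw [hadd, hdi]; simpa using hi

/-- Integers satisfy `|a| ≤ a²`. This turns the 1-norms of the determinant bound into the squared
lengths that occur in `Δ_A²`. -/
theorem sum_abs_le_colSq (A : Matrix (Fin m) (Fin n) ℤ) (j : Fin n) :
    ∑ k, |(A k j : ℝ)| ≤ colSq A j := by
  rw [colSq_eq, Int.cast_sum]
  refine Finset.sum_le_sum fun k _ => ?_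
  rw [← Int.cast_abs]
  have : |A k j| ≤ A k j * A k j := by
    rw [← abs_mul_abs_self]
    rcases (abs_nonneg (A k j)).eq_or_lt with h | h
    · simp [← h]
    · nlinarith
  exact_mod_cast this

/-- A solution determined up to scaling by tight columns together with `a_i` is, by Cramer's rule, a
multiple of a column of the adjugate of an integral basis matrix `N`. Its entries are then bounded
by the product `D` of the other squared column lengths, while its scalar product with `a_i` is `±det
N`, a nonzero integer. After scaling to length at most 1 the product is at least `1 / (m D) ≥ ‖a_i‖²
/ (m P)`, more than is needed because `‖a_i‖ ≥ 1`. -/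
theorem exists_margin {A : Matrix (Fin m) (Fin n) ℤ} (hm : 1 ≤ m) (hA : (toReal A).rank = m)
    {P : ℝ} (hP : ∀ B : Finset (Fin n), LinearIndepOn ℝ (toReal A).col (B : Set (Fin n)) →
      ∏ j ∈ B, colSq A j ≤ P)
    {i : Fin n} {z : Fin m → ℝ} (hz : ∀ j, 0 ≤ (toReal A).col j ⬝ᵥ z)
    (hi : 0 < (toReal A).col i ⬝ᵥ z) :
    ∃ y : Fin m → ℝ, (∀ j, 0 ≤ (toReal A).col j ⬝ᵥ y) ∧ y ⬝ᵥ y ≤ 1 ∧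
      1 / (m * m * P) * √(colSq A i) ≤ (toReal A).col i ⬝ᵥ y := by
  classical
  obtain ⟨y, hy, hiy, huniq⟩ := exists_tight hA hz hi
  set a := (toReal A).col with ha
  -- a basis of columns, consisting of `i` and of tight columns
  have hai : a i ≠ 0 := fun h => by simp [h] at hiy
  obtain ⟨B, hBt, hiB, hspan, hB⟩ := exists_linearIndepOn_extension (K := ℝ) (v := a)
    (s := {i}) (t := {j | a j ⬝ᵥ y = 0} ∪ {i})
    (by simpa using hai) (by simp)
  have htight : ∀ j ∈ B, j ≠ i → a j ⬝ᵥ y = 0 := fun j hj hji => by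
    simpa [hji] using hBt hj
  have hBuniq : ∀ d : Fin m → ℝ, (∀ j ∈ B, a j ⬝ᵥ d = 0) → d = 0 := by
    intro d hd
    have h1 : ∀ x ∈ Submodule.span ℝ (a '' B), x ⬝ᵥ d = 0 := by
      intro x hx
      induction hx using Submodule.span_induction with
      | mem x hx => obtain ⟨j, hj, rfl⟩ := hx; exact hd j hj
      | zero => simp
      | add x y _ _ hx hy => rw [add_dotProduct, hx, hy, add_zero]
      | smul c x _ hx => rw [smul_dotProduct, hx, smul_zero]
    refine huniq d (hd i (hiB rfl)) fun j hj => h1 _ (hspan ⟨j, Or.inl hj, rfl⟩)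
  -- With fewer than `m` members of `B`, some nonzero vector would be orthogonal to all of them.
  have hcard : Fintype.card B = m := by
    refine le_antisymm (by simpa using LinearIndependent.fintype_card_le_finrank hB) ?_
    by_contra! hlt
    let f : (Fin m → ℝ) →ₗ[ℝ] (B → ℝ) := (of fun (j : B) k => a j k).mulVecLin
    obtain ⟨d, hd, hd0⟩ := Submodule.exists_mem_ne_zero_of_ne_bot
      (LinearMap.ker_ne_bot_of_finrank_lt (f := f) (by simpa using hlt))
    exact hd0 (hBuniq d fun j hj => congrFun (LinearMap.mem_ker.1 hd) ⟨j, hj⟩)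
  let e : Fin m ≃ B := (Fintype.equivFinOfCardEq hcard).symm
  let N : Matrix (Fin m) (Fin m) ℝ := of fun l k => a (e l) k
  let NZ : Matrix (Fin m) (Fin m) ℤ := of fun l k => A k (e l)
  have hNZ : N.det = (NZ.det : ℝ) := by
    exact (RingHom.map_det (Int.castRingHom ℝ) NZ).symm
  have hNinj : ∀ d, N *ᵥ d = 0 → d = 0 := fun d hd => hBuniq d fun j hj => by
    simpa [N, mulVec] using congrFun hd (e.symm ⟨j, hj⟩)
  have hdet : N.det ≠ 0 := fun h0 => by
    obtain ⟨d, hd, hd'⟩ := exists_mulVec_eq_zero_iff.2 h0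
    exact hd (hNinj d hd')
  have hdet1 : 1 ≤ |N.det| := by
    rw [hNZ] at hdet ⊢
    exact_mod_cast Int.one_le_abs (by exact_mod_cast hdet : NZ.det ≠ 0)
  set i₀ := e.symm ⟨i, hiB rfl⟩ with hi₀
  have hei₀ : (e i₀ : Fin n) = i := by simp [hi₀]
  -- Cramer's rule
  set y' : Fin m → ℝ := N.adjugate *ᵥ Pi.single i₀ 1 with hy'
  have hNy' : N *ᵥ y' = N.det • Pi.single i₀ 1 := by
    rw [hy', mulVec_mulVec, mul_adjugate, smul_mulVec, one_mulVec]
  have hNy : N *ᵥ y = (a i ⬝ᵥ y) • Pi.single i₀ 1 := by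
    funext l
    by_cases hl : l = i₀
    · subst hl; simp [N, mulVec, hei₀]
    · have : (e l : Fin n) ≠ i := fun h => hl (by rw [hi₀, Equiv.eq_symm_apply]; exact Subtype.ext h)
      simpa [N, mulVec, hl] using htight _ (e l).2 this
  have hyy' : y' = (N.det / (a i ⬝ᵥ y)) • y := by
    rw [← sub_eq_zero]
    refine hNinj _ ?_
    rw [mulVec_sub, mulVec_smul, hNy, hNy', smul_smul, div_mul_cancel₀ _ hiy.ne', sub_self]
  set D := ∏ j ∈ B.toFinset.erase i, colSq A j with hD
  have hcol1 : ∀ j ∈ B, 1 ≤ colSq A j := fun j hj => one_le_colSq (hB.ne_zero hj)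
  have hD1 : 1 ≤ D := one_le_prod fun j hj =>
    hcol1 j (by simpa using Finset.mem_of_mem_erase hj)
  -- The entry `y' k` is the determinant of `N` with row `i₀` replaced by the unit vector `e_k`, a
  -- row of 1-norm 1.
  have hbound : ∀ k, |y' k| ≤ D := by
    intro k
    have h1 : y' k = (N.updateRow i₀ (Pi.single k 1)).det := by
      rw [← adjugate_apply, hy']; simp
    rw [h1]
    refine (abs_det_le_prod_sum _).trans ?_
    rw [← Finset.mul_prod_erase _ _ (Finset.mem_univ i₀)]
    have h2 : ∑ j, |N.updateRow i₀ (Pi.single k 1) i₀ j| = 1 := by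
      simp only [updateRow_self]
      rw [Finset.sum_eq_single k]
      · simp
      · intro b _ hb; simp [hb]
      · simp
    rw [h2, one_mul]
    have h3 : D = ∏ l ∈ Finset.univ.erase i₀, colSq A (e l) := by
      symm
      refine Finset.prod_bij (fun l _ => (e l : Fin n)) ?_ ?_ ?_ fun _ _ => rfl
      · intro l hl
        refine Finset.mem_erase.2 ⟨fun h => Finset.ne_of_mem_erase hl ?_, by simp⟩
        rw [hi₀, Equiv.eq_symm_apply]; exact Subtype.ext h
      · intro l _ l' _ h
        exact e.injective (Subtype.ext h)
      · intro j hj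
        obtain ⟨hji, hj⟩ := Finset.mem_erase.1 hj
        refine ⟨e.symm ⟨j, by simpa using hj⟩, Finset.mem_erase.2 ⟨fun h => hji ?_, by simp⟩,
          by simp⟩
        rw [hi₀, e.symm.injective.eq_iff] at h
        exact congrArg Subtype.val h
    rw [h3]
    refine Finset.prod_le_prod (fun _ _ => Finset.sum_nonneg fun _ _ => abs_nonneg _) ?_
    intro l hl
    simp only [updateRow_ne (Finset.ne_of_mem_erase hl)]
    exact sum_abs_le_colSq A (e l)
  have hPD : colSq A i * D ≤ P := by
    rw [hD, Finset.mul_prod_erase _ _ (by simpa using hiB)]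
    exact hP _ (by simpa using hB)
  -- rescale
  set c := |N.det| / (a i ⬝ᵥ y) with hc
  have hc0 : 0 < c := by positivity
  have hcy : ∀ k, |(c • y) k| ≤ D := fun k => by
    refine le_of_eq_of_le ?_ (hbound k)
    rw [hyy', Pi.smul_apply, Pi.smul_apply, smul_eq_mul, smul_eq_mul, abs_mul, abs_mul, hc, abs_div,
      abs_div, abs_abs]
  have hm1 : (1 : ℝ) ≤ m := by exact_mod_cast hm
  -- The vector `c • y` equals `y'` up to sign, the positive factor `c` keeping it feasible. Its
  -- entries are at most `D`, so division by `m D` makes the squared length at most `1 / m`.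
  refine ⟨(1 / (m * D)) • c • y, fun j => ?_, ?_, ?_⟩
  · rw [dotProduct_smul, dotProduct_smul]
    have := hy j
    simp only [smul_eq_mul]
    positivity
  · rw [smul_dotProduct, dotProduct_smul, smul_smul, smul_eq_mul]
    have h1 : (c • y) ⬝ᵥ (c • y) ≤ m * (D * D) := by
      rw [dotProduct]
      calc _ ≤ ∑ _k : Fin m, D * D := Finset.sum_le_sum fun k _ => by
            rw [← abs_mul_abs_self ((c • y) k)]
            exact mul_self_le_mul_self (abs_nonneg _) (hcy k)
        _ = _ := by simp
    calc _ ≤ 1 / (m * D) * (1 / (m * D)) * (m * (D * D)) := by gcongr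
      _ = 1 / m := by field_simp
      _ ≤ 1 := by rw [div_le_one (by positivity)]; exact hm1
  · rw [dotProduct_smul, dotProduct_smul, smul_eq_mul, smul_eq_mul, hc,
      div_mul_cancel₀ _ hiy.ne']
    have h1 := hcol1 i (hiB rfl)
    have h2 : √(colSq A i) ≤ colSq A i := by
      rw [Real.sqrt_le_left (by linarith)]; nlinarith
    have h3 : 0 < P := by nlinarith
    calc 1 / (m * m * P) * √(colSq A i) ≤ 1 / (m * 1 * (colSq A i * D)) * colSq A i := by gcongr
      _ = 1 / (m * D) * 1 := by field_simp
      _ ≤ _ := by gcongr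

end MaxSupport

namespace MaxSupport

open Timed Matrix

/-! ### First order methods -/

/-- The result `(x, y)` of a first order method is as demanded: `Aᵀ Q y > 0`, or `y` is a convex
combination of the normalized columns with `‖y‖_Q ≤ ε`. -/
def IsFirstOrderResult {r t : ℕ} (A : Matrix (Fin r) (Fin t) ℝ) (Q : Matrix (Fin r) (Fin r) ℝ)
    (ε : ℝ) (x : Fin t → ℝ) (y : Fin r → ℝ) : Prop :=
  (∀ i, 0 < A.col i ⬝ᵥ Q *ᵥ y) ∨
    ((∀ i, 0 ≤ x i) ∧ ∑ i, x i = 1 ∧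
      y = ∑ i, (x i / √(A.col i ⬝ᵥ Q *ᵥ A.col i)) • A.col i ∧ √(y ⬝ᵥ Q *ᵥ y) ≤ ε)

/-- On matrices with at most `m` rows and `n` columns, the method delivers a correct result at the
given cost, for all sufficiently large budgets. -/
def FirstOrderCorrect (fom : FirstOrderMethod ℝ) (m n cost : ℕ) : Prop :=
  ∃ N : ℕ, ∀ (calls r t : ℕ) (A : Matrix (Fin r) (Fin (t + 1)) ℝ) (Q : Matrix (Fin r) (Fin r) ℝ),
    r ≤ m → t + 1 ≤ n → Q.PosDef → (∀ i, A.col i ≠ 0) →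
    ∃ x y c, (∀ fuel ≥ N, fom calls fuel r t A Q (1 / (11 * m)) = ⟨some (x, y), c⟩) ∧ c ≤ cost ∧
      IsFirstOrderResult A Q (1 / (11 * m)) x y

theorem PosDef.pos {r : ℕ} {Q : Matrix (Fin r) (Fin r) ℝ} (hQ : Q.PosDef) {v : Fin r → ℝ}
    (hv : v ≠ 0) : 0 < v ⬝ᵥ Q *ᵥ v := by
  simpa using hQ.dotProduct_mulVec_pos hv

theorem PosDef.nonneg {r : ℕ} {Q : Matrix (Fin r) (Fin r) ℝ} (hQ : Q.PosDef) (v : Fin r → ℝ) :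
    0 ≤ v ⬝ᵥ Q *ᵥ v := by
  simpa using hQ.posSemidef.dotProduct_mulVec_nonneg v

theorem PosDef.symm {r : ℕ} {Q : Matrix (Fin r) (Fin r) ℝ} (hQ : Q.PosDef) : Qᵀ = Q := by
  simpa using hQ.isHermitian.eq

theorem PosDef.comm {r : ℕ} {Q : Matrix (Fin r) (Fin r) ℝ} (hQ : Q.PosDef) (u v : Fin r → ℝ) :
    u ⬝ᵥ Q *ᵥ v = v ⬝ᵥ Q *ᵥ u := by
  rw [dotProduct_mulVec, dotProduct_comm, ← mulVec_transpose, PosDef.symm hQ]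

/-! ### The von Neumann algorithm -/

section VonNeumann

variable {r t : ℕ} (c : ℕ → ℕ) (A : Matrix (Fin r) (Fin (t + 1)) ℝ)
  (F : Matrix (Fin (t + 1)) (Fin (t + 1)) ℝ) (d : Fin (t + 1) → ℝ) (ε : ℝ) (j : ℕ)
  (x : Fin (t + 1) → ℝ) (y : Fin r → ℝ) (z : Fin (t + 1) → ℝ)

theorem vonNeumannRound_val :
    let s := ∑ i, x i * (z i / d i)
    ((vonNeumannRound c A F d ε (j, x, y, z)).val = some (Sum.inr (x, y)) ∧
      (√s ≤ ε ∨ ∀ i, 0 < z i)) ∨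
    (ε < √s ∧ ∃ k l, z k ≤ 0 ∧ l = (s - z k / d k) / (s - 2 * (z k / d k) + 1) ∧
      (vonNeumannRound c A F d ε (j, x, y, z)).val = some (Sum.inl (j + 1,
        (fun i => (1 - l) * x i + if i = k then l else 0),
        (fun i => (1 - l) * y i + l / d k * A i k),
        (fun i => (1 - l) * z i + l / d k * F i k)))) := by
  intro s
  rcases le_or_gt (√s) ε with hs | hs
  · left
    refine ⟨?_, Or.inl hs⟩
    have hb := (le_val (√s) ε).2 hs
    simp only [vonNeumannRound, bind_val, sumT_val, div_val, mul_val, sqrt_val]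
    rw [hb]
    simp
  · have hb := (le_val_false (√s) ε).2 hs
    simp only [vonNeumannRound, bind_val, sumT_val, div_val, mul_val, sqrt_val]
    rw [hb]
    simp only [Bool.false_eq_true, if_false, bind_val, filterT_val, pure_val]
    rcases hc : (List.finRange (t + 1)).filter fun i => !(isPos (z i)).val with _ | ⟨k₀, ks⟩
    · left
      refine ⟨rfl, Or.inr fun i => ?_⟩
      by_contra hi
      have : i ∈ (List.finRange (t + 1)).filter fun i => !(isPos (z i)).val := by
        simpa using hi
      rw [hc] at this
      simp at this
    · right
      have hk := pick_mem (c j) k₀ ks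
      rw [← hc] at hk
      refine ⟨hs, pick (c j) k₀ ks, _, by simpa using hk, rfl, ?_⟩
      simp only [bind_val, pure_val, vec_val, lit_val, div_val, mul_val, sub_val, add_val,
        Timed.ite_val, Int.cast_one, Int.cast_ofNat, Option.some.injEq, Sum.inl.injEq,
        Prod.mk.injEq, true_and]
      refine ⟨?_, rfl, rfl⟩
      funext i
      split_ifs <;> simp [s]

theorem vonNeumannRound_cost_le :
    (vonNeumannRound c A F d ε (j, x, y, z)).cost ≤ 13 + 10 * (t + 1) + 3 * r := by
  have h1 := filterT_cost_le (c := 2) (test := fun i => do let b ← isPos (z i); pure (!b))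
    (fun i => by simp) (List.finRange (t + 1))
  rw [List.length_finRange] at h1
  simp only [vonNeumannRound, bind_cost, sumT_cost, div_cost, mul_cost, sqrt_cost, le_cost]
  simp only [Timed.ite_cost, bind_cost, pure_cost]
  have h2 : ∀ (a : ℝ) (x : Fin (t + 1) → ℝ) (k : Fin (t + 1)) (l : ℝ),
      (vec fun i => do
          let u ← RealRAM.mul a (x i)
          if i = k then RealRAM.add u l else pure u).cost ≤ (t + 1) * 2 := fun a x k l =>
    vec_cost_le fun i => by
      simp only [bind_cost, mul_cost, Timed.ite_cost]
      split_ifs <;> simp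
  split_ifs
  · simp; omega
  · split
    · simp; omega
    · rename_i k₀ ks _
      simp only [bind_cost, lit_cost, div_cost, sub_cost, mul_cost, add_cost, pure_cost]
      have h3 := fun a l => h2 a x (pick (c j) k₀ ks) l
      -- The search for candidates and the update of `x` have costs without a closed form; their
      -- bounds are inserted at their places in the nested sum.
      refine le_trans (Nat.add_le_add_left (Nat.add_le_add_left (Nat.add_le_add_left
        (Nat.add_le_add h1 (Nat.add_le_add_left (Nat.add_le_add_left (Nat.add_le_add_left
        (Nat.add_le_add_left (Nat.add_le_add_left (Nat.add_le_add_left (Nat.add_le_add_left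
        (Nat.add_le_add_left (Nat.add_le_add_left (Nat.add_le_add_left
        (Nat.add_le_add (h3 _ _) le_rfl) _) _) _) _) _) _) _) _) _) _)) _) _) _) ?_
      simp
      omega

end VonNeumann

/-- The step length minimizes the norm on the segment from `y` to the unit vector `b_k`. The new
squared norm is `(s - h²) / (s - 2 h + 1) ≤ s / (s + 1)` for `h ≤ 0`, so its reciprocal grows by at
least 1 in each step. -/
theorem vonNeumann_step {s h : ℝ} {j : ℕ} (hs : 0 ≤ s) (hsj : s * (j + 1) ≤ 1) (hh : h ≤ 0) {l : ℝ}
    (hl : l = (s - h) / (s - 2 * h + 1)) :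
    0 ≤ l ∧ l ≤ 1 ∧ ((1 - l) * (1 - l) * s + 2 * ((1 - l) * l * h) + l * l) * (j + 2) ≤ 1 := by
  have hden : 0 < s - 2 * h + 1 := by linarith
  have h1 : (1 - l) * (1 - l) * s + 2 * ((1 - l) * l * h) + l * l
      = (s - h * h) / (s - 2 * h + 1) := by
    have e : l * (s - 2 * h + 1) = s - h := by rw [hl, div_mul_cancel₀ _ hden.ne']
    rw [eq_div_iff hden.ne']
    linear_combination (l * (s - 2 * h + 1) - (s - h)) * e
  refine ⟨?_, ?_, ?_⟩
  · rw [hl]; exact div_nonneg (by linarith) hden.le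
  · rw [hl, div_le_one hden]; linarith
  · rw [h1]
    have h2 : (s - h * h) / (s - 2 * h + 1) ≤ s / (s + 1) := by
      rw [div_le_div_iff₀ hden (by linarith)]
      nlinarith [mul_nonneg hs (neg_nonneg.2 hh), mul_nonneg (mul_self_nonneg h) hs,
        mul_self_nonneg h]
    have h3 : s / (s + 1) * (j + 2) ≤ 1 := by
      rw [div_mul_eq_mul_div, div_le_one (by linarith)]; linarith
    have h4 : (0 : ℝ) ≤ j + 2 := by positivity
    exact (mul_le_mul_of_nonneg_right h2 h4).trans h3

/-- The invariant is `‖y‖_Q² (j + 1) ≤ 1` together with `z = Aᵀ Q y`. A round costs at most `26 n`,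
as `z` is updated from the stored `F`; this gives the term in `m² n`, while computing `F` gives the
term in `m n²`. -/
theorem vonNeumann_correct (c : ℕ → ℕ → ℕ) {m n : ℕ} (hm : 1 ≤ m) (hmn : m ≤ n) :
    FirstOrderCorrect (vonNeumann c) m n (6 * (m * n * n) + 3200 * (m * m * n) + 4 * n) := by
  refine ⟨121 * m * m + 1, fun calls r t A Q hr ht hQ hA => ?_⟩
  set ε : ℝ := 1 / (11 * m) with hε
  set F := Aᵀ * (Q * A) with hF
  have hFik : ∀ i k, F i k = A.col i ⬝ᵥ Q *ᵥ A.col k := fun i k => rfl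
  set d : Fin (t + 1) → ℝ := fun i => √(F i i) with hd
  have hFpos : ∀ i, 0 < F i i := fun i => PosDef.pos hQ (hA i)
  have hdpos : ∀ i, 0 < d i := fun i => Real.sqrt_pos.2 (hFpos i)
  have hdd : ∀ i, d i * d i = F i i := fun i => Real.mul_self_sqrt (hFpos i).le
  set K := 13 + 10 * (t + 1) + 3 * r
  have hm0 : (1 : ℝ) ≤ m := by exact_mod_cast hm
  have hε0 : 0 < ε := by positivity
  obtain ⟨b, c', hrun, hpost, hcost⟩ := loop_halts
    (round := fun _ => vonNeumannRound (c calls) A F d ε) (N := 0)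
    (fun st : ℕ × (Fin (t + 1) → ℝ) × (Fin r → ℝ) × (Fin (t + 1) → ℝ) =>
      (∀ i, 0 ≤ st.2.1 i) ∧ ∑ i, st.2.1 i = 1 ∧
      st.2.2.1 = ∑ i, (st.2.1 i / d i) • A.col i ∧
      st.2.2.2 = (fun i => A.col i ⬝ᵥ Q *ᵥ st.2.2.1) ∧
      (st.2.2.1 ⬝ᵥ Q *ᵥ st.2.2.1) * (st.1 + 1) ≤ 1 ∧ st.1 ≤ 121 * m * m)
    (fun b => IsFirstOrderResult A Q ε b.1 b.2)
    -- `121 m²` is `1 / ε²`; the extra 1 pays for the round that returns.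
    (fun st => 121 * m * m - st.1) (fun st => (121 * m * m - st.1 + 1) * K) (by
      rintro ⟨j, x, y, z⟩ ⟨hx0, hx1, hy, hz, hs, hj⟩
      dsimp only at hx0 hx1 hy hz hs hj
      have hsum : ∑ i, x i * (z i / d i) = y ⬝ᵥ Q *ᵥ y := by
        conv_rhs => rw [hy]
        rw [sum_dotProduct]
        refine Finset.sum_congr rfl fun i _ => ?_
        rw [smul_dotProduct, smul_eq_mul, ← hy, hz]
        ring
      have hs0 := PosDef.nonneg hQ y
      have hc := vonNeumannRound_cost_le (c calls) A F d ε j x y z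
      have hv := vonNeumannRound_val (c calls) A F d ε j x y z
      simp only [hsum] at hv
      rcases hv with ⟨hv, hres⟩ | ⟨hlt, k, l, hzk, hl, hv⟩
      · refine ⟨Sum.inr (x, y), _, fun _ _ => Timed.ext' hv rfl, by simp, ?_⟩
        rintro _ ⟨⟩
        refine ⟨?_, hc.trans (Nat.le_mul_of_pos_left _ (by omega))⟩
        rcases hres with hres | hres
        · exact Or.inr ⟨hx0, hx1, hy, hres⟩
        · left; intro i; have := hres i; rw [hz] at this; exact this
      · refine ⟨_, _, fun _ _ => Timed.ext' hv rfl, ?_, by simp⟩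
        rintro _ ⟨⟩
        set h := z k / d k with hh
        have hh0 : h ≤ 0 := div_nonpos_of_nonpos_of_nonneg hzk (hdpos k).le
        obtain ⟨hl0, hl1, hl2⟩ := vonNeumann_step hs0 hs hh0 hl
        -- The loop goes on only if `ε² < ‖y‖_Q² ≤ 1 / (j + 1)`.
        have hj' : j + 1 ≤ 121 * m * m := by
          have h1 : ε * ε < y ⬝ᵥ Q *ᵥ y := by
            have := Real.lt_sqrt hε0.le |>.1 hlt
            rwa [pow_two] at this
          have h2 : ε * ε * (j + 1) ≤ 1 := by
            have : (0 : ℝ) < j + 1 := by positivity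
            nlinarith
          have h3 : ((j : ℝ) + 1) ≤ 121 * m * m := by
            rw [hε] at h2
            have h4 : 1 / (11 * (m : ℝ)) * (1 / (11 * m)) * (j + 1) = (j + 1) / (121 * m * m) := by
              field_simp; norm_num
            rw [h4, div_le_one (by positivity)] at h2
            exact h2
          exact_mod_cast h3
        have hy' : (fun i => (1 - l) * y i + l / d k * A i k) = (1 - l) • y + (l / d k) • A.col k :=
          rfl
        have hQy' : Q *ᵥ ((1 - l) • y + (l / d k) • A.col k)
            = (1 - l) • Q *ᵥ y + (l / d k) • Q *ᵥ A.col k := by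
          rw [mulVec_add, mulVec_smul, mulVec_smul]
        refine ⟨⟨fun i => ?_, ?_, ?_, ?_, ?_, hj'⟩, by dsimp only; omega, ?_⟩
        · have := hx0 i
          have h1 : 0 ≤ 1 - l := by linarith
          dsimp only
          split_ifs <;> positivity
        · dsimp only
          rw [Finset.sum_add_distrib, ← Finset.mul_sum, hx1]
          simp
        · dsimp only
          rw [hy']
          have h1 : ∀ i, (((1 - l) * x i + if i = k then l else 0) / d i) • A.col i
              = (1 - l) • (x i / d i) • A.col i + if i = k then (l / d k) • A.col k else 0 := by
            intro i
            rw [smul_smul, add_div, add_smul, mul_div_assoc]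
            congr 1
            split_ifs with hi
            · rw [hi]
            · simp
          simp only [h1]
          rw [Finset.sum_add_distrib, ← Finset.smul_sum, ← hy]
          simp
        · dsimp only
          rw [hy']
          funext i
          rw [hQy', dotProduct_add, dotProduct_smul, dotProduct_smul, hz, hFik]
          rfl
        · dsimp only
          rw [hy', hQy']
          simp only [add_dotProduct, dotProduct_add, smul_dotProduct, dotProduct_smul, smul_eq_mul]
          have h1 : A.col k ⬝ᵥ Q *ᵥ y = h * d k := by
            rw [hh, div_mul_cancel₀ _ (hdpos k).ne', hz]
          rw [PosDef.comm hQ y (A.col k), h1, ← hFik, ← hdd]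
          have h2 := (hdpos k).ne'
          convert hl2 using 2
          · field_simp; ring
          · push_cast; ring
        · dsimp only
          have h1 : 121 * m * m - j + 1 = (121 * m * m - (j + 1) + 1) + 1 := by omega
          rw [h1, add_mul (121 * m * m - (j + 1) + 1) 1 K, one_mul, add_comm]
          exact Nat.add_le_add_left hc _)
    (0, fun i => if i = 0 then 1 else 0, fun i => A i 0 / d 0, fun i => F i 0 / d 0) (by
      have hy' : (fun i => A i 0 / d 0) = (1 / d 0) • A.col 0 := by
        funext i; simp [div_eq_inv_mul]
      refine ⟨fun i => ?_, by simp, ?_, ?_, ?_, by simp⟩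
      · dsimp only; split_ifs <;> norm_num
      · dsimp only
        rw [hy', Finset.sum_eq_single 0]
        · simp
        · intro b _ hb; simp [hb]
        · simp
      · dsimp only
        rw [hy']
        funext i
        rw [mulVec_smul, dotProduct_smul, hFik, smul_eq_mul]
        ring
      · dsimp only
        rw [hy', mulVec_smul, dotProduct_smul, smul_dotProduct, ← hFik, ← hdd]
        have h2 := (hdpos 0).ne'
        simp only [smul_eq_mul]
        apply le_of_eq
        field_simp
        simp)
  refine ⟨b.1, b.2, r * ((t + 1) * (1 + r * 2)) + ((t + 1) * ((t + 1) * (1 + r * 2)) +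
    ((t + 1) + ((t + 1) + (r + ((t + 1) + c'))))), fun fuel hf => ?_, ?_, hpost⟩
  · have hx : (vec fun i : Fin (t + 1) => if i = 0 then RealRAM.lit 1 else RealRAM.lit 0 :
        Timed (Fin (t + 1) → ℝ)).val = fun i => if i = 0 then 1 else 0 := by
      funext i; simp [Timed.ite_val]
    have hrun' := hrun fuel (Nat.zero_le _) fuel (by dsimp only; omega)
    have hcongr : ∀ x : Fin (t + 1) → ℝ, x = (fun i => if i = 0 then 1 else 0) →
        loop (vonNeumannRound (c calls) A F d ε) fuel
          (0, x, fun i => A i 0 / d 0, fun i => F i 0 / d 0) = ⟨some b, c'⟩ := by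
      rintro _ rfl; exact hrun'
    refine Timed.ext' ?_ ?_
    · simp only [vonNeumann, bind_val, matMul_val, vec_val, sqrt_val, div_val]
      exact congrArg Timed.val (hcongr _ hx)
    · simp only [vonNeumann, bind_cost, matMul_val, matMul_cost, vec_val, vec_cost,
        sqrt_val, sqrt_cost, div_val, div_cost]
      have := congrArg Timed.cost (hcongr _ hx)
      simp only [vec_val] at this
      rw [this]
      simp [Timed.ite_cost]
  · have hc1 : c' ≤ (121 * (m * m) + 1) * (26 * n) := by
      refine hcost.trans ?_
      dsimp only
      rw [Nat.sub_zero, mul_assoc]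
      exact Nat.mul_le_mul_left _ (by omega)
    have hn : 1 ≤ n := hm.trans hmn
    have h1 : r * ((t + 1) * (1 + r * 2)) ≤ m * (n * (3 * m)) := by gcongr; omega
    have h2 : (t + 1) * ((t + 1) * (1 + r * 2)) ≤ n * (n * (3 * m)) := by gcongr; omega
    have h3 : n ≤ m * m * n := Nat.le_mul_of_pos_left _ (by positivity)
    have h4 : m * m * n ≤ m * n * n := by
      rw [mul_right_comm]; exact Nat.mul_le_mul_left _ hmn
    nlinarith

end MaxSupport

namespace MaxSupport

open Timed Matrix

/-! ### Relative entropy -/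

/-- This rests on the factorization `(u + 2)³ - 27 u = (u - 1)² (u + 8)`. -/
theorem log_rational_deriv_nonneg {u : ℝ} (hu : 0 < u) : 0 ≤ 1 / u - 27 / (u + 2) ^ 3 := by
  rw [sub_nonneg, div_le_div_iff₀ (by positivity) hu]
  nlinarith [mul_nonneg (mul_self_nonneg (u - 1)) (by linarith : 0 ≤ u + 8)]

theorem hasDerivAt_log_sub_rational {u : ℝ} (hu : 0 < u) :
    HasDerivAt (fun u : ℝ => Real.log u - 3 * (u - 1) * (u + 5) / (2 * (u + 2) ^ 2))
      (1 / u - 27 / (u + 2) ^ 3) u := by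
  have h := (Real.hasDerivAt_log hu.ne').sub
    (((((hasDerivAt_id u).sub_const 1).const_mul 3).mul ((hasDerivAt_id u).add_const 5)).div
      ((((hasDerivAt_id u).add_const 2).pow 2).const_mul 2) (by simp; positivity))
  convert! h using 1
  simp only [id, Pi.mul_apply, Pi.pow_apply]
  field_simp
  norm_num
  ring

theorem monotoneOn_log_sub_rational :
    MonotoneOn (fun u : ℝ => Real.log u - 3 * (u - 1) * (u + 5) / (2 * (u + 2) ^ 2))
      (Set.Ioi 0) := by
  refine monotoneOn_of_deriv_nonneg (convex_Ioi 0) ?_ ?_ ?_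
  · exact fun u hu => (hasDerivAt_log_sub_rational hu).continuousAt.continuousWithinAt
  · rw [interior_Ioi]
    exact fun u hu => (hasDerivAt_log_sub_rational hu).differentiableAt.differentiableWithinAt
  · rw [interior_Ioi]
    intro u hu
    rw [(hasDerivAt_log_sub_rational hu).deriv]
    exact log_rational_deriv_nonneg hu

/-- The pointwise inequality behind Pinsker. The difference of the sides vanishes at 1, and so does
its derivative, which is increasing; hence 1 is the minimum. -/
theorem sq_div_le_mul_log {u : ℝ} (hu : 0 < u) :
    3 * (u - 1) ^ 2 / (2 * (u + 2)) ≤ u * Real.log u - u + 1 := by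
  set f : ℝ → ℝ := fun u => u * Real.log u - u + 1 - 3 * (u - 1) ^ 2 / (2 * (u + 2)) with hf
  have hderiv : ∀ u : ℝ, 0 < u → HasDerivAt f
      (Real.log u - 3 * (u - 1) * (u + 5) / (2 * (u + 2) ^ 2)) u := by
    intro u hu
    have h := ((((hasDerivAt_id u).mul (Real.hasDerivAt_log hu.ne')).sub (hasDerivAt_id u)).add_const
      1).sub (((((hasDerivAt_id u).sub_const 1).pow 2).const_mul 3).div
      (((hasDerivAt_id u).add_const 2).const_mul 2) (by simp; positivity))
    convert! h using 1
    simp only [id, Pi.pow_apply]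
    field_simp
    norm_num
    ring
  have hf1 : f 1 = 0 := by simp [hf]
  have hsign := monotoneOn_log_sub_rational
  have hk1 : Real.log 1 - 3 * ((1 : ℝ) - 1) * (1 + 5) / (2 * (1 + 2) ^ 2) = 0 := by simp
  suffices h : f 1 ≤ f u by rw [hf1] at h; simp only [hf] at h; linarith
  rcases le_total 1 u with h1 | h1
  · have hmono : MonotoneOn f (Set.Ici 1) := by
      refine monotoneOn_of_deriv_nonneg (convex_Ici 1) ?_ ?_ ?_
      · exact fun v hv => (hderiv v (zero_lt_one.trans_le hv)).continuousAt.continuousWithinAt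
      · rw [interior_Ici]
        exact fun v hv =>
          (hderiv v (zero_lt_one.trans hv)).differentiableAt.differentiableWithinAt
      · rw [interior_Ici]
        intro v hv
        have hv0 : (0 : ℝ) < v := zero_lt_one.trans hv
        rw [(hderiv v hv0).deriv, ← hk1]
        exact hsign (Set.mem_Ioi.2 one_pos) hv0 (le_of_lt hv)
    exact hmono (Set.mem_Ici.2 le_rfl) h1 h1
  · have hanti : AntitoneOn f (Set.Ioc 0 1) := by
      refine antitoneOn_of_deriv_nonpos (convex_Ioc 0 1) ?_ ?_ ?_
      · exact fun v hv => (hderiv v hv.1).continuousAt.continuousWithinAt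
      · rw [interior_Ioc]
        exact fun v hv => (hderiv v hv.1).differentiableAt.differentiableWithinAt
      · rw [interior_Ioc]
        intro v hv
        rw [(hderiv v hv.1).deriv, ← hk1]
        exact hsign hv.1 (Set.mem_Ioi.2 one_pos) hv.2.le
    exact hanti ⟨hu, h1⟩ ⟨one_pos, le_rfl⟩ h1

/-- Relative entropy of positive vectors. -/
noncomputable def relEntropy {t : ℕ} (p q : Fin t → ℝ) : ℝ := ∑ i, p i * Real.log (p i / q i)

theorem relEntropy_self {t : ℕ} {p : Fin t → ℝ} (hp : ∀ i, 0 < p i) : relEntropy p p = 0 := by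
  refine Finset.sum_eq_zero fun i _ => ?_
  rw [div_self (hp i).ne', Real.log_one, mul_zero]

/-- Pinsker's inequality. -/
theorem sq_sum_abs_sub_le_relEntropy {t : ℕ} {p q : Fin t → ℝ} (hp : ∀ i, 0 < p i)
    (hq : ∀ i, 0 < q i) (hp1 : ∑ i, p i = 1) (hq1 : ∑ i, q i = 1) :
    (∑ i, |p i - q i|) ^ 2 ≤ 2 * relEntropy p q := by
  have hpt : ∀ i, 3 * (p i - q i) ^ 2 / (2 * (p i + 2 * q i))
      ≤ p i * Real.log (p i / q i) - p i + q i := by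
    intro i
    have h := mul_le_mul_of_nonneg_left (sq_div_le_mul_log (div_pos (hp i) (hq i))) (hq i).le
    have hp0 := hp i
    have hq0 := hq i
    have e1 : q i * (3 * (p i / q i - 1) ^ 2 / (2 * (p i / q i + 2)))
        = 3 * (p i - q i) ^ 2 / (2 * (p i + 2 * q i)) := by
      field_simp
    have e2 : q i * (p i / q i * Real.log (p i / q i) - p i / q i + 1)
        = p i * Real.log (p i / q i) - p i + q i := by
      field_simp
    rwa [e1, e2] at h
  have hsum := Finset.sum_le_sum fun i (_ : i ∈ Finset.univ) => hpt i
  rw [Finset.sum_add_distrib, Finset.sum_sub_distrib, hp1, hq1] at hsum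
  -- Cauchy–Schwarz with the weights `2 (p_i + 2 q_i) / 3`, whose sum is 2; the other factor is
  -- bounded by the pointwise inequality, in which `-p_i + q_i` sums to zero.
  have hcs := Finset.sum_sq_le_sum_mul_sum_of_sq_le_mul Finset.univ
    (r := fun i => |p i - q i|) (f := fun i => 2 * (p i + 2 * q i) / 3)
    (g := fun i => 3 * (p i - q i) ^ 2 / (2 * (p i + 2 * q i)))
    (fun i _ => by have := hp i; have := hq i; positivity)
    (fun i _ => by have := hp i; have := hq i; positivity)
    (fun i _ => by
      have h1 := hp i
      have h2 := hq i
      rw [sq_abs]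
      apply le_of_eq
      field_simp)
  have h3 : ∑ i, 2 * (p i + 2 * q i) / 3 = 2 := by
    rw [← Finset.sum_div, ← Finset.mul_sum, Finset.sum_add_distrib, ← Finset.mul_sum, hp1, hq1]
    norm_num
  rw [h3] at hcs
  unfold relEntropy
  linarith

/-- The normalized vector with coordinates `x_i exp (-g_i)`. -/
noncomputable def gibbs {t : ℕ} (x g : Fin t → ℝ) : Fin t → ℝ :=
  fun i => x i * Real.exp (-g i) / ∑ l, x l * Real.exp (-g l)

section Gibbs

variable {t : ℕ} {x g : Fin (t + 1) → ℝ}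

theorem gibbs_sum_pos (hx : ∀ i, 0 < x i) : 0 < ∑ l, x l * Real.exp (-g l) :=
  Finset.sum_pos (fun i _ => mul_pos (hx i) (Real.exp_pos _)) ⟨0, Finset.mem_univ _⟩

theorem gibbs_pos (hx : ∀ i, 0 < x i) (i : Fin (t + 1)) : 0 < gibbs x g i :=
  div_pos (mul_pos (hx i) (Real.exp_pos _)) (gibbs_sum_pos hx)

theorem sum_gibbs (hx : ∀ i, 0 < x i) : ∑ i, gibbs x g i = 1 := by
  simp only [gibbs]
  rw [← Finset.sum_div, div_self (gibbs_sum_pos hx).ne']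

theorem log_gibbs (hx : ∀ i, 0 < x i) (i : Fin (t + 1)) :
    Real.log (gibbs x g i)
      = Real.log (x i) - g i - Real.log (∑ l, x l * Real.exp (-g l)) := by
  rw [gibbs, Real.log_div (mul_pos (hx i) (Real.exp_pos _)).ne' (gibbs_sum_pos hx).ne',
    Real.log_mul (hx i).ne' (Real.exp_pos _).ne', Real.log_exp]
  ring

/-- The logarithm of a Gibbs vector is affine in `g`, so the optimality gap of the entropic
minimization is exactly a relative entropy. With `p` the Gibbs vector itself this computes the
minimum, `-log` of the partition sum. -/
theorem relEntropy_gibbs (hx : ∀ i, 0 < x i) {p : Fin (t + 1) → ℝ} (hp : ∀ i, 0 < p i)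
    (hp1 : ∑ i, p i = 1) :
    relEntropy p (gibbs x g)
      = relEntropy p x + ∑ i, p i * g i + Real.log (∑ l, x l * Real.exp (-g l)) := by
  have h : ∀ i, p i * Real.log (p i / gibbs x g i) = p i * Real.log (p i / x i) + p i * g i
      + p i * Real.log (∑ l, x l * Real.exp (-g l)) := by
    intro i
    rw [Real.log_div (hp i).ne' (gibbs_pos hx i).ne', Real.log_div (hp i).ne' (hx i).ne',
      log_gibbs hx]
    ring
  simp only [relEntropy, h]
  rw [Finset.sum_add_distrib, Finset.sum_add_distrib, ← Finset.sum_mul, hp1, one_mul]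

end Gibbs

/-! ### Steps of the smoothed perceptron and of mirror prox in a Euclidean space -/

section Euclidean

open scoped InnerProductSpace

variable {E : Type*} [NormedAddCommGroup E] [InnerProductSpace ℝ E]

/-- Pinsker's inequality carried over to `E`: vectors of length at most 1 map the 1-norm to the norm
of `E` without expansion. -/
theorem norm_comb_sub_sq_le {t : ℕ} {β : Fin t → E} (hβ : ∀ i, ‖β i‖ ≤ 1) {p q : Fin t → ℝ}
    (hp : ∀ i, 0 < p i) (hq : ∀ i, 0 < q i) (hp1 : ∑ i, p i = 1) (hq1 : ∑ i, q i = 1) :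
    ‖∑ i, p i • β i - ∑ i, q i • β i‖ ^ 2 ≤ 2 * relEntropy p q := by
  refine le_trans (pow_le_pow_left₀ (norm_nonneg _) ?_ 2)
    (sq_sum_abs_sub_le_relEntropy hp hq hp1 hq1)
  rw [← Finset.sum_sub_distrib]
  refine (norm_sum_le _ _).trans (Finset.sum_le_sum fun i _ => ?_)
  rw [← sub_smul, norm_smul, Real.norm_eq_abs]
  exact mul_le_of_le_one_right (abs_nonneg _) (hβ i)

/-- Nesterov's excessive gap invariant. Here `p = B x`, `q = B x_μ(y)`, and `p₁` is the image of the
minimizer at the new point; `LN = log N`, `LZ` and `LZ'` are logarithms of the partition sums at the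
old and the new point, and `D` is the negative entropy of the new minimizer. `h1` says that this
minimizer is suboptimal at `y`, with strong convexity; `h2` that it is optimal at the new point. -/
theorem smoothedPerceptron_step {y p q p₁ : E} {μ τ LN LZ LZ' D : ℝ} (hτ0 : 0 ≤ τ) (hτ1 : τ ≤ 1)
    (hτμ : τ ^ 2 ≤ (1 - τ) * μ)
    (h0 : ‖p‖ ^ 2 + ‖y‖ ^ 2 ≤ 2 * (μ * (LN - LZ)))
    (h1 : -(μ * LZ) + μ / 2 * ‖p₁ - q‖ ^ 2 ≤ ⟪y, p₁⟫_ℝ + μ * D)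
    (h2 : -((1 - τ) * μ * LZ')
      = ⟪(1 - τ) • (y + τ • p) + τ ^ 2 • q, p₁⟫_ℝ + (1 - τ) * μ * D) :
    ‖(1 - τ) • p + τ • p₁‖ ^ 2 + ‖(1 - τ) • (y + τ • p) + τ ^ 2 • q‖ ^ 2
      ≤ 2 * ((1 - τ) * μ * (LN - LZ')) := by
  -- The claim is a linear combination of three nonnegative squares and the two hypotheses `h0` and
  -- `h1` weighted with `1 - τ`, given the equation `h2`.
  have a1 := mul_nonneg (mul_nonneg hτ0 (sub_nonneg.2 hτ1))
    (real_inner_self_nonneg (x := y - ((1 - τ) • p + τ • q)))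
  have a2 := mul_nonneg (mul_nonneg (mul_nonneg hτ0 hτ0) (sub_nonneg.2 hτ1))
    (real_inner_self_nonneg (x := p - q))
  have a3 := mul_nonneg (sub_nonneg.2 hτμ) (real_inner_self_nonneg (x := p₁ - q))
  have a4 := mul_nonneg (sub_nonneg.2 hτ1) (sub_nonneg.2 h0)
  have a5 := mul_nonneg (sub_nonneg.2 hτ1) (sub_nonneg.2 h1)
  simp only [← real_inner_self_eq_norm_sq, inner_add_left, inner_add_right, inner_sub_left,
    inner_sub_right, inner_smul_left, inner_smul_right, conj_trivial, real_inner_comm y p,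
    real_inner_comm y q, real_inner_comm p q, real_inner_comm p p₁,
    real_inner_comm q p₁] at a1 a2 a3 a4 a5 h2 ⊢
  have hcy := real_inner_comm p y
  linarith

/-- The projection onto the unit ball. -/
noncomputable def ballProj (a : E) : E := if ‖a‖ ≤ 1 then a else ‖a‖⁻¹ • a

theorem norm_ballProj_le (a : E) : ‖ballProj a‖ ≤ 1 := by
  unfold ballProj
  split_ifs with h
  · exact h
  · rw [norm_smul, norm_inv, norm_norm, inv_mul_cancel₀ (by linarith)]

theorem inner_ballProj_nonpos (a : E) {U : E} (hU : ‖U‖ ≤ 1) :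
    ⟪a - ballProj a, U - ballProj a⟫_ℝ ≤ 0 := by
  unfold ballProj
  split_ifs with h
  · simp
  · push Not at h
    have h0 : ‖a‖ ≠ 0 := by linarith
    have e : a - ‖a‖⁻¹ • a = (1 - ‖a‖⁻¹) • a := by module
    have h1 : ⟪a, U⟫_ℝ ≤ ‖a‖ := (real_inner_le_norm a U).trans
      (mul_le_of_le_one_right (norm_nonneg a) hU)
    have h2 : 0 ≤ 1 - ‖a‖⁻¹ := sub_nonneg.2 (inv_le_one_of_one_le₀ h.le)
    rw [e, inner_smul_left, inner_sub_right, inner_smul_right, real_inner_self_eq_norm_sq,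
      conj_trivial, pow_two, inv_mul_cancel_left₀ h0]
    exact mul_nonpos_of_nonneg_of_nonpos h2 (by linarith)

/-- The three-point inequality of a projected step: the variational inequality of the projection,
rewritten by polarization. -/
theorem inner_ballProj_le (u g : E) {U : E} (hU : ‖U‖ ≤ 1) :
    2 * ⟪g, U - ballProj (u + g)⟫_ℝ ≤ ‖U - u‖ ^ 2 - ‖U - ballProj (u + g)‖ ^ 2
      - ‖ballProj (u + g) - u‖ ^ 2 := by
  have h := inner_ballProj_nonpos (u + g) hU
  set v := ballProj (u + g)
  simp only [← real_inner_self_eq_norm_sq, inner_add_left, inner_sub_left,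
    inner_sub_right, real_inner_comm U v, real_inner_comm U u, real_inner_comm u v] at h ⊢
  linarith

/-- The regret at the extrapolated point `(v, w)` against `U` and the vertex `e_i` of the simplex is
at most a decrease of distances, which telescopes. It suffices to compare with vertices, and the
relative entropy of `e_i` with respect to `x` is `-log x_i`. -/
theorem mirrorProx_step {t : ℕ} {β : Fin (t + 1) → E} (hβ : ∀ i, ‖β i‖ ≤ 1) {τ : ℝ} (hτ : 0 < τ)
    (u : E) {x : Fin (t + 1) → ℝ} (hx : ∀ i, 0 < x i) (hx1 : ∑ i, x i = 1) {v u' : E}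
    {w x' : Fin (t + 1) → ℝ} (hv : v = ballProj (u + τ⁻¹ • ∑ i, x i • β i))
    (hw : w = gibbs x fun i => τ * ⟪β i, u⟫_ℝ)
    (hu' : u' = ballProj (u + τ⁻¹ • ∑ i, w i • β i))
    (hx' : x' = gibbs x fun i => τ * ⟪β i, v⟫_ℝ) {U : E} (hU : ‖U‖ ≤ 1) (i : Fin (t + 1)) :
    ⟪U, ∑ i, w i • β i⟫_ℝ - ⟪β i, v⟫_ℝ ≤ τ / 2 * (‖U - u‖ ^ 2 - ‖U - u'‖ ^ 2)
      + (Real.log (x' i) - Real.log (x i)) / τ := by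
  have hwpos : ∀ i, 0 < w i := fun i => hw ▸ gibbs_pos hx i
  have hw1 : ∑ i, w i = 1 := hw ▸ sum_gibbs hx
  have hxpos' : ∀ i, 0 < x' i := fun i => hx' ▸ gibbs_pos hx i
  have hx1' : ∑ i, x' i = 1 := hx' ▸ sum_gibbs hx
  have hinner : ∀ (p : Fin (t + 1) → ℝ) (y : E),
      ∑ i, p i * (τ * ⟪β i, y⟫_ℝ) = τ * ⟪y, ∑ i, p i • β i⟫_ℝ := by
    intro p y
    rw [inner_sum, Finset.mul_sum]
    refine Finset.sum_congr rfl fun i _ => ?_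
    rw [inner_smul_right, real_inner_comm]; ring
  have e1 := log_gibbs (g := fun i => τ * ⟪β i, v⟫_ℝ) hx i
  have e2 := relEntropy_gibbs (g := fun i => τ * ⟪β i, v⟫_ℝ) hx hxpos' hx1'
  have e3 := relEntropy_gibbs (g := fun i => τ * ⟪β i, u⟫_ℝ) hx hxpos' hx1'
  have e4 := relEntropy_gibbs (g := fun i => τ * ⟪β i, u⟫_ℝ) hx hwpos hw1
  rw [← hx'] at e1 e2
  rw [← hw] at e3 e4
  rw [relEntropy_self hxpos', hinner] at e2
  rw [hinner] at e3
  rw [relEntropy_self hwpos, hinner] at e4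
  have k1 := norm_comb_sub_sq_le hβ hxpos' hwpos hx1' hw1
  have k2 := norm_comb_sub_sq_le hβ hwpos hx hw1 hx1
  have p1 := inner_ballProj_le u (τ⁻¹ • ∑ i, w i • β i) hU
  have p2 := inner_ballProj_le u (τ⁻¹ • ∑ i, x i • β i)
    (U := u') (hu' ▸ norm_ballProj_le _)
  rw [← hu'] at p1
  rw [← hv] at p2
  set bw := ∑ i, w i • β i
  set bx := ∑ i, x i • β i
  set bx' := ∑ i, x' i • β i
  rw [inner_smul_left, conj_trivial] at p1 p2
  -- These squares bound the cross terms between both blocks. What they cost is covered by the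
  -- negative terms of the projections `p1`, `p2` and by the entropies, through Pinsker's inequality
  -- in `k1`, `k2`.
  have q1 := real_inner_self_nonneg (x := τ • (u' - v) - (bw - bx))
  have q2 := real_inner_self_nonneg (x := τ • (v - u) - (bw - bx'))
  have hdiv : (Real.log (x' i) - Real.log (x i)) / τ
      = -⟪β i, v⟫_ℝ - Real.log (∑ l, x l * Real.exp (-(τ * ⟪β l, v⟫_ℝ))) / τ := by
    rw [e1]; field_simp; ring
  rw [hdiv]
  set LZ := Real.log (∑ l, x l * Real.exp (-(τ * ⟪β l, v⟫_ℝ)))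
  suffices h : τ * ⟪U, bw⟫_ℝ + LZ ≤ τ * (τ / 2 * (‖U - u‖ ^ 2 - ‖U - u'‖ ^ 2)) by
    have h2 : ⟪U, bw⟫_ℝ + LZ / τ ≤ τ / 2 * (‖U - u‖ ^ 2 - ‖U - u'‖ ^ 2) := by
      have e : ⟪U, bw⟫_ℝ + LZ / τ = (τ * ⟪U, bw⟫_ℝ + LZ) / τ := by field_simp
      rw [e, div_le_iff₀ hτ]
      linarith
    linarith
  have p1' : τ * (2 * ⟪bw, U - u'⟫_ℝ) ≤ τ ^ 2 * (‖U - u‖ ^ 2 - ‖U - u'‖ ^ 2 - ‖u' - u‖ ^ 2) := by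
    have := mul_le_mul_of_nonneg_left p1 (sq_nonneg τ)
    refine le_of_eq_of_le ?_ this
    field_simp
  have p2' : τ * (2 * ⟪bx, u' - v⟫_ℝ) ≤ τ ^ 2 * (‖u' - u‖ ^ 2 - ‖u' - v‖ ^ 2 - ‖v - u‖ ^ 2) := by
    have := mul_le_mul_of_nonneg_left p2 (sq_nonneg τ)
    refine le_of_eq_of_le ?_ this
    field_simp
  have hcomm : ∀ a b : E, ⟪a, b⟫_ℝ = ⟪b, a⟫_ℝ := fun a b => real_inner_comm b a
  simp only [← real_inner_self_eq_norm_sq, inner_sub_left, inner_sub_right, inner_smul_left,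
    inner_smul_right, conj_trivial, hcomm bx bw, hcomm bx' bw, hcomm u bw, hcomm v bw, hcomm u' bw,
    hcomm U bw, hcomm v bx, hcomm u' bx, hcomm u bx', hcomm v bx', hcomm u u',
    hcomm u v, hcomm u' v, hcomm u U, hcomm u' U] at *
  nlinarith

end Euclidean

end MaxSupport

namespace MaxSupport

open Timed Matrix

open scoped InnerProductSpace

/-! ### The normalized columns as points of a Euclidean space -/

/-- The matrix with columns `a_i / ‖a_i‖_Q`. -/
noncomputable def normalized {r t : ℕ} (A : Matrix (Fin r) (Fin t) ℝ)
    (Q : Matrix (Fin r) (Fin r) ℝ) : Matrix (Fin r) (Fin t) ℝ :=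
  of fun l i => A l i / √(A.col i ⬝ᵥ Q *ᵥ A.col i)

section Normalized

variable {r t : ℕ} (A : Matrix (Fin r) (Fin t) ℝ) (Q : Matrix (Fin r) (Fin r) ℝ)

theorem normalized_col (i : Fin t) :
    (normalized A Q).col i = (√(A.col i ⬝ᵥ Q *ᵥ A.col i))⁻¹ • A.col i := by
  funext l; simp [normalized, div_eq_inv_mul]

theorem normalized_mulVec (x : Fin t → ℝ) : normalized A Q *ᵥ x
    = ∑ i, (x i / √(A.col i ⬝ᵥ Q *ᵥ A.col i)) • A.col i := by
  funext l
  simp only [mulVec, dotProduct, Finset.sum_apply, Pi.smul_apply, smul_eq_mul, normalized,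
    of_apply, col_apply]
  exact Finset.sum_congr rfl fun i _ => by ring

theorem normalizedColumns_val :
    (normalizedColumns A Q).val = (normalized A Q, Q * normalized A Q) := by
  simp only [normalizedColumns, bind_val, matMul_val, vec_val, dot_val, sqrt_val, mat_val, div_val,
    pure_val, Prod.mk.injEq]
  refine ⟨rfl, ?_⟩
  ext l i
  simp only [of_apply, mul_apply, normalized, Finset.sum_div]
  refine Finset.sum_congr rfl fun k _ => ?_
  rw [mul_div_assoc]
  rfl

theorem normalizedColumns_cost :
    (normalizedColumns A Q).cost = r * (t * (1 + r * 2)) + (t * (1 + r * 2 + 1) + r * t + r * t) := by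
  simp [normalizedColumns, add_assoc]

end Normalized

open scoped MatrixOrder in
theorem exists_transpose_mul_self {r : ℕ} {Q : Matrix (Fin r) (Fin r) ℝ} (hQ : Q.PosSemidef) :
    ∃ S : Matrix (Fin r) (Fin r) ℝ, Q = Sᵀ * S :=
  CStarAlgebra.nonneg_iff_eq_star_mul_self.mp hQ.nonneg

/-- A factorization `Q = Sᵀ S` makes `v ↦ S v` an isometry from `‖·‖_Q` to the Euclidean norm, so
the estimates in inner product spaces apply to the programs. -/
theorem exists_embedding {r t : ℕ} {A : Matrix (Fin r) (Fin t) ℝ} {Q : Matrix (Fin r) (Fin r) ℝ}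
    (hQ : Q.PosDef) (hA : ∀ i, A.col i ≠ 0) :
    ∃ (T : (Fin r → ℝ) →ₗ[ℝ] EuclideanSpace ℝ (Fin r)) (β : Fin t → EuclideanSpace ℝ (Fin r)),
      (∀ i, ‖β i‖ ≤ 1) ∧ (∀ x, T (normalized A Q *ᵥ x) = ∑ i, x i • β i) ∧
      (∀ y i, ((Q * normalized A Q)ᵀ *ᵥ y) i = ⟪β i, T y⟫_ℝ) ∧
      (∀ v, √(v ⬝ᵥ Q *ᵥ v) = ‖T v‖) ∧
      ∀ y, (∀ i, 0 < ⟪β i, T y⟫_ℝ) → ∀ i, 0 < A.col i ⬝ᵥ Q *ᵥ y := by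
  obtain ⟨S, hS⟩ := exists_transpose_mul_self hQ.posSemidef
  let T : (Fin r → ℝ) →ₗ[ℝ] EuclideanSpace ℝ (Fin r) :=
    (WithLp.linearEquiv 2 ℝ (Fin r → ℝ)).symm.toLinearMap ∘ₗ S.mulVecLin
  have hT : ∀ u v, ⟪T u, T v⟫_ℝ = u ⬝ᵥ Q *ᵥ v := by
    intro u v
    have : ⟪T u, T v⟫_ℝ = (S *ᵥ v) ⬝ᵥ (S *ᵥ u) := by
      simp [T, EuclideanSpace.inner_eq_star_dotProduct]
    rw [this, dotProduct_comm, hS, ← mulVec_mulVec, dotProduct_mulVec u, vecMul_transpose]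
  have hnorm : ∀ v, √(v ⬝ᵥ Q *ᵥ v) = ‖T v‖ := fun v => by
    rw [← hT, real_inner_self_eq_norm_sq, Real.sqrt_sq (norm_nonneg _)]
  have hd : ∀ i, 0 < √(A.col i ⬝ᵥ Q *ᵥ A.col i) := fun i => Real.sqrt_pos.2 (PosDef.pos hQ (hA i))
  refine ⟨T, fun i => T ((normalized A Q).col i), fun i => ?_, fun x => ?_, fun y i => ?_, hnorm,
    fun y hy i => ?_⟩
  · dsimp only
    rw [normalized_col, map_smul, norm_smul, ← hnorm, norm_inv, Real.norm_of_nonneg (hd i).le,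
      inv_mul_cancel₀ (hd i).ne']
  · rw [normalized_mulVec, map_sum]
    refine Finset.sum_congr rfl fun i _ => ?_
    dsimp only
    rw [normalized_col, map_smul, map_smul, smul_smul]
    rfl
  · rw [hT, PosDef.comm hQ, dotProduct_comm]
    rfl
  · have := hy i
    rw [hT, normalized_col, smul_dotProduct, smul_eq_mul] at this
    exact (mul_pos_iff_of_pos_left (inv_pos.2 (hd i))).1 this

theorem isFirstOrderResult_of_small {r t : ℕ} {A : Matrix (Fin r) (Fin t) ℝ}
    {Q : Matrix (Fin r) (Fin r) ℝ} {ε : ℝ} {x : Fin t → ℝ} (hx : ∀ i, 0 ≤ x i) (hx1 : ∑ i, x i = 1)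
    (h : √((normalized A Q *ᵥ x) ⬝ᵥ Q *ᵥ (normalized A Q *ᵥ x)) ≤ ε) :
    IsFirstOrderResult A Q ε x (normalized A Q *ᵥ x) :=
  Or.inr ⟨hx, hx1, normalized_mulVec A Q x, h⟩

/-! ### Normalization and soft minimum on the simplex -/

section Simplex

variable {t : ℕ}

theorem normalizeSum_val (v : Fin t → ℝ) :
    (normalizeSum v).val = fun i => v i / ∑ l, v l := by
  simp [normalizeSum]

@[simp] theorem normalizeSum_cost (v : Fin t → ℝ) : (normalizeSum v).cost = 1 + t + t := by
  simp [normalizeSum]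

@[simp] theorem uniform_val : (uniform t : Timed (Fin t → ℝ)).val = fun _ => 1 / (t : ℝ) := by
  simp [uniform]

@[simp] theorem uniform_cost : (uniform t : Timed (Fin t → ℝ)).cost = 3 := by
  simp [uniform]

@[simp] theorem softMin_val (μ : ℝ) (g : Fin t → ℝ) :
    (softMin μ g).val = gibbs (fun _ => 1) fun i => g i / μ := by
  simp only [softMin, bind_val, lit_val, vec_val, sub_val, div_val, exp_val, normalizeSum_val]
  funext i
  simp [gibbs, neg_div]

@[simp] theorem softMin_cost (μ : ℝ) (g : Fin t → ℝ) : (softMin μ g).cost = 2 + t * 5 := by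
  simp [softMin]; ring

end Simplex

/-! ### The smoothed perceptron -/

section SmoothedPerceptron

variable {r t : ℕ} (B QB : Matrix (Fin r) (Fin t) ℝ) (Q : Matrix (Fin r) (Fin r) ℝ) (ε : ℝ) (k : ℕ)
  (x : Fin t → ℝ) (y : Fin r → ℝ) (μ : ℝ)

theorem smoothedPerceptronRound_val :
    ((∀ i, 0 < (QBᵀ *ᵥ y) i) ∧
      (smoothedPerceptronRound B QB Q ε (k, x, y, μ)).val = some (Sum.inr (x, y))) ∨
    (√((B *ᵥ x) ⬝ᵥ Q *ᵥ B *ᵥ x) ≤ ε ∧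
      (smoothedPerceptronRound B QB Q ε (k, x, y, μ)).val = some (Sum.inr (x, B *ᵥ x))) ∨
    ((∃ i, (QBᵀ *ᵥ y) i ≤ 0) ∧ ε < √((B *ᵥ x) ⬝ᵥ Q *ᵥ B *ᵥ x) ∧ ∃ (τ : ℝ) (y' : Fin r → ℝ),
      τ = 2 / (k + 3) ∧
      y' = (1 - τ) • (y + τ • B *ᵥ x)
        + τ ^ 2 • B *ᵥ gibbs (fun _ => 1) (fun i => (QBᵀ *ᵥ y) i / μ) ∧
      (smoothedPerceptronRound B QB Q ε (k, x, y, μ)).val = some (Sum.inl (k + 1,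
        (1 - τ) • x + τ • gibbs (fun _ => 1) (fun i => (QBᵀ *ᵥ y') i / ((1 - τ) * μ)),
        y', (1 - τ) * μ))) := by
  by_cases hg : ∀ i, 0 < (QBᵀ *ᵥ y) i
  · left
    have hb := (allPos_val _).2 hg
    simp [smoothedPerceptronRound, hb, hg]
  · right
    have hb : (allPos (QBᵀ *ᵥ y)).val = false := by
      rw [← Bool.not_eq_true, allPos_val]; exact hg
    rcases le_or_gt (√((B *ᵥ x) ⬝ᵥ Q *ᵥ B *ᵥ x)) ε with hs | hs
    · left
      have hb2 := (le_val _ _).2 hs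
      simp [smoothedPerceptronRound, hb, hb2, hs, -le_val, -mulVec_mulVec]
    · right
      have hb2 := (le_val_false _ _).2 hs
      push Not at hg
      refine ⟨hg, hs, 2 / (k + 3), _, rfl, rfl, ?_⟩
      have hy' : (1 - 2 / ((k : ℝ) + 3)) • (y + (2 / ((k : ℝ) + 3)) • B *ᵥ x)
          + (2 / ((k : ℝ) + 3)) ^ 2 • B *ᵥ gibbs (fun _ => 1) (fun i => (QBᵀ *ᵥ y) i / μ)
          = fun i => (1 - 2 / ((k : ℝ) + 3)) * (y i + 2 / ((k : ℝ) + 3) * (B *ᵥ x) i)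
            + 2 / ((k : ℝ) + 3) * (2 / ((k : ℝ) + 3))
              * (B *ᵥ gibbs (fun _ => 1) (fun i => (QBᵀ *ᵥ y) i / μ)) i := by
        funext i; simp [pow_two, mul_add]
      rw [hy']
      simp [smoothedPerceptronRound, hb, hb2, -le_val, -mulVec_mulVec]
      rfl

theorem smoothedPerceptronRound_cost_le :
    (smoothedPerceptronRound B QB Q ε (k, x, y, μ)).cost
      ≤ 2 * (t * (1 + r * 2)) + 15 * t + 2 * (r * (1 + t * 2)) + r * (1 + r * 2) + 7 * r + 16 := by
  have h := allPos_cost_le (QBᵀ *ᵥ y)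
  simp only [smoothedPerceptronRound, bind_cost, matVec_val, matVec_cost]
  split_ifs
  · simp only [pure_cost]; nlinarith
  · simp only [bind_cost, normQ_cost, matVec_cost, le_cost]
    split_ifs
    · simp only [pure_cost]; nlinarith
    · simp only [bind_cost, lit_cost, div_cost, sub_cost, mul_cost, softMin_cost, matVec_cost,
        vec_cost, add_cost, pure_cost, Finset.sum_const, Finset.card_univ, Fintype.card_fin,
        smul_eq_mul]
      nlinarith

end SmoothedPerceptron

/-- A bound on the number of iterations of the entropy-based methods. -/
noncomputable def entropyRounds (m n : ℕ) : ℕ := ⌊32 * m * √(Real.log n)⌋₊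

/-- `1024 = 32²` leaves room for the constant `968 = 8 · 121` of the smoothed perceptron and `242 =
2 · 121` of mirror prox. -/
theorem le_entropyRounds {m n j : ℕ} (h : (j : ℝ) ^ 2 ≤ 1024 * m ^ 2 * Real.log n) :
    j ≤ entropyRounds m n := by
  refine Nat.le_floor ?_
  have hlog : 0 ≤ Real.log n := Real.log_natCast_nonneg n
  refine abs_le_of_sq_le_sq' ?_ (by positivity) |>.2
  rw [mul_pow, mul_pow, Real.sq_sqrt hlog]
  linarith

/-- A failed feasibility test provides such an `i`, so the logarithm of the partition sum can be
dropped from the invariant. -/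
theorem one_le_sum_exp {t : ℕ} {g : Fin t → ℝ} {i : Fin t} (h : g i ≤ 0) :
    1 ≤ ∑ l, 1 * Real.exp (-g l) :=
  (Real.one_le_exp (x := -g i) (by linarith)).trans <| by
    simpa using Finset.single_le_sum (f := fun l => Real.exp (-g l))
      (fun l _ => (Real.exp_pos _).le) (Finset.mem_univ i)

/-- The recursion for `μ` solves to `4 / ((k + 1) (k + 2))`. While the method goes on, the invariant
gives `ε² ≤ ‖B x_k‖_Q² ≤ 2 μ log n`, which bounds `k` by a multiple of `m √(log n)`. -/
theorem smoothedPerceptron_correct {m n : ℕ} (hm : 1 ≤ m) (hmn : m ≤ n) :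
    FirstOrderCorrect smoothedPerceptron m n (100 * (m * m * n)
      + (entropyRounds m n + 1) * (100 * (m * n))) := by
  refine ⟨entropyRounds m n + 1, fun calls r t A Q hr ht hQ hA => ?_⟩
  set J := entropyRounds m n
  set ε : ℝ := 1 / (11 * m) with hε
  have hm0 : (1 : ℝ) ≤ m := by exact_mod_cast hm
  have hε0 : 0 < ε := by positivity
  obtain ⟨T, β, hβ, hcomb, hg, hnorm, hfeas⟩ := exists_embedding hQ hA
  obtain ⟨B, hB⟩ : ∃ B, B = normalized A Q := ⟨_, rfl⟩
  rw [← hB] at hcomb hg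
  have hone : ∀ i : Fin (t + 1), (0 : ℝ) < (fun _ => 1 : Fin (t + 1) → ℝ) i := fun _ => one_pos
  have hrn : r ≤ n := hr.trans hmn
  have hKb : ∀ {c : ℕ}, c ≤ 2 * ((t + 1) * (1 + r * 2)) + 15 * (t + 1)
      + 2 * (r * (1 + (t + 1) * 2)) + r * (1 + r * 2) + 7 * r + 16 → c ≤ 100 * (m * n) := by
    intro c hc
    have h1 : (t + 1) * (1 + r * 2) ≤ n * (m * 3) := by gcongr; omega
    have h2 : r * (1 + (t + 1) * 2) ≤ m * (n * 3) := by gcongr; omega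
    have h3 : r * (1 + r * 2) ≤ m * (n * 3) := by gcongr; omega
    have h4 : n ≤ m * n := Nat.le_mul_of_pos_left _ hm
    nlinarith
  have hinner : ∀ (p : Fin (t + 1) → ℝ) (y : EuclideanSpace ℝ (Fin r)) (μ : ℝ), 0 < μ →
      μ * ∑ i, p i * (⟪β i, y⟫_ℝ / μ) = ⟪y, ∑ i, p i • β i⟫_ℝ := by
    intro p y μ hμ
    rw [inner_sum, Finset.mul_sum]
    refine Finset.sum_congr rfl fun i _ => ?_
    rw [inner_smul_right, real_inner_comm]
    field_simp
  have hgeq : ∀ y : Fin r → ℝ, (Q * B)ᵀ *ᵥ y = fun i => ⟪β i, T y⟫_ℝ := fun y => funext (hg y)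
  obtain ⟨b, c', hrun, hpost, hcost⟩ := loop_halts
    (round := fun _ => smoothedPerceptronRound B (Q * B) Q ε) (N := 0)
    (fun st : ℕ × (Fin (t + 1) → ℝ) × (Fin r → ℝ) × ℝ =>
      st.2.2.2 = 4 / ((st.1 + 1) * (st.1 + 2)) ∧ (∀ i, 0 ≤ st.2.1 i) ∧ ∑ i, st.2.1 i = 1 ∧
      ‖∑ i, st.2.1 i • β i‖ ^ 2 + ‖T st.2.2.1‖ ^ 2 ≤ 2 * (st.2.2.2 * (Real.log (t + 1 : ℕ)
        - Real.log (∑ l, 1 * Real.exp (-(⟪β l, T st.2.2.1⟫_ℝ / st.2.2.2))))) ∧ st.1 ≤ J)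
    (fun b => IsFirstOrderResult A Q ε b.1 b.2)
    (fun st => J - st.1) (fun st => (J - st.1 + 1) * (100 * (m * n))) (by
      rintro ⟨k, x, y, μ⟩ ⟨hμ, hx0, hx1, hinv, hk⟩
      dsimp only at hμ hx0 hx1 hinv hk
      have hμ0 : 0 < μ := by rw [hμ]; positivity
      have hc := hKb (smoothedPerceptronRound_cost_le B (Q * B) Q ε k x y μ)
      have hc2 : (smoothedPerceptronRound B (Q * B) Q ε (k, x, y, μ)).cost
          ≤ (J - k + 1) * (100 * (m * n)) := hc.trans (Nat.le_mul_of_pos_left _ (by omega))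
      rcases smoothedPerceptronRound_val B (Q * B) Q ε k x y μ with
        ⟨hpos, hv⟩ | ⟨hsmall, hv⟩ | ⟨⟨i, hi⟩, hlarge, τ, y', hτ, hy', hv⟩
      · refine ⟨_, _, fun _ _ => Timed.ext' hv rfl, by simp, ?_⟩
        rintro _ ⟨⟩
        rw [hgeq] at hpos
        exact ⟨Or.inl (hfeas y hpos), hc2⟩
      · refine ⟨_, _, fun _ _ => Timed.ext' hv rfl, by simp, ?_⟩
        rintro _ ⟨⟩
        subst hB
        exact ⟨isFirstOrderResult_of_small hx0 hx1 hsmall, hc2⟩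
      · refine ⟨_, _, fun _ _ => Timed.ext' hv rfl, ?_, by simp⟩
        rintro _ ⟨⟩
        rw [hgeq] at hi hy' ⊢
        rw [hgeq] at *
        rw [hnorm, hcomb] at hlarge
        have hk3 : (0 : ℝ) < k + 3 := by positivity
        have hτ0 : 0 < τ := by rw [hτ]; positivity
        have hτ1 : τ < 1 := by rw [hτ, div_lt_one hk3]; linarith [(Nat.cast_nonneg k : (0 : ℝ) ≤ k)]
        have hμ' : (1 - τ) * μ = 4 / ((((k + 1 : ℕ) : ℝ) + 1) * ((k + 1 : ℕ) + 2)) := by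
          rw [hμ, hτ]; push_cast; field_simp; ring
        have hμ'0 : 0 < (1 - τ) * μ := mul_pos (by linarith) hμ0
        have hk' : k + 1 ≤ J := by
          apply le_entropyRounds
          have hZ := Real.log_nonneg (one_le_sum_exp (g := fun l => ⟪β l, T y⟫_ℝ / μ) (i := i)
            (div_nonpos_of_nonpos_of_nonneg hi hμ0.le))
          have h1 : ε ^ 2 ≤ 2 * (μ * Real.log (t + 1 : ℕ)) := by
            have h2 : ε ^ 2 ≤ ‖∑ i, x i • β i‖ ^ 2 := pow_le_pow_left₀ hε0.le hlarge.le 2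
            nlinarith [sq_nonneg ‖T y‖, mul_nonneg hμ0.le hZ]
          have h2 : Real.log (t + 1 : ℕ) ≤ Real.log n :=
            Real.log_le_log (by positivity) (by exact_mod_cast ht)
          have h3 : 1 ≤ 968 * m ^ 2 / ((k + 1 : ℝ) * (k + 2)) * Real.log n := by
            have h4 : ε ^ 2 ≤ 2 * (μ * Real.log n) := by nlinarith
            rw [hε, hμ] at h4
            have := mul_le_mul_of_nonneg_left h4 (by positivity : (0 : ℝ) ≤ 121 * m ^ 2)
            have e1 : 121 * (m : ℝ) ^ 2 * (1 / (11 * m)) ^ 2 = 1 := by field_simp; norm_num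
            rw [e1] at this
            refine this.trans (le_of_eq ?_)
            field_simp; ring
          rw [div_mul_eq_mul_div, one_le_div (by positivity)] at h3
          have hlog : 0 ≤ Real.log n := Real.log_natCast_nonneg n
          push_cast
          nlinarith [mul_nonneg (sq_nonneg (m : ℝ)) hlog]
        set x₁ := gibbs (fun _ => 1) fun i => ⟪β i, T y'⟫_ℝ / ((1 - τ) * μ) with hx₁
        set xs := gibbs (fun _ => 1) fun i => ⟪β i, T y⟫_ℝ / μ with hxs
        have hx₁pos : ∀ i, 0 < x₁ i := fun i => gibbs_pos hone i
        have hx₁1 : ∑ i, x₁ i = 1 := sum_gibbs hone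
        have hTy' : T y' = (1 - τ) • (T y + τ • ∑ i, x i • β i) + τ ^ 2 • ∑ i, xs i • β i := by
          rw [hy']
          simp only [map_add, map_smul, hcomb]
        have hcomb' : ∑ i, ((1 - τ) • x + τ • x₁) i • β i
            = (1 - τ) • ∑ i, x i • β i + τ • ∑ i, x₁ i • β i := by
          rw [Finset.smul_sum, Finset.smul_sum, ← Finset.sum_add_distrib]
          refine Finset.sum_congr rfl fun i _ => ?_
          simp only [Pi.add_apply, Pi.smul_apply, smul_eq_mul]
          module
        refine ⟨⟨hμ', fun i => ?_, ?_, ?_, hk'⟩, by dsimp only; omega, ?_⟩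
        · have h1 := hx0 i
          have h2 := (hx₁pos i).le
          have h3 : 0 ≤ 1 - τ := by linarith
          simp only [Pi.add_apply, Pi.smul_apply, smul_eq_mul]
          positivity
        · simp only [Pi.add_apply, Pi.smul_apply, smul_eq_mul]
          rw [Finset.sum_add_distrib, ← Finset.mul_sum, ← Finset.mul_sum, hx1, hx₁1]
          ring
        · dsimp only
          have e1 := relEntropy_gibbs (g := fun i => ⟪β i, T y⟫_ℝ / μ) hone hx₁pos hx₁1
          have e2 := relEntropy_gibbs (g := fun i => ⟪β i, T y'⟫_ℝ / ((1 - τ) * μ)) hone hx₁pos hx₁1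
          rw [← hx₁, relEntropy_self hx₁pos] at e2
          have k1 := norm_comb_sub_sq_le hβ hx₁pos (gibbs_pos hone) hx₁1
            (sum_gibbs (g := fun i => ⟪β i, T y⟫_ℝ / μ) hone)
          rw [e1] at k1
          have k2 := mul_le_mul_of_nonneg_left k1 (by positivity : 0 ≤ μ / 2)
          have e3 := hinner x₁ (T y) μ hμ0
          have e4 := hinner x₁ (T y') _ hμ'0
          rw [hcomb', hTy']
          refine smoothedPerceptron_step (D := relEntropy x₁ fun _ => 1) hτ0.le hτ1.le ?_ hinv ?_ ?_
          -- The condition on the step length reads `4 / (k + 3)² ≤ 4 / ((k + 2) (k + 3))`.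
          · rw [hμ', hτ, div_pow, div_le_div_iff₀ (by positivity) (by positivity)]
            push_cast
            nlinarith [(Nat.cast_nonneg k : (0 : ℝ) ≤ k)]
          · rw [← e3]
            linarith
          · rw [← hTy', ← e4]
            linear_combination ((1 - τ) * μ) * e2
        · dsimp only
          have h1 : J - k + 1 = (J - (k + 1) + 1) + 1 := by omega
          rw [h1, add_mul (J - (k + 1) + 1) 1 (100 * (m * n)), one_mul, add_comm]
          exact Nat.add_le_add_left hc _)
    (0, gibbs (fun _ => 1) (fun i => ⟪β i, T (B *ᵥ fun _ => 1 / ((t + 1 : ℕ) : ℝ))⟫_ℝ / 2),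
      B *ᵥ fun _ => 1 / ((t + 1 : ℕ) : ℝ), 2) (by
      set u : Fin (t + 1) → ℝ := fun _ => 1 / ((t + 1 : ℕ) : ℝ) with hu
      set x₀ := gibbs (fun _ => 1) (fun i => ⟪β i, T (B *ᵥ u)⟫_ℝ / 2) with hx₀
      have hx₀pos : ∀ i, 0 < x₀ i := fun i => gibbs_pos hone i
      have hx₀1 : ∑ i, x₀ i = 1 := sum_gibbs hone
      have hupos : ∀ i, 0 < u i := fun i => by simp only [hu]; positivity
      refine ⟨by norm_num, fun i => (hx₀pos i).le, hx₀1, ?_, Nat.zero_le _⟩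
      dsimp only
      have e2 := relEntropy_gibbs (g := fun i => ⟪β i, T (B *ᵥ u)⟫_ℝ / 2) hone hx₀pos hx₀1
      rw [← hx₀, relEntropy_self hx₀pos] at e2
      have hu1 : ∑ i, u i = 1 := by simp [hu]; field_simp
      have k1 := norm_comb_sub_sq_le hβ hx₀pos hupos hx₀1 hu1
      -- The initial invariant is Pinsker's inequality for `x₀` against the uniform vector, whose
      -- image is the starting point `y₀`; this is the origin of `log N`.
      have e3 : relEntropy x₀ u = relEntropy x₀ (fun _ => 1) + Real.log (t + 1 : ℕ) := by
        have : ∀ i, x₀ i * Real.log (x₀ i / u i)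
            = x₀ i * Real.log (x₀ i / 1) + x₀ i * Real.log (t + 1 : ℕ) := fun i => by
          rw [Real.log_div (hx₀pos i).ne' (hupos i).ne', hu, one_div, Real.log_inv, div_one]
          ring
        simp only [relEntropy, this]
        rw [Finset.sum_add_distrib, ← Finset.sum_mul, hx₀1, one_mul]
      have e4 := hinner x₀ (T (B *ᵥ u)) 2 two_pos
      rw [hcomb] at *
      set p := ∑ i, x₀ i • β i
      set q := ∑ i, u i • β i
      have e5 := norm_sub_sq_real p q
      rw [real_inner_comm] at e4
      nlinarith [sq_nonneg ‖p - q‖])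
  refine ⟨b.1, b.2, r * ((t + 1) * (1 + r * 2)) + ((t + 1) * (1 + r * 2 + 1) + r * (t + 1)
    + r * (t + 1)) + (3 + (r * (1 + (t + 1) * 2) + (1 + ((t + 1) * (1 + r * 2)
    + ((2 + (t + 1) * 5) + c'))))), fun fuel hf => ?_, ?_, hpost⟩
  · have hrun' := hrun fuel (Nat.zero_le _) fuel (by dsimp only; omega)
    refine Timed.ext' ?_ ?_
    · simp only [smoothedPerceptron, bind_val, normalizedColumns_val, uniform_val, matVec_val,
        lit_val, softMin_val, ← hB, hgeq, Int.cast_ofNat]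
      exact congrArg Timed.val hrun'
    · simp only [smoothedPerceptron, bind_cost, normalizedColumns_val, normalizedColumns_cost,
        uniform_val, uniform_cost, matVec_val, matVec_cost, lit_cost, lit_val, softMin_val,
        softMin_cost, ← hB, hgeq, Int.cast_ofNat]
      rw [congrArg Timed.cost hrun']
  · have hc1 : c' ≤ (J + 1) * (100 * (m * n)) := hcost
    have h1 : r * ((t + 1) * (1 + r * 2)) ≤ m * (n * (m * 3)) := by gcongr; omega
    have h2 : r * (t + 1) ≤ m * n := by gcongr
    have h4 : n ≤ m * n := Nat.le_mul_of_pos_left _ hm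
    have h5 : m * n ≤ m * m * n := by
      rw [mul_assoc]; exact Nat.le_mul_of_pos_left _ hm
    nlinarith

end MaxSupport

namespace MaxSupport

open Timed Matrix

open scoped InnerProductSpace

/-! ### Mirror prox -/

section MirrorProx

variable {r t : ℕ} (B QB : Matrix (Fin r) (Fin t) ℝ) (Q : Matrix (Fin r) (Fin r) ℝ) (ε σ τ : ℝ)
  (j : ℕ) (u : Fin r → ℝ) (x : Fin t → ℝ) (u₁ : Fin r → ℝ) (x₁ : Fin t → ℝ) (su : Fin r → ℝ)
  (sx : Fin t → ℝ)

/-- The first component of a prox step. -/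
noncomputable def proxBall : Fin r → ℝ :=
  if √((u + σ • B *ᵥ x₁) ⬝ᵥ Q *ᵥ (u + σ • B *ᵥ x₁)) ≤ 1 then u + σ • B *ᵥ x₁
  else (√((u + σ • B *ᵥ x₁) ⬝ᵥ Q *ᵥ (u + σ • B *ᵥ x₁)))⁻¹ • (u + σ • B *ᵥ x₁)

theorem proxStep_val : (proxStep B QB Q σ τ u x u₁ x₁).val
    = (proxBall B Q σ u x₁, gibbs x fun i => τ * (QBᵀ *ᵥ u₁) i) := by
  have hv : (fun i => u i + σ * (B *ᵥ x₁) i) = u + σ • B *ᵥ x₁ := rfl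
  have hgibbs : (fun i => (x i * Real.exp (0 - τ * (QBᵀ *ᵥ u₁) i)) /
      ∑ l, x l * Real.exp (0 - τ * (QBᵀ *ᵥ u₁) l)) = gibbs x fun i => τ * (QBᵀ *ᵥ u₁) i := by
    simp only [zero_sub]; rfl
  by_cases h : √((u + σ • B *ᵥ x₁) ⬝ᵥ Q *ᵥ (u + σ • B *ᵥ x₁)) ≤ 1
  · have hb := (le_val _ _).2 h
    simp only [proxStep, bind_val, lit_val, matVec_val, vec_val, mul_val, add_val, normQ_val,
      Int.cast_one, Int.cast_zero, hv, hb, if_true, pure_val, sub_val, exp_val, normalizeSum_val,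
      hgibbs, proxBall, if_pos h]
  · have hb := (le_val_false _ _).2 (lt_of_not_ge h)
    simp only [proxStep, bind_val, lit_val, matVec_val, vec_val, mul_val, add_val, normQ_val,
      Int.cast_one, Int.cast_zero, hv, hb, Bool.false_eq_true, if_false, pure_val, sub_val,
      exp_val, normalizeSum_val, hgibbs, proxBall, if_neg h, div_val, Prod.mk.injEq, and_true]
    funext i
    simp [div_eq_inv_mul]

theorem proxStep_cost_le : (proxStep B QB Q σ τ u x u₁ x₁).cost
    ≤ r * (1 + t * 2) + t * (1 + r * 2) + r * (1 + r * 2) + 5 * r + 6 * t + 6 := by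
  simp only [proxStep, bind_cost, lit_cost, matVec_cost, vec_cost, mul_cost, add_cost, normQ_cost,
    le_cost]
  split_ifs <;>
  · simp only [bind_cost, pure_cost, vec_cost, mul_cost, sub_cost, exp_cost, div_cost, matVec_cost,
      normalizeSum_cost, Finset.sum_const, Finset.card_univ, Fintype.card_fin, smul_eq_mul]
    nlinarith

theorem mirrorProxRound_val {v u' : Fin r → ℝ} {w x' : Fin t → ℝ}
    (hv : v = proxBall B Q σ u x) (hw : w = gibbs x fun i => τ * (QBᵀ *ᵥ u) i)
    (hu' : u' = proxBall B Q σ u w) (hx' : x' = gibbs x fun i => τ * (QBᵀ *ᵥ v) i)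
    {ua : Fin r → ℝ} {xa : Fin t → ℝ} (hua : ua = ((j : ℝ) + 1)⁻¹ • (su + v))
    (hxa : xa = ((j : ℝ) + 1)⁻¹ • (sx + w)) :
    ((∀ i, 0 < (QBᵀ *ᵥ ua) i) ∧
      (mirrorProxRound B QB Q ε σ τ (j, u, x, su, sx)).val = some (Sum.inr (xa, ua))) ∨
    (√((B *ᵥ xa) ⬝ᵥ Q *ᵥ B *ᵥ xa) ≤ ε ∧
      (mirrorProxRound B QB Q ε σ τ (j, u, x, su, sx)).val = some (Sum.inr (xa, B *ᵥ xa))) ∨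
    ((∃ i, (QBᵀ *ᵥ ua) i ≤ 0) ∧ ε < √((B *ᵥ xa) ⬝ᵥ Q *ᵥ B *ᵥ xa) ∧
      (mirrorProxRound B QB Q ε σ τ (j, u, x, su, sx)).val
        = some (Sum.inl (j + 1, u', x', su + v, sx + w))) := by
  have hua' : (fun i => (su i + v i) / (((j + 1 : ℤ)) : ℝ)) = ua := by
    funext i; simp [hua, div_eq_inv_mul, mul_add]
  have hxa' : (fun i => (sx i + w i) / (((j + 1 : ℤ)) : ℝ)) = xa := by
    funext i; simp [hxa, div_eq_inv_mul, mul_add]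
  have hsu : (fun i => su i + v i) = su + v := rfl
  have hsx : (fun i => sx i + w i) = sx + w := rfl
  by_cases hg : ∀ i, 0 < (QBᵀ *ᵥ ua) i
  · left
    have hb := (allPos_val _).2 hg
    refine ⟨hg, ?_⟩
    simp only [mirrorProxRound, bind_val, proxStep_val, ← hv, ← hw, ← hu', ← hx', vec_val, add_val,
      lit_val, div_val, hua', hxa', matVec_val, hb, if_true, pure_val]
  · right
    have hb : (allPos (QBᵀ *ᵥ ua)).val = false := by
      rw [← Bool.not_eq_true, allPos_val]; exact hg
    rcases le_or_gt (√((B *ᵥ xa) ⬝ᵥ Q *ᵥ B *ᵥ xa)) ε with hs | hs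
    · left
      have hb2 := (le_val _ _).2 hs
      refine ⟨hs, ?_⟩
      simp only [mirrorProxRound, bind_val, proxStep_val, ← hv, ← hw, ← hu', ← hx', vec_val,
        add_val, lit_val, div_val, hua', hxa', matVec_val, hb, if_true, pure_val,
        Bool.false_eq_true, if_false, normQ_val, hb2]
    · right
      have hb2 := (le_val_false _ _).2 hs
      push Not at hg
      refine ⟨hg, hs, ?_⟩
      simp only [mirrorProxRound, bind_val, proxStep_val, ← hv, ← hw, ← hu', ← hx', vec_val,
        add_val, lit_val, div_val, hua', hxa', matVec_val, hb, pure_val,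
        Bool.false_eq_true, if_false, normQ_val, hb2, hsu, hsx]

theorem mirrorProxRound_cost_le :
    (mirrorProxRound B QB Q ε σ τ (j, u, x, su, sx)).cost
      ≤ 3 * (r * (1 + t * 2)) + 3 * (t * (1 + r * 2)) + 3 * (r * (1 + r * 2))
        + 14 * r + 16 * t + 16 := by
  have h1 := proxStep_cost_le B QB Q σ τ u x u x
  have h2 := proxStep_cost_le B QB Q σ τ u x (proxStep B QB Q σ τ u x u x).val.1
    (proxStep B QB Q σ τ u x u x).val.2
  have h3 : ∀ v : Fin t → ℝ, (allPos v).cost ≤ t * 2 := allPos_cost_le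
  simp only [mirrorProxRound, bind_cost, vec_cost, add_cost, lit_cost, div_cost, matVec_cost,
    Finset.sum_const, Finset.card_univ, Fintype.card_fin, smul_eq_mul]
  split_ifs
  · simp only [pure_cost]
    refine le_trans (Nat.add_le_add h1 (Nat.add_le_add h2 (Nat.add_le_add_left
      (Nat.add_le_add_left (Nat.add_le_add_left (Nat.add_le_add_left (Nat.add_le_add_left
      (Nat.add_le_add_left (Nat.add_le_add_right (h3 _) _) _) _) _) _) _) _))) ?_
    nlinarith
  · simp only [bind_cost, normQ_cost, matVec_cost, le_cost]
    split_ifs <;>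
    · simp only [pure_cost]
      refine le_trans (Nat.add_le_add h1 (Nat.add_le_add h2 (Nat.add_le_add_left
        (Nat.add_le_add_left (Nat.add_le_add_left (Nat.add_le_add_left (Nat.add_le_add_left
        (Nat.add_le_add_left (Nat.add_le_add_right (h3 _) _) _) _) _) _) _) _))) ?_
      nlinarith

end MirrorProx

/-- Test the regret bound with `U = s / ‖s‖`. The distance term and the entropy term contribute at
most `τ / 2` each. For `s = 0` the convention `0⁻¹ = 0` makes `U = 0`, which does no harm. -/
theorem norm_le_of_inner_le {E : Type*} [NormedAddCommGroup E] [InnerProductSpace ℝ E] {s p : E}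
    {a l τ : ℝ} (hτ : 0 ≤ τ)
    (h : ∀ U : E, ‖U‖ ≤ 1 → ⟪U, s⟫_ℝ - a ≤ τ / 2 * (‖U‖ ^ 2 - ‖U - p‖ ^ 2) + l)
    (ha : a ≤ 0) (hl : l ≤ τ / 2) : ‖s‖ ≤ τ := by
  have hU : ‖‖s‖⁻¹ • s‖ ≤ 1 := by
    rw [norm_smul, norm_inv, norm_norm]
    exact inv_mul_le_one
  have h1 := h (‖s‖⁻¹ • s) hU
  have h2 : ⟪‖s‖⁻¹ • s, s⟫_ℝ = ‖s‖ := by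
    rw [inner_smul_left, conj_trivial, real_inner_self_eq_norm_mul_norm]
    rcases eq_or_ne ‖s‖ 0 with h | h
    · simp [h]
    · field_simp
  have h5 : ‖‖s‖⁻¹ • s‖ ^ 2 - ‖‖s‖⁻¹ • s - p‖ ^ 2 ≤ 1 := by
    have := pow_le_one₀ (norm_nonneg _) hU (n := 2)
    nlinarith [sq_nonneg ‖‖s‖⁻¹ • s - p‖]
  rw [h2] at h1
  nlinarith

theorem succ_le_entropyRounds {m n j : ℕ} (hm : 1 ≤ m) {τ : ℝ}
    (h : ((j : ℝ) + 1) * (1 / (11 * m)) ≤ τ) (hτ : τ ^ 2 ≤ 2 * Real.log n) :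
    j + 1 ≤ entropyRounds m n := by
  apply le_entropyRounds
  have hm0 : (1 : ℝ) ≤ m := by exact_mod_cast hm
  have h2 : (((j : ℝ) + 1) * (1 / (11 * m))) ^ 2 ≤ τ ^ 2 := pow_le_pow_left₀ (by positivity) h 2
  have h4 : ((j : ℝ) + 1) ^ 2 = 121 * m ^ 2 * (((j : ℝ) + 1) * (1 / (11 * m))) ^ 2 := by
    field_simp; norm_num
  push_cast
  rw [h4]
  have h5 := h2.trans hτ
  nlinarith [mul_nonneg (sq_nonneg (m : ℝ)) (Real.log_natCast_nonneg n),
    mul_le_mul_of_nonneg_left h5 (sq_nonneg (m : ℝ))]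

set_option maxHeartbeats 1000000 in
-- Summing the one-step bounds gives an invariant for the sums of the extrapolated points. If the
-- average fails the feasibility test at `i`, then the sum of the `B w` has norm at most `τ`, so the
-- average has norm at most `τ / (j + 1)`.
theorem mirrorProx_correct {m n : ℕ} (hm : 1 ≤ m) (hmn : m ≤ n) (hn : 2 ≤ n) :
    FirstOrderCorrect mirrorProx m n (100 * (m * m * n)
      + (entropyRounds m n + 1) * (100 * (m * n))) := by
  refine ⟨entropyRounds m n + 1, fun calls r t A Q hr ht hQ hA => ?_⟩
  set J := entropyRounds m n
  set ε : ℝ := 1 / (11 * m) with hε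
  have hm0 : (1 : ℝ) ≤ m := by exact_mod_cast hm
  have hε0 : 0 < ε := by positivity
  obtain ⟨T, β, hβ, hcomb, hg, hnorm, hfeas⟩ := exists_embedding hQ hA
  obtain ⟨B, hB⟩ : ∃ B, B = normalized A Q := ⟨_, rfl⟩
  rw [← hB] at hcomb hg
  have hrn : r ≤ n := hr.trans hmn
  have hKb : ∀ {c : ℕ}, c ≤ 3 * (r * (1 + (t + 1) * 2)) + 3 * ((t + 1) * (1 + r * 2))
      + 3 * (r * (1 + r * 2)) + 14 * r + 16 * (t + 1) + 16 → c ≤ 100 * (m * n) := by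
    intro c hc
    have h1 : (t + 1) * (1 + r * 2) ≤ n * (m * 3) := by gcongr; omega
    have h2 : r * (1 + (t + 1) * 2) ≤ m * (n * 3) := by gcongr; omega
    have h3 : r * (1 + r * 2) ≤ m * (n * 3) := by gcongr; omega
    have h4 : n ≤ m * n := Nat.le_mul_of_pos_left _ hm
    nlinarith
  have hgeq : ∀ y : Fin r → ℝ, (Q * B)ᵀ *ᵥ y = fun i => ⟪β i, T y⟫_ℝ := fun y => funext (hg y)
  -- The 2 keeps the logarithm, and with it `τ`, positive when only one column is left; `NN ≤ n`
  -- then needs `2 ≤ n`.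
  set NN : ℝ := max 2 ((t : ℝ) + 1) with hNN
  have hNN2 : (2 : ℝ) ≤ NN := le_max_left _ _
  have hNNn : NN ≤ n := max_le (by exact_mod_cast hn) (by exact_mod_cast ht)
  have hlogNN : 0 < Real.log NN := Real.log_pos (by linarith)
  set τ : ℝ := √(2 * Real.log NN) with hτ
  have hτ0 : 0 < τ := Real.sqrt_pos.2 (by linarith)
  have hττ : τ ^ 2 = 2 * Real.log NN := Real.sq_sqrt (by linarith)
  have hball : ∀ (u : Fin r → ℝ) (x : Fin (t + 1) → ℝ),
      T (proxBall B Q τ⁻¹ u x) = ballProj (T u + τ⁻¹ • ∑ i, x i • β i) := by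
    intro u x
    have h1 : T (u + τ⁻¹ • B *ᵥ x) = T u + τ⁻¹ • ∑ i, x i • β i := by
      rw [map_add, map_smul, hcomb]
    unfold proxBall ballProj
    rw [hnorm, ← h1]
    split_ifs
    · rfl
    · rw [map_smul]
  have hlogN : Real.log (t + 1) ≤ τ ^ 2 / 2 := by
    rw [hττ]
    have : Real.log (t + 1) ≤ Real.log NN := Real.log_le_log (by positivity) (le_max_right _ _)
    linarith
  obtain ⟨b, c', hrun, hpost, hcost⟩ := loop_halts
    (round := fun _ => mirrorProxRound B (Q * B) Q ε τ⁻¹ τ) (N := 0)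
    (fun st : ℕ × (Fin r → ℝ) × (Fin (t + 1) → ℝ) × (Fin r → ℝ) × (Fin (t + 1) → ℝ) =>
      (∀ i, 0 < st.2.2.1 i) ∧ ∑ i, st.2.2.1 i = 1 ∧ (∀ i, 0 ≤ st.2.2.2.2 i) ∧
      ∑ i, st.2.2.2.2 i = st.1 ∧ (∀ U : EuclideanSpace ℝ (Fin r), ‖U‖ ≤ 1 → ∀ i,
        ⟪U, ∑ i, st.2.2.2.2 i • β i⟫_ℝ - ⟪β i, T st.2.2.2.1⟫_ℝ
          ≤ τ / 2 * (‖U‖ ^ 2 - ‖U - T st.2.1‖ ^ 2)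
            + (Real.log (t + 1) + Real.log (st.2.2.1 i)) / τ) ∧ st.1 ≤ J)
    (fun b => IsFirstOrderResult A Q ε b.1 b.2)
    (fun st => J - st.1) (fun st => (J - st.1 + 1) * (100 * (m * n))) (by
      rintro ⟨j, u, x, su, sx⟩ ⟨hx0, hx1, hsx0, hsx1, hinv, hj⟩
      dsimp only at hx0 hx1 hsx0 hsx1 hinv hj
      have hc := hKb (mirrorProxRound_cost_le B (Q * B) Q ε τ⁻¹ τ j u x su sx)
      have hc2 : (mirrorProxRound B (Q * B) Q ε τ⁻¹ τ (j, u, x, su, sx)).cost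
          ≤ (J - j + 1) * (100 * (m * n)) := hc.trans (Nat.le_mul_of_pos_left _ (by omega))
      obtain ⟨v, hv⟩ : ∃ v, v = proxBall B Q τ⁻¹ u x := ⟨_, rfl⟩
      obtain ⟨w, hw⟩ : ∃ w, w = gibbs x fun i => τ * ((Q * B)ᵀ *ᵥ u) i := ⟨_, rfl⟩
      obtain ⟨u', hu'⟩ : ∃ u', u' = proxBall B Q τ⁻¹ u w := ⟨_, rfl⟩
      obtain ⟨x', hx'⟩ : ∃ x', x' = gibbs x fun i => τ * ((Q * B)ᵀ *ᵥ v) i := ⟨_, rfl⟩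
      obtain ⟨ua, hua⟩ : ∃ ua, ua = ((j : ℝ) + 1)⁻¹ • (su + v) := ⟨_, rfl⟩
      obtain ⟨xa, hxa⟩ : ∃ xa, xa = ((j : ℝ) + 1)⁻¹ • (sx + w) := ⟨_, rfl⟩
      have hj1 : (0 : ℝ) < (j : ℝ) + 1 := by positivity
      have hround := mirrorProxRound_val B (Q * B) Q ε τ⁻¹ τ j u x su sx hv hw hu' hx' hua hxa
      rw [hgeq] at hw hx'
      have hwpos : ∀ i, 0 < w i := fun i => hw ▸ gibbs_pos hx0 i
      have hw1 : ∑ i, w i = 1 := hw ▸ sum_gibbs hx0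
      have hx'pos : ∀ i, 0 < x' i := fun i => hx' ▸ gibbs_pos hx0 i
      have hx'1 : ∑ i, x' i = 1 := hx' ▸ sum_gibbs hx0
      have hsx' : ∀ i, 0 ≤ (sx + w) i := fun i => add_nonneg (hsx0 i) (hwpos i).le
      have hsx1' : ∑ i, (sx + w) i = (j : ℝ) + 1 := by
        simp only [Pi.add_apply]
        rw [Finset.sum_add_distrib, hsx1, hw1]
      have hinv' : ∀ U : EuclideanSpace ℝ (Fin r), ‖U‖ ≤ 1 → ∀ i,
          ⟪U, ∑ i, (sx + w) i • β i⟫_ℝ - ⟪β i, T (su + v)⟫_ℝ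
            ≤ τ / 2 * (‖U‖ ^ 2 - ‖U - T u'‖ ^ 2)
              + (Real.log (t + 1) + Real.log (x' i)) / τ := by
        intro U hU i
        have h1 := hinv U hU i
        have h2 := mirrorProx_step hβ hτ0 (T u) hx0 hx1 (v := T v) (u' := T u') (w := w) (x' := x')
          (by rw [hv, hball]) hw (by rw [hu', hball]) hx' hU i
        simp only [Pi.add_apply, add_smul]
        rw [Finset.sum_add_distrib, inner_add_right, map_add, inner_add_right]
        have e : (Real.log (t + 1) + Real.log (x' i)) / τ
            = (Real.log (t + 1) + Real.log (x i)) / τ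
              + (Real.log (x' i) - Real.log (x i)) / τ := by ring
        rw [e]
        linarith
      have hxa0 : ∀ i, 0 ≤ xa i := fun i => by
        rw [hxa]; exact mul_nonneg (inv_nonneg.2 hj1.le) (hsx' i)
      have hxa1 : ∑ i, xa i = 1 := by
        rw [hxa]
        simp only [Pi.smul_apply, smul_eq_mul]
        rw [← Finset.mul_sum, hsx1', inv_mul_cancel₀ hj1.ne']
      rcases hround with ⟨hpos, hval⟩ | ⟨hsmall, hval⟩ | ⟨⟨i, hi⟩, hlarge, hval⟩
      · refine ⟨_, _, fun _ _ => Timed.ext' hval rfl, by simp, ?_⟩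
        rintro _ ⟨⟩
        rw [hgeq] at hpos
        exact ⟨Or.inl (hfeas ua hpos), hc2⟩
      · refine ⟨_, _, fun _ _ => Timed.ext' hval rfl, by simp, ?_⟩
        rintro _ ⟨⟩
        subst hB
        exact ⟨isFirstOrderResult_of_small hxa0 hxa1 hsmall, hc2⟩
      · refine ⟨_, _, fun _ _ => Timed.ext' hval rfl, ?_, by simp⟩
        rintro _ ⟨⟩
        rw [hnorm, hcomb] at hlarge
        have hgi : ⟪β i, T (su + v)⟫_ℝ ≤ 0 := by
          rw [hg, hua, map_smul, inner_smul_right] at hi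
          exact nonpos_of_mul_nonpos_right hi (inv_pos.2 hj1)
        set s := ∑ i, (sx + w) i • β i with hs
        have hxs : ∑ i, xa i • β i = ((j : ℝ) + 1)⁻¹ • s := by
          rw [hs, Finset.smul_sum]
          refine Finset.sum_congr rfl fun i _ => ?_
          rw [hxa, Pi.smul_apply, smul_assoc]
        have hsτ : ‖s‖ ≤ τ := by
          -- The entropy term is at most `log (t + 1) / τ ≤ τ / 2`, since `x' i ≤ 1`; the value of
          -- `τ` balances both contributions.
          refine norm_le_of_inner_le hτ0.le (fun U hU => hinv' U hU i) hgi ?_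
          have h3 : Real.log (x' i) ≤ 0 := by
            refine Real.log_nonpos (hx'pos i).le ?_
            rw [← hx'1]
            exact Finset.single_le_sum (fun l _ => (hx'pos l).le) (Finset.mem_univ i)
          rw [div_le_iff₀ hτ0]; nlinarith
        have hj' : j + 1 ≤ J := by
          rw [hxs, norm_smul, norm_inv, Real.norm_of_nonneg hj1.le, lt_inv_mul_iff₀ hj1] at hlarge
          have h3 : Real.log NN ≤ Real.log n := Real.log_le_log (by linarith) hNNn
          exact succ_le_entropyRounds hm (hlarge.le.trans hsτ) (by linarith)
        refine ⟨⟨hx'pos, hx'1, hsx', ?_, hinv', hj'⟩, by dsimp only; omega, ?_⟩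
        · dsimp only
          rw [hsx1']; push_cast; rfl
        · dsimp only
          have h1 : J - j + 1 = (J - (j + 1) + 1) + 1 := by omega
          rw [h1, add_mul (J - (j + 1) + 1) 1 (100 * (m * n)), one_mul, add_comm]
          exact Nat.add_le_add_left hc _)
    (0, fun _ => 0, fun _ => 1 / ((t + 1 : ℕ) : ℝ), fun _ => 0, fun _ => 0) (by
      refine ⟨fun i => by dsimp only; positivity, ?_, fun i => le_rfl, by simp, ?_, Nat.zero_le _⟩
      · simp; field_simp
      · intro U _ i
        have h0 : T (fun _ => 0) = 0 := map_zero T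
        dsimp only
        rw [h0, one_div, Real.log_inv]
        simp)
  refine ⟨b.1, b.2, r * ((t + 1) * (1 + r * 2)) + ((t + 1) * (1 + r * 2 + 1) + r * (t + 1)
    + r * (t + 1)) + (1 + (1 + (1 + (1 + (1 + (1 + (1 + (r + ((t + 1) + (3 + c')))))))))),
    fun fuel hf => ?_, ?_, hpost⟩
  · have hrun' := hrun fuel (Nat.zero_le _) fuel (by dsimp only; omega)
    have hcast : ((max 2 ((t : ℤ) + 1) : ℤ) : ℝ) = NN := by push_cast; rfl
    refine Timed.ext' ?_ ?_
    · simp only [mirrorProx, bind_val, normalizedColumns_val, uniform_val, lit_val, div_val,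
        mul_val, sqrt_val, log_val, vec_val, ← hB, Int.cast_ofNat, Int.cast_one, Int.cast_zero,
        hcast, ← hτ, one_div τ]
      exact congrArg Timed.val hrun'
    · simp only [mirrorProx, bind_cost, normalizedColumns_val, normalizedColumns_cost,
        uniform_val, uniform_cost, lit_cost, lit_val, div_val, div_cost, mul_val, mul_cost,
        sqrt_val, sqrt_cost, log_val, log_cost, vec_val, vec_cost, ← hB, Int.cast_ofNat,
        Int.cast_one, Int.cast_zero, hcast, ← hτ, one_div τ, Finset.sum_const, Finset.card_univ,
        Fintype.card_fin, smul_eq_mul, mul_one]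
      rw [congrArg Timed.cost hrun']
  · have hc1 : c' ≤ (J + 1) * (100 * (m * n)) := hcost
    have h1 : r * ((t + 1) * (1 + r * 2)) ≤ m * (n * (m * 3)) := by gcongr; omega
    have h2 : r * (t + 1) ≤ m * n := by gcongr
    have h4 : n ≤ m * n := Nat.le_mul_of_pos_left _ hm
    have h5 : m * n ≤ m * m * n := by
      rw [mul_assoc]; exact Nat.le_mul_of_pos_left _ hm
    nlinarith

end MaxSupport

namespace MaxSupport

open Timed Matrix

/-! ### Positive definite matrices -/

section PositiveDefinite

variable {r : ℕ}

/-- With the nonnegative eigenvalues `λ_i` this is `1 + ∑ λ_i ≤ ∏ (1 + λ_i)`; the determinant is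
read off from the characteristic polynomial at `-1`. -/
theorem one_add_trace_le_det_one_add {P : Matrix (Fin r) (Fin r) ℝ} (hP : P.PosSemidef) :
    1 + P.trace ≤ (1 + P).det := by
  have hH := hP.isHermitian
  have h1 : (1 + P).det = ∏ i, (1 + hH.eigenvalues i) := by
    have h := eval_charpoly P (-1)
    rw [hH.charpoly_eq, Polynomial.eval_prod] at h
    have h2 : scalar (Fin r) (-1 : ℝ) - P = -(1 + P) := by
      rw [map_neg, map_one]; abel
    have h3 : ∏ i, Polynomial.eval (-1 : ℝ) (Polynomial.X - Polynomial.C (hH.eigenvalues i : ℝ))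
        = (-1) ^ r * ∏ i, (1 + hH.eigenvalues i) := by
      have e : (-1 : ℝ) ^ r = ∏ _i : Fin r, (-1 : ℝ) := by simp
      rw [e, ← Finset.prod_mul_distrib]
      refine Finset.prod_congr rfl fun i _ => ?_
      simp; ring
    rw [h2, det_neg, Fintype.card_fin] at h
    have h4 := h3.symm.trans h
    exact (mul_left_cancel₀ (pow_ne_zero _ (by norm_num)) h4).symm
  rw [h1, hH.trace_eq_sum_eigenvalues]
  exact one_add_sum_le_prod Finset.univ fun i _ => hP.eigenvalues_nonneg i

theorem det_le_pow {R : Matrix (Fin r) (Fin r) ℝ} (hR : R.PosDef) {M : ℝ}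
    (h : ∀ w, w ⬝ᵥ R *ᵥ w ≤ M * (w ⬝ᵥ w)) : R.det ≤ M ^ r := by
  have hH := hR.isHermitian
  rw [hH.det_eq_prod_eigenvalues]
  calc ∏ i, ((hH.eigenvalues i : ℝ) : ℝ) ≤ ∏ _i : Fin r, M := by
        refine Finset.prod_le_prod (fun i _ => (hR.eigenvalues_pos i).le) fun i _ => ?_
        set v : Fin r → ℝ := ⇑(hH.eigenvectorBasis i)
        have h1 : hH.eigenvalues i = v ⬝ᵥ R *ᵥ v := by
          have := hH.eigenvalues_eq i
          simpa using this
        have h2 : v ⬝ᵥ v = 1 := by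
          have := hH.eigenvectorBasis.orthonormal.1 i
          have h3 := real_inner_self_eq_norm_sq (hH.eigenvectorBasis i)
          rw [this, EuclideanSpace.inner_eq_star_dotProduct] at h3
          simpa using h3
        have := h v
        rw [h2, mul_one, ← h1] at this
        exact this
    _ = M ^ r := by simp

variable {R : Matrix (Fin r) (Fin r) ℝ}

theorem PosDef.isUnit_det (hR : R.PosDef) : IsUnit R.det := hR.det_pos.ne'.isUnit

theorem PosDef.mulVec_inv_mulVec (hR : R.PosDef) (v : Fin r → ℝ) : R *ᵥ R⁻¹ *ᵥ v = v := by
  rw [mulVec_mulVec, mul_nonsing_inv _ (PosDef.isUnit_det hR), one_mulVec]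

theorem PosDef.inv_form (hR : R.PosDef) (v : Fin r → ℝ) :
    (R⁻¹ *ᵥ v) ⬝ᵥ R *ᵥ (R⁻¹ *ᵥ v) = v ⬝ᵥ R⁻¹ *ᵥ v := by
  rw [PosDef.mulVec_inv_mulVec hR, dotProduct_comm]

/-- The Cauchy–Schwarz inequality for the norms of `R` and `R⁻¹`. -/
theorem PosDef.sq_dotProduct_le (hR : R.PosDef) (v w : Fin r → ℝ) :
    (v ⬝ᵥ w) ^ 2 ≤ (v ⬝ᵥ R⁻¹ *ᵥ v) * (w ⬝ᵥ R *ᵥ w) := by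
  rcases eq_or_ne v 0 with rfl | hv
  · simp
  have hκ : 0 < v ⬝ᵥ R⁻¹ *ᵥ v := PosDef.pos hR.inv hv
  set κ := v ⬝ᵥ R⁻¹ *ᵥ v with hκdef
  -- A multiple by `κ` of the component of `w` that is `R`-orthogonal to `R⁻¹ v`.
  have h := PosDef.nonneg hR (κ • w - (v ⬝ᵥ w) • R⁻¹ *ᵥ v)
  simp only [mulVec_sub, mulVec_smul, sub_dotProduct, dotProduct_sub, smul_dotProduct,
    dotProduct_smul, smul_eq_mul] at h
  rw [PosDef.inv_form hR, PosDef.comm hR (R⁻¹ *ᵥ v) w, PosDef.mulVec_inv_mulVec hR, ← hκdef,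
    dotProduct_comm w v] at h
  have h2 : 0 ≤ κ * (κ * (w ⬝ᵥ R *ᵥ w) - (v ⬝ᵥ w) ^ 2) := by linarith
  have := nonneg_of_mul_nonneg_right h2 hκ
  linarith

theorem PosDef.dotProduct_self_le (hR : R.PosDef) {M : ℝ}
    (h : ∀ w, w ⬝ᵥ R *ᵥ w ≤ M * (w ⬝ᵥ w)) (a : Fin r → ℝ) :
    a ⬝ᵥ a ≤ M * (a ⬝ᵥ R⁻¹ *ᵥ a) := by
  rcases eq_or_ne a 0 with rfl | ha
  · simp
  have haa : 0 < a ⬝ᵥ a := by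
    have := dotProduct_star_self_pos_iff.2 ha
    simpa using this
  have h1 := PosDef.sq_dotProduct_le hR a a
  have h2 := mul_le_mul_of_nonneg_left (h a) (PosDef.nonneg hR.inv a)
  have h3 : (a ⬝ᵥ a) * (a ⬝ᵥ a) ≤ (M * (a ⬝ᵥ R⁻¹ *ᵥ a)) * (a ⬝ᵥ a) := by linarith
  exact le_of_mul_le_mul_right h3 haa

theorem form_vecMulVec (c w : Fin r → ℝ) : w ⬝ᵥ vecMulVec c c *ᵥ w = (c ⬝ᵥ w) ^ 2 := by
  rw [vecMulVec_mulVec, pow_two, dotProduct_comm c w]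
  simp

theorem form_sum {ι : Type*} (s : Finset ι) (N : ι → Matrix (Fin r) (Fin r) ℝ) (w : Fin r → ℝ) :
    w ⬝ᵥ (∑ i ∈ s, N i) *ᵥ w = ∑ i ∈ s, w ⬝ᵥ N i *ᵥ w := by
  rw [sum_mulVec, dotProduct_sum]

theorem form_smul_one_add_sum {ι : Type*} [Fintype ι] (α : ℝ) (γ : ι → ℝ) (c : ι → Fin r → ℝ)
    (w : Fin r → ℝ) :
    w ⬝ᵥ (α • 1 + ∑ i, γ i • vecMulVec (c i) (c i)) *ᵥ w
      = α * (w ⬝ᵥ w) + ∑ i, γ i * (c i ⬝ᵥ w) ^ 2 := by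
  rw [add_mulVec, dotProduct_add, form_sum, smul_mulVec, one_mulVec, dotProduct_smul, smul_eq_mul]
  congr 1
  refine Finset.sum_congr rfl fun i _ => ?_
  rw [smul_mulVec, dotProduct_smul, form_vecMulVec, smul_eq_mul]

theorem posDef_smul_one_add_sum {ι : Type*} [Fintype ι] {α : ℝ} (hα : 0 < α) {γ : ι → ℝ}
    (hγ : ∀ i, 0 ≤ γ i) (c : ι → Fin r → ℝ) :
    (α • 1 + ∑ i, γ i • vecMulVec (c i) (c i) : Matrix (Fin r) (Fin r) ℝ).PosDef := by
  refine PosDef.of_dotProduct_mulVec_pos ?_ fun w hw => ?_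
  · rw [IsHermitian, conjTranspose_eq_transpose_of_trivial]
    simp only [transpose_add, transpose_sum, transpose_smul, transpose_one, transpose_vecMulVec]
  · rw [star_trivial, form_smul_one_add_sum]
    have h1 : 0 < w ⬝ᵥ w := by
      have := dotProduct_star_self_pos_iff.2 hw
      simpa using this
    have h2 : 0 ≤ ∑ i, γ i * (c i ⬝ᵥ w) ^ 2 :=
      Finset.sum_nonneg fun i _ => mul_nonneg (hγ i) (sq_nonneg _)
    positivity

/-- The form of `R` at `R⁻¹ c_i` has the value `κ = c_iᵀ R⁻¹ c_i`, and the summand `i` alone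
contributes `γ_i κ²` to it. -/
theorem mul_inv_form_le_one {ι : Type*} [Fintype ι] {α : ℝ} (hα : 0 < α) {γ : ι → ℝ}
    (hγ : ∀ i, 0 ≤ γ i) {c : ι → Fin r → ℝ}
    (hR : R = α • 1 + ∑ i, γ i • vecMulVec (c i) (c i)) (i : ι) :
    γ i * (c i ⬝ᵥ R⁻¹ *ᵥ c i) ≤ 1 := by
  have hpd : R.PosDef := hR ▸ posDef_smul_one_add_sum hα hγ c
  rcases eq_or_ne (c i) 0 with h0 | h0
  · simp [h0]
  have hκ := PosDef.pos hpd.inv h0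
  have h1 := PosDef.inv_form hpd (c i)
  have h2 := form_smul_one_add_sum α γ c (R⁻¹ *ᵥ c i)
  rw [← hR, h1] at h2
  have h3 : γ i * (c i ⬝ᵥ R⁻¹ *ᵥ c i) ^ 2 ≤ ∑ i', γ i' * (c i' ⬝ᵥ R⁻¹ *ᵥ c i) ^ 2 :=
    Finset.single_le_sum (f := fun i' => γ i' * (c i' ⬝ᵥ R⁻¹ *ᵥ c i) ^ 2)
      (fun i' _ => mul_nonneg (hγ i') (sq_nonneg _)) (Finset.mem_univ i)
  have h4 : 0 ≤ α * ((R⁻¹ *ᵥ c i) ⬝ᵥ (R⁻¹ *ᵥ c i)) :=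
    mul_nonneg hα.le (by simpa using dotProduct_star_self_nonneg (R⁻¹ *ᵥ c i))
  have h5 : (γ i * (c i ⬝ᵥ R⁻¹ *ᵥ c i)) * (c i ⬝ᵥ R⁻¹ *ᵥ c i) ≤ 1 * (c i ⬝ᵥ R⁻¹ *ᵥ c i) := by
    linarith
  exact le_of_mul_le_mul_right h5 hκ

theorem sq_dotProduct_le_mul {v w : Fin r → ℝ} : (v ⬝ᵥ w) ^ 2 ≤ (v ⬝ᵥ v) * (w ⬝ᵥ w) := by
  have h : (v ⬝ᵥ w) ^ 2 ≤ (∑ i, v i ^ 2) * ∑ i, w i ^ 2 := Finset.sum_mul_sq_le_sq_mul_sq _ _ _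
  simpa [dotProduct, pow_two] using h

/-- If the vectors are long with respect to `R⁻¹`, then `R` is small. -/
theorem form_le_of_long {n : ℕ} {α : ℝ} (hα : 0 < α) (hα1 : α ≤ 1) {γ : Fin n → ℝ}
    (hγ : ∀ i, 0 ≤ γ i) {c : Fin n → Fin r → ℝ}
    (hR : R = α • 1 + ∑ i, γ i • vecMulVec (c i) (c i)) {θ : ℝ} (hθ : 0 < θ)
    (hlong : ∀ i, θ ^ 2 * (c i ⬝ᵥ c i) ≤ c i ⬝ᵥ R⁻¹ *ᵥ c i) (w : Fin r → ℝ) :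
    w ⬝ᵥ R *ᵥ w ≤ (1 + n / θ ^ 2) * (w ⬝ᵥ w) := by
  have hww : 0 ≤ w ⬝ᵥ w := by simpa using dotProduct_star_self_nonneg w
  conv_lhs => rw [hR, form_smul_one_add_sum]
  have h1 : ∀ i, γ i * (c i ⬝ᵥ w) ^ 2 ≤ 1 / θ ^ 2 * (w ⬝ᵥ w) := fun i => by
    have h2 := mul_le_mul_of_nonneg_left (hlong i) (hγ i)
    have h3 := h2.trans (mul_inv_form_le_one hα hγ hR i)
    have h4 : γ i * (c i ⬝ᵥ c i) ≤ 1 / θ ^ 2 := by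
      rw [le_div_iff₀ (by positivity)]; linarith
    calc γ i * (c i ⬝ᵥ w) ^ 2 ≤ γ i * ((c i ⬝ᵥ c i) * (w ⬝ᵥ w)) :=
          mul_le_mul_of_nonneg_left sq_dotProduct_le_mul (hγ i)
      _ = γ i * (c i ⬝ᵥ c i) * (w ⬝ᵥ w) := by ring
      _ ≤ _ := mul_le_mul_of_nonneg_right h4 hww
  have h5 := Finset.sum_le_sum fun i (_ : i ∈ Finset.univ) => h1 i
  rw [Finset.sum_const, Finset.card_univ, Fintype.card_fin, nsmul_eq_mul] at h5
  have h6 : α * (w ⬝ᵥ w) ≤ w ⬝ᵥ w := mul_le_of_le_one_left hww hα1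
  calc _ ≤ w ⬝ᵥ w + n * (1 / θ ^ 2 * (w ⬝ᵥ w)) := add_le_add h6 h5
    _ = _ := by ring

end PositiveDefinite

/-! ### Rescaling -/

section Rescale

variable {r t : ℕ} (ε : ℝ) (A : Matrix (Fin r) (Fin t) ℝ) (R Q : Matrix (Fin r) (Fin r) ℝ)
  (x : Fin t → ℝ)

theorem rescale_val : (rescale ε A R Q x).val = (1 + ε)⁻¹ • (R
    + ∑ i, (x i / (A.col i ⬝ᵥ Q *ᵥ A.col i)) • vecMulVec (A.col i) (A.col i)) := by
  ext l k
  simp only [rescale, bind_val, matMul_val, vec_val, dot_val, div_val, lit_val, add_val, mat_val,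
    sumT_val, mul_val, of_apply, Matrix.smul_apply, Matrix.add_apply, Matrix.sum_apply,
    vecMulVec_apply, smul_eq_mul, Int.cast_one]
  rw [div_eq_inv_mul]
  rfl

theorem rescale_cost : (rescale ε A R Q x).cost
    = r * (t * (1 + r * 2)) + (t * (1 + r * 2 + 1) + (1 + (1 + r * (r * (1 + t * 3 + 1 + 1))))) := by
  simp [rescale, add_assoc]

variable {ε A R Q x}

theorem form_rescale (w : Fin r → ℝ) : w ⬝ᵥ (rescale ε A R Q x).val *ᵥ w
    = (1 + ε)⁻¹ * (w ⬝ᵥ R *ᵥ w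
      + ∑ i, x i / (A.col i ⬝ᵥ Q *ᵥ A.col i) * (A.col i ⬝ᵥ w) ^ 2) := by
  rw [rescale_val, smul_mulVec, dotProduct_smul, add_mulVec, dotProduct_add, form_sum, smul_eq_mul]
  congr 2
  refine Finset.sum_congr rfl fun i _ => ?_
  rw [smul_mulVec, dotProduct_smul, form_vecMulVec, smul_eq_mul]

/-- By Cauchy–Schwarz each `a_i a_iᵀ / ‖a_i‖_Q²` is at most `R`, and so is a convex combination.
This controls `R` between a rescaling and the removal of short columns. -/
theorem form_rescale_le (hε : 0 < ε) (hR : R.PosDef) (hQ : Q = R⁻¹) (hA : ∀ i, A.col i ≠ 0)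
    (hx : ∀ i, 0 ≤ x i) (hx1 : ∑ i, x i = 1) (w : Fin r → ℝ) :
    w ⬝ᵥ (rescale ε A R Q x).val *ᵥ w ≤ 2 * (w ⬝ᵥ R *ᵥ w) := by
  have hw := PosDef.nonneg hR w
  have h1 : ∑ i, x i / (A.col i ⬝ᵥ Q *ᵥ A.col i) * (A.col i ⬝ᵥ w) ^ 2 ≤ w ⬝ᵥ R *ᵥ w := by
    calc _ ≤ ∑ i, x i * (w ⬝ᵥ R *ᵥ w) := Finset.sum_le_sum fun i _ => by
          have hκ : 0 < A.col i ⬝ᵥ Q *ᵥ A.col i := hQ ▸ PosDef.pos hR.inv (hA i)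
          have := PosDef.sq_dotProduct_le hR (A.col i) w
          rw [← hQ] at this
          rw [div_mul_eq_mul_div, div_le_iff₀ hκ, mul_assoc]
          refine mul_le_mul_of_nonneg_left ?_ (hx i)
          linarith
      _ = _ := by rw [← Finset.sum_mul, hx1, one_mul]
  rw [form_rescale]
  have h2 : (1 + ε)⁻¹ ≤ 1 := inv_le_one_of_one_le₀ (by linarith)
  have h3 : 0 ≤ (1 + ε)⁻¹ := by positivity
  nlinarith

/-- The added matrix `Z` has trace 1 relative to `R`, because each `a_i a_iᵀ / ‖a_i‖_Q²` has. So
`det (R + Z) ≥ 2 det R`, and the division by `1 + ε` costs at most a factor `9 / 8`. -/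
theorem det_rescale_ge {m : ℕ} (hm : 1 ≤ m) (hrm : r ≤ m) (hε : ε = 1 / (11 * m)) (hR : R.PosDef)
    (hQ : Q = R⁻¹) (hA : ∀ i, A.col i ≠ 0) (hx : ∀ i, 0 ≤ x i) (hx1 : ∑ i, x i = 1) :
    16 / 9 * R.det ≤ (rescale ε A R Q x).val.det := by
  have hm0 : (1 : ℝ) ≤ m := by exact_mod_cast hm
  have hε0 : 0 < ε := by rw [hε]; positivity
  set Z := ∑ i, (x i / (A.col i ⬝ᵥ Q *ᵥ A.col i)) • vecMulVec (A.col i) (A.col i) with hZ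
  have hκ : ∀ i, 0 < A.col i ⬝ᵥ Q *ᵥ A.col i := fun i => hQ ▸ PosDef.pos hR.inv (hA i)
  -- `(1 + ε)^m ≤ e^(1 / 11) ≤ 11 / 10`, the last from `e^(-1 / 11) ≥ 10 / 11`.
  have hpow : (1 + ε) ^ r ≤ 9 / 8 := by
    calc (1 + ε) ^ r ≤ (1 + ε) ^ m := pow_le_pow_right₀ (by linarith) hrm
      _ ≤ Real.exp ε ^ m := pow_le_pow_left₀ (by linarith) (by linarith [Real.add_one_le_exp ε]) m
      _ = Real.exp (1 / 11) := by
          rw [← Real.exp_nat_mul, hε]; congr 1; field_simp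
      _ ≤ 9 / 8 := by
          have h1 := Real.add_one_le_exp (-(1 / 11 : ℝ))
          rw [Real.exp_neg] at h1
          have h2 := Real.exp_pos (1 / 11 : ℝ)
          have h3 : (-(1 / 11 : ℝ) + 1) * Real.exp (1 / 11) ≤ 1 := by
            calc _ ≤ (Real.exp (1 / 11))⁻¹ * Real.exp (1 / 11) :=
                  mul_le_mul_of_nonneg_right h1 h2.le
              _ = 1 := inv_mul_cancel₀ h2.ne'
          linarith
  obtain ⟨S, hS⟩ := exists_transpose_mul_self hR.inv.posSemidef
  have hfac : R + Z = R * (1 + Q * Z) := by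
    rw [Matrix.mul_add, Matrix.mul_one, ← Matrix.mul_assoc, hQ,
      mul_nonsing_inv _ (PosDef.isUnit_det hR), Matrix.one_mul]
  -- `Q Z` need not be symmetric, but `S Z Sᵀ` is, with `Q = Sᵀ S`, and Sylvester's identity relates
  -- the determinants.
  have hdet : (1 + Q * Z).det = (1 + S * Z * Sᵀ).det := by
    rw [hQ, hS, Matrix.mul_assoc, det_one_add_mul_comm]
  have hpsd : (S * Z * Sᵀ).PosSemidef := by
    have hZp : Z.PosSemidef := by
      refine PosSemidef.of_dotProduct_mulVec_nonneg ?_ fun w => ?_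
      · rw [IsHermitian, conjTranspose_eq_transpose_of_trivial, hZ]
        simp only [transpose_sum, transpose_smul, transpose_vecMulVec]
      · rw [star_trivial, hZ, form_sum]
        refine Finset.sum_nonneg fun i _ => ?_
        rw [smul_mulVec, dotProduct_smul, form_vecMulVec]
        exact smul_nonneg (div_nonneg (hx i) (hκ i).le) (sq_nonneg _)
    have := hZp.mul_mul_conjTranspose_same S
    rwa [conjTranspose_eq_transpose_of_trivial] at this
  have htr : (S * Z * Sᵀ).trace = 1 := by
    rw [trace_mul_comm, ← Matrix.mul_assoc, ← hS, ← hQ, hZ, Matrix.mul_sum, trace_sum, ← hx1]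
    refine Finset.sum_congr rfl fun i _ => ?_
    rw [Matrix.mul_smul, trace_smul, mul_vecMulVec, trace_vecMulVec,
      dotProduct_comm (Q *ᵥ A.col i) (A.col i), smul_eq_mul,
      div_mul_cancel₀ _ (hκ i).ne']
  have h2 : 2 ≤ (1 + Q * Z).det := by
    rw [hdet]
    have := one_add_trace_le_det_one_add hpsd
    rw [htr] at this
    linarith
  rw [rescale_val, det_smul, Fintype.card_fin, ← hZ, hfac, det_mul, inv_pow]
  have hdR := hR.det_pos
  rw [← div_eq_inv_mul, le_div_iff₀ (by positivity)]
  calc 16 / 9 * R.det * (1 + ε) ^ r ≤ 16 / 9 * R.det * (9 / 8) := by gcongr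
    _ = R.det * 2 := by ring
    _ ≤ _ := by gcongr

/-- Rescaling keeps `w` in the unit ball of `R`, if it has nonnegative scalar product with all
columns. -/
theorem form_rescale_le_one (hε : 0 < ε) (hR : R.PosDef) (hQ : Q = R⁻¹) (hA : ∀ i, A.col i ≠ 0)
    (hx : ∀ i, 0 ≤ x i) {y : Fin r → ℝ}
    (hy : y = ∑ i, (x i / √(A.col i ⬝ᵥ Q *ᵥ A.col i)) • A.col i) (hyε : √(y ⬝ᵥ Q *ᵥ y) ≤ ε)
    {w : Fin r → ℝ} (hw : w ⬝ᵥ R *ᵥ w ≤ 1) (hAw : ∀ i, 0 ≤ A.col i ⬝ᵥ w) :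
    w ⬝ᵥ (rescale ε A R Q x).val *ᵥ w ≤ 1 := by
  have hcs : ∀ v : Fin r → ℝ, v ⬝ᵥ w ≤ √(v ⬝ᵥ Q *ᵥ v) := fun v => by
    refine Real.le_sqrt_of_sq_le ?_
    have h1 := PosDef.sq_dotProduct_le hR v w
    rw [← hQ] at h1
    have h2 : 0 ≤ v ⬝ᵥ Q *ᵥ v := hQ ▸ PosDef.nonneg hR.inv v
    nlinarith
  have hsum : ∑ i, x i / (A.col i ⬝ᵥ Q *ᵥ A.col i) * (A.col i ⬝ᵥ w) ^ 2 ≤ ε := by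
    -- The ratio `(a_i · w) / ‖a_i‖_Q` lies between 0 and 1, so its square is at most itself.
    calc _ ≤ ∑ i, x i / √(A.col i ⬝ᵥ Q *ᵥ A.col i) * (A.col i ⬝ᵥ w) :=
          Finset.sum_le_sum fun i _ => by
            have hκ : 0 < A.col i ⬝ᵥ Q *ᵥ A.col i := hQ ▸ PosDef.pos hR.inv (hA i)
            set d := √(A.col i ⬝ᵥ Q *ᵥ A.col i) with hd
            have hd0 : 0 < d := Real.sqrt_pos.2 hκ
            have hdd : A.col i ⬝ᵥ Q *ᵥ A.col i = d * d := (Real.mul_self_sqrt hκ.le).symm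
            have h1 := hcs (A.col i)
            rw [← hd] at h1
            rw [hdd]
            have h2 : x i / (d * d) * (A.col i ⬝ᵥ w) ^ 2
                = x i / d * (A.col i ⬝ᵥ w) * ((A.col i ⬝ᵥ w) / d) := by
              field_simp
            rw [h2]
            exact mul_le_of_le_one_right (mul_nonneg (div_nonneg (hx i) hd0.le) (hAw i))
              ((div_le_one hd0).2 h1)
      _ = y ⬝ᵥ w := by
          rw [hy, sum_dotProduct]
          exact Finset.sum_congr rfl fun i _ => by rw [smul_dotProduct, smul_eq_mul]
      _ ≤ ε := (hcs y).trans hyε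
  rw [form_rescale, inv_mul_le_iff₀ (by positivity)]
  linarith

end Rescale

end MaxSupport

namespace MaxSupport

open Timed Matrix

/-! ### The states of the main loop -/

section States

variable {m n : ℕ}

/-- `z` solves `Aᵀ z ≥ 0`. -/
def IsFeasible (A₀ : Matrix (Fin m) (Fin n) ℝ) (z : Fin m → ℝ) : Prop :=
  ∀ i, 0 ≤ A₀.col i ⬝ᵥ z

/-- The invariants of the main loop: the columns of `U` are an orthonormal basis of a space that
contains all solutions; the columns of `A` are those of the input matrix in this basis, without the
zero vectors; the ellipsoid of `R` contains all solutions of length at most 1, and its volume has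
decreased with the number of calls, up to a factor `M` for each removed row. -/
structure IsValid (A₀ : Matrix (Fin m) (Fin n) ℝ) (M : ℝ) (s : State ℝ m) : Prop where
  rows_le : s.rows ≤ m
  cols_le : s.cols ≤ n
  orth : s.Uᵀ * s.U = 1
  col_ne : ∀ j, s.A.col j ≠ 0
  col_eq : ∀ j, ∃ i, s.A.col j = s.Uᵀ *ᵥ A₀.col i
  col_of : ∀ i, s.Uᵀ *ᵥ A₀.col i ≠ 0 → ∃ j, s.A.col j = s.Uᵀ *ᵥ A₀.col i
  feas : ∀ z, IsFeasible A₀ z → s.U *ᵥ s.Uᵀ *ᵥ z = z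
  repr : ∃ (α : ℝ) (γ : Fin n → ℝ), 0 < α ∧ α ≤ 1 ∧ (∀ i, 0 ≤ γ i) ∧
    s.R = α • 1 + ∑ i, γ i • vecMulVec (s.Uᵀ *ᵥ A₀.col i) (s.Uᵀ *ᵥ A₀.col i)
  inv : s.Q = s.R⁻¹
  ell : ∀ z, IsFeasible A₀ z → z ⬝ᵥ z ≤ 1 → (s.Uᵀ *ᵥ z) ⬝ᵥ s.R *ᵥ (s.Uᵀ *ᵥ z) ≤ 1
  vol : (16 / 9) ^ s.calls ≤ s.R.det * M ^ (m - s.rows)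

/-- No column is shorter in the norm of `Q` by a factor less than `θ`. -/
def IsLong (θ : ℝ) (s : State ℝ m) : Prop :=
  ∀ j, θ ^ 2 * (s.A.col j ⬝ᵥ s.A.col j) ≤ s.A.col j ⬝ᵥ s.Q *ᵥ s.A.col j

variable {A₀ : Matrix (Fin m) (Fin n) ℝ} {M θ : ℝ} {s : State ℝ m}

theorem IsValid.posDef (h : IsValid A₀ M s) : s.R.PosDef := by
  obtain ⟨α, γ, hα, -, hγ, hR⟩ := h.repr
  exact hR ▸ posDef_smul_one_add_sum hα hγ _

theorem mulVec_dotProduct_mulVec {p q : ℕ} {U : Matrix (Fin p) (Fin q) ℝ} (hU : Uᵀ * U = 1)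
    (v w : Fin q → ℝ) : (U *ᵥ v) ⬝ᵥ (U *ᵥ w) = v ⬝ᵥ w := by
  rw [dotProduct_mulVec, vecMul_mulVec, hU, vecMul_one]

theorem transpose_mulVec_dotProduct {p q : ℕ} (U : Matrix (Fin p) (Fin q) ℝ)
    (a : Fin p → ℝ) (v : Fin q → ℝ) : (Uᵀ *ᵥ a) ⬝ᵥ v = a ⬝ᵥ U *ᵥ v := by
  rw [dotProduct_mulVec, mulVec_transpose]

theorem transpose_mulVec_dotProduct_self_le {p q : ℕ} {U : Matrix (Fin p) (Fin q) ℝ}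
    (hU : Uᵀ * U = 1) (a : Fin p → ℝ) : (Uᵀ *ᵥ a) ⬝ᵥ (Uᵀ *ᵥ a) ≤ a ⬝ᵥ a := by
  have h1 : 0 ≤ (a - U *ᵥ Uᵀ *ᵥ a) ⬝ᵥ (a - U *ᵥ Uᵀ *ᵥ a) := by
    simpa using dotProduct_star_self_nonneg (a - U *ᵥ Uᵀ *ᵥ a)
  have h2 := transpose_mulVec_dotProduct U a (Uᵀ *ᵥ a)
  rw [sub_dotProduct, dotProduct_sub, dotProduct_sub, mulVec_dotProduct_mulVec hU,
    dotProduct_comm (U *ᵥ Uᵀ *ᵥ a) a, ← h2] at h1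
  linarith

theorem IsValid.dotProduct_transpose (h : IsValid A₀ M s) {z : Fin m → ℝ} (hz : IsFeasible A₀ z)
    (a : Fin m → ℝ) : (s.Uᵀ *ᵥ a) ⬝ᵥ (s.Uᵀ *ᵥ z) = a ⬝ᵥ z := by
  rw [transpose_mulVec_dotProduct, h.feas z hz]

theorem IsValid.form_le (h : IsValid A₀ M s) (hθ : 0 < θ) (hs : IsLong θ s)
    (w : Fin s.rows → ℝ) : w ⬝ᵥ s.R *ᵥ w ≤ (1 + n / θ ^ 2) * (w ⬝ᵥ w) := by
  obtain ⟨α, γ, hα, hα1, hγ, hR⟩ := h.repr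
  refine form_le_of_long hα hα1 hγ hR hθ (fun i => ?_) w
  by_cases h0 : s.Uᵀ *ᵥ A₀.col i = 0
  · simp [h0]
  · obtain ⟨j, hj⟩ := h.col_of i h0
    rw [← hj, ← h.inv]
    exact hs j

/-- The remaining rows bound `det R` by `M ^ rows`, and each removed row has cost at most one
further factor `M`; together this is always `M ^ m`. -/
theorem IsValid.pow_calls_le (h : IsValid A₀ M s) (hM : 0 ≤ M)
    (hRM : ∀ w, w ⬝ᵥ s.R *ᵥ w ≤ M * (w ⬝ᵥ w)) : (16 / 9) ^ s.calls ≤ M ^ m := by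
  calc _ ≤ s.R.det * M ^ (m - s.rows) := h.vol
    _ ≤ M ^ s.rows * M ^ (m - s.rows) := by
        gcongr
        exact det_le_pow h.posDef hRM
    _ = M ^ m := by rw [← pow_add, Nat.add_sub_cancel' h.rows_le]

/-- The factor by which solutions of length 1 can satisfy an inequality strictly. -/
def HasMargin (A₀ : Matrix (Fin m) (Fin n) ℝ) (θ : ℝ) : Prop :=
  ∀ z, IsFeasible A₀ z → ∀ i, 0 < A₀.col i ⬝ᵥ z →
    ∃ y, IsFeasible A₀ y ∧ y ⬝ᵥ y ≤ 1 ∧ θ * √(A₀.col i ⬝ᵥ A₀.col i) ≤ A₀.col i ⬝ᵥ y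

/-- Otherwise the margin gives a solution `y` of length at most 1 with `a_i · y ≥ θ ‖a_i‖`, and
projection does not lengthen `a_i`. But `y` lies in the ellipsoid, so `a_i · y` is at most the
`Q`-norm of the projected column, less than `θ` times its length. -/
theorem IsValid.orthogonal_of_short (h : IsValid A₀ M s) (hθ : 0 < θ) (hA : HasMargin A₀ θ)
    {k : Fin s.cols}
    (hk : √(s.A.col k ⬝ᵥ s.Q *ᵥ s.A.col k) / √(s.A.col k ⬝ᵥ s.A.col k) < θ)
    {z : Fin m → ℝ} (hz : IsFeasible A₀ z) : s.A.col k ⬝ᵥ s.Uᵀ *ᵥ z = 0 := by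
  have hc : 0 < s.A.col k ⬝ᵥ s.A.col k := by
    simpa using dotProduct_star_self_pos_iff.2 (h.col_ne k)
  obtain ⟨i, hi⟩ := h.col_eq k
  by_contra h0
  rw [hi, h.dotProduct_transpose hz] at h0
  obtain ⟨y, hy, hy1, hyθ⟩ := hA z hz i (lt_of_le_of_ne (hz i) (Ne.symm h0))
  have h1 := PosDef.sq_dotProduct_le h.posDef (s.A.col k) (s.Uᵀ *ᵥ y)
  have h2 := h.ell y hy hy1
  have h3 : s.A.col k ⬝ᵥ s.Uᵀ *ᵥ y = A₀.col i ⬝ᵥ y := by rw [hi, h.dotProduct_transpose hy]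
  rw [h3, ← h.inv] at h1
  have h4 : 0 ≤ s.A.col k ⬝ᵥ s.Q *ᵥ s.A.col k := h.inv ▸ PosDef.nonneg h.posDef.inv _
  have h5 : A₀.col i ⬝ᵥ y ≤ √(s.A.col k ⬝ᵥ s.Q *ᵥ s.A.col k) :=
    Real.le_sqrt_of_sq_le (h1.trans (mul_le_of_le_one_right h4 h2))
  rw [div_lt_iff₀ (Real.sqrt_pos.2 hc)] at hk
  have h6 : s.A.col k ⬝ᵥ s.A.col k ≤ A₀.col i ⬝ᵥ A₀.col i := by
    rw [hi]; exact transpose_mulVec_dotProduct_self_le h.orth _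
  have h7 := mul_le_mul_of_nonneg_left (Real.sqrt_le_sqrt h6) hθ.le
  linarith

theorem transpose_mul_vecMulVec_mul {p q : ℕ} (W : Matrix (Fin p) (Fin q) ℝ) (c : Fin p → ℝ) :
    Wᵀ * (vecMulVec c c * W) = vecMulVec (Wᵀ *ᵥ c) (Wᵀ *ᵥ c) := by
  rw [vecMulVec_mul, mul_vecMulVec, mulVec_transpose]

theorem conj_form {p q : ℕ} (W : Matrix (Fin p) (Fin q) ℝ) (R : Matrix (Fin p) (Fin p) ℝ)
    (w : Fin q → ℝ) : w ⬝ᵥ (Wᵀ * (R * W)) *ᵥ w = (W *ᵥ w) ⬝ᵥ R *ᵥ (W *ᵥ w) := by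
  rw [← mulVec_mulVec, ← mulVec_mulVec, dotProduct_comm, transpose_mulVec_dotProduct,
    dotProduct_comm]

/-- Restriction to the complement of a column that is orthogonal to all solutions. -/
theorem IsValid.compress {calls r t : ℕ} {A : Matrix (Fin (r + 1)) (Fin t) ℝ}
    {R Q : Matrix (Fin (r + 1)) (Fin (r + 1)) ℝ} {U : Matrix (Fin m) (Fin (r + 1)) ℝ}
    (h : IsValid A₀ M ⟨calls, r + 1, t, A, R, Q, U⟩) (hM : 0 ≤ M)
    (hRM : ∀ w, w ⬝ᵥ R *ᵥ w ≤ M * (w ⬝ᵥ w)) {k : Fin t}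
    (hk : ∀ z, IsFeasible A₀ z → A.col k ⬝ᵥ Uᵀ *ᵥ z = 0)
    {W : Matrix (Fin (r + 1)) (Fin r) ℝ} (hW : W = (complementBasis (A.col k)).val)
    {keep : List (Fin t)} (hkeep : keep = (nonzeroColumns (Wᵀ * A)).val) :
    IsValid A₀ M ⟨calls, r, keep.length, (Wᵀ * A).submatrix id keep.get, Wᵀ * (R * W),
      (Wᵀ * (R * W))⁻¹, U * W⟩ ∧ ∀ w, w ⬝ᵥ (Wᵀ * (R * W)) *ᵥ w ≤ M * (w ⬝ᵥ w) := by
  have hR := h.posDef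
  have ha := h.col_ne k
  simp only at hR ha
  have hWW : Wᵀ * W = 1 := hW ▸ complementBasis_transpose_mul_self ha
  have hWc : ∀ w, A.col k ⬝ᵥ w = 0 → W *ᵥ Wᵀ *ᵥ w = w := fun w hw =>
    hW ▸ complementBasis_mulVec_transpose_mulVec ha hw
  have hdet : (Wᵀ * (R * W)).det * (A.col k ⬝ᵥ A.col k) = R.det * (A.col k ⬝ᵥ R⁻¹ *ᵥ A.col k) :=
    hW ▸ det_complementBasis_conj ha (PosDef.isUnit_det hR)
  have hUW : ∀ v, (U * W)ᵀ *ᵥ v = Wᵀ *ᵥ Uᵀ *ᵥ v := fun v => by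
    rw [transpose_mul, mulVec_mulVec]
  have hcol : ∀ j, (Wᵀ * A).col j = Wᵀ *ᵥ A.col j := fun j => by
    ext l; simp [mul_apply, mulVec, dotProduct]
  have hsub : ∀ j, ((Wᵀ * A).submatrix id keep.get).col j = Wᵀ *ᵥ A.col (keep.get j) :=
    fun j => hcol _
  have hfe : ∀ z, IsFeasible A₀ z → W *ᵥ (U * W)ᵀ *ᵥ z = Uᵀ *ᵥ z := fun z hz => by
    rw [hUW, hWc _ (hk z hz)]
  refine ⟨⟨?_, ?_, ?_, ?_, ?_, ?_, ?_, ?_, rfl, ?_, ?_⟩, fun w => ?_⟩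
  · have := h.rows_le
    simp only at this ⊢
    omega
  · have := h.cols_le
    have h2 := nonzeroColumns_length_le (Wᵀ * A)
    rw [← hkeep] at h2
    exact h2.trans this
  · have h1 : Uᵀ * U = 1 := h.orth
    change (U * W)ᵀ * (U * W) = 1
    rw [transpose_mul, Matrix.mul_assoc, ← Matrix.mul_assoc Uᵀ, h1, Matrix.one_mul, hWW]
  · intro j
    have h1 : keep.get j ∈ (nonzeroColumns (Wᵀ * A)).val := hkeep ▸ List.get_mem keep j
    have h2 := (mem_nonzeroColumns _ _).1 h1
    exact h2
  · intro j
    obtain ⟨i, hi⟩ := h.col_eq (keep.get j)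
    refine ⟨i, ?_⟩
    change ((Wᵀ * A).submatrix id keep.get).col j = (U * W)ᵀ *ᵥ A₀.col i
    rw [hsub, hUW]
    exact congrArg _ hi
  · intro i hi
    change (U * W)ᵀ *ᵥ A₀.col i ≠ 0 at hi
    rw [hUW] at hi
    have h0 : Uᵀ *ᵥ A₀.col i ≠ 0 := fun h0 => hi (by rw [h0, mulVec_zero])
    obtain ⟨j, hj⟩ := h.col_of i h0
    change A.col j = Uᵀ *ᵥ A₀.col i at hj
    have hmem : j ∈ keep := by
      rw [hkeep, mem_nonzeroColumns, hcol, hj]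
      exact hi
    obtain ⟨l, hl⟩ := List.get_of_mem hmem
    refine ⟨l, ?_⟩
    change ((Wᵀ * A).submatrix id keep.get).col l = (U * W)ᵀ *ᵥ A₀.col i
    rw [hsub, hl, hj, hUW]
  · intro z hz
    change (U * W) *ᵥ (U * W)ᵀ *ᵥ z = z
    rw [← mulVec_mulVec, hfe z hz]
    exact h.feas z hz
  · obtain ⟨α, γ, hα, hα1, hγ, hRe⟩ := h.repr
    refine ⟨α, γ, hα, hα1, hγ, ?_⟩
    change R = α • 1 + ∑ i, γ i • vecMulVec (Uᵀ *ᵥ A₀.col i) (Uᵀ *ᵥ A₀.col i) at hRe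
    change Wᵀ * (R * W) = α • 1
      + ∑ i, γ i • vecMulVec ((U * W)ᵀ *ᵥ A₀.col i) ((U * W)ᵀ *ᵥ A₀.col i)
    simp only [hUW]
    rw [hRe, Matrix.add_mul, Matrix.mul_add, Matrix.smul_mul, Matrix.mul_smul, Matrix.one_mul, hWW,
      Matrix.sum_mul, Matrix.mul_sum]
    congr 1
    refine Finset.sum_congr rfl fun i _ => ?_
    rw [Matrix.smul_mul, Matrix.mul_smul, transpose_mul_vecMulVec_mul]
  · intro z hz hz1
    change ((U * W)ᵀ *ᵥ z) ⬝ᵥ (Wᵀ * (R * W)) *ᵥ ((U * W)ᵀ *ᵥ z) ≤ 1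
    rw [conj_form, hfe z hz]
    exact h.ell z hz hz1
  · have hv : (16 / 9) ^ calls ≤ R.det * M ^ (m - (r + 1)) := h.vol
    have hr : r + 1 ≤ m := h.rows_le
    change (16 / 9) ^ calls ≤ (Wᵀ * (R * W)).det * M ^ (m - r)
    have h1 : m - r = m - (r + 1) + 1 := by omega
    have hκ := PosDef.pos hR.inv ha
    have haa := PosDef.dotProduct_self_le hR hRM (A.col k)
    have haa0 : 0 < A.col k ⬝ᵥ A.col k := by
      simpa using dotProduct_star_self_pos_iff.2 ha
    have hd : 0 ≤ (Wᵀ * (R * W)).det := by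
      have h2 := mul_pos hR.det_pos hκ
      rw [← hdet] at h2
      exact (pos_of_mul_pos_left h2 haa0.le).le
    -- The determinant changes by the factor `‖a_k‖_Q² / ‖a_k‖²`, which is at least `1 / M` since `R
    -- ≤ M I`.
    have h3 : R.det ≤ (Wᵀ * (R * W)).det * M := by
      have h4 := mul_le_mul_of_nonneg_left haa hd
      rw [hdet] at h4
      exact le_of_mul_le_mul_right (by linarith) hκ
    calc _ ≤ R.det * M ^ (m - (r + 1)) := hv
      _ ≤ (Wᵀ * (R * W)).det * M * M ^ (m - (r + 1)) := by gcongr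
      _ = _ := by rw [h1, pow_succ]; ring
  · rw [conj_form]
    refine (hRM _).trans_eq ?_
    rw [mulVec_dotProduct_mulVec hWW]

/-- The columns that are shorter in the norm of `Q` by a factor less than `θ`, where
`QA = Q * A`. -/
noncomputable def shortColumns {r t : ℕ} (θ : ℝ) (A QA : Matrix (Fin r) (Fin t) ℝ) :
    Timed (List (Fin t)) :=
  filterT (fun k => do
    let s ← dot (fun i => A i k) (fun i => QA i k)
    let nq ← RealRAM.sqrt s
    let e ← dot (fun i => A i k) (fun i => A i k)
    let ne ← RealRAM.sqrt e
    let ratio ← RealRAM.div nq ne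
    let b ← RealRAM.le θ ratio
    pure (!b)) (List.finRange t)

theorem mem_shortColumns {r t : ℕ} {θ : ℝ} {A : Matrix (Fin r) (Fin t) ℝ}
    {Q : Matrix (Fin r) (Fin r) ℝ} {k : Fin t} : k ∈ (shortColumns θ A (Q * A)).val
      ↔ √(A.col k ⬝ᵥ Q *ᵥ A.col k) / √(A.col k ⬝ᵥ A.col k) < θ := by
  have hcol : (fun i => (Q * A) i k) = Q *ᵥ A.col k := by
    ext l; simp [mul_apply, mulVec, dotProduct]
  have hcol' : (fun i => A i k) = A.col k := rfl
  simp only [shortColumns, filterT_val, List.mem_filter, List.mem_finRange, true_and, bind_val,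
    dot_val, sqrt_val, div_val, pure_val, Bool.not_eq_true', le_val_false, hcol, hcol']

theorem shortColumns_cost_le {r t : ℕ} (θ : ℝ) (A QA : Matrix (Fin r) (Fin t) ℝ) :
    (shortColumns θ A QA).cost ≤ t * (6 + r * 4) := by
  refine (filterT_cost_le (c := 6 + r * 4) (fun k => ?_) _).trans (by simp)
  simp only [bind_cost, dot_cost, sqrt_cost, div_cost, le_cost, pure_cost]
  omega

theorem removeShort_succ (c : ℕ → ℕ) (θ : ℝ) (calls r t : ℕ) (A : Matrix (Fin (r + 1)) (Fin t) ℝ)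
    (R Q : Matrix (Fin (r + 1)) (Fin (r + 1)) ℝ) (U : Matrix (Fin m) (Fin (r + 1)) ℝ) :
    removeShort c θ calls (r + 1) t A R Q U = (do
      let QA ← matMul Q A
      let short ← shortColumns θ A QA
      match short with
      | [] => pure ⟨calls, r + 1, t, A, R, Q, U⟩
      | k₀ :: ks => do
        let k := pick (c r) k₀ ks
        let W ← complementBasis fun i => A i k
        let WA ← matMul W.transpose A
        let keep ← nonzeroColumns WA
        let RW ← matMul R W
        let R' ← matMul W.transpose RW
        let U' ← matMul U W
        let Q' ← inverse R'
        removeShort c θ calls r keep.length (WA.submatrix id keep.get) R' Q' U') := rfl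

theorem removal_cost_le {r t : ℕ} (hr : r + 1 ≤ m) (ht : t ≤ n) (hmn : m ≤ n) :
    (r + 1) * (t * (1 + (r + 1) * 2)) + (t * (6 + (r + 1) * 4)
      + (8 + 4 * (r + 1) + (r + 1) * (r * 4) + (r * (t * (1 + (r + 1) * 2)) + (t * (r * 3)
      + ((r + 1) * (r * (1 + (r + 1) * 2)) + (r * (r * (1 + (r + 1) * 2))
      + (m * (r * (1 + (r + 1) * 2)) + r * (2 + r * (r * 3))))))))) ≤ 50 * (m * m * n) := by
  have hm : 1 ≤ m := by omega
  have hr' : r ≤ m := by omega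
  have h1 : 1 + (r + 1) * 2 ≤ 3 * m := by omega
  have a1 : (r + 1) * (t * (1 + (r + 1) * 2)) ≤ m * (n * (3 * m)) := by gcongr
  have a2 : t * (6 + (r + 1) * 4) ≤ n * (10 * (m * m)) := by
    gcongr
    nlinarith
  have a3 : 8 + 4 * (r + 1) + (r + 1) * (r * 4) ≤ 16 * (m * m * n) := by
    have : (r + 1) * (r * 4) ≤ m * (m * 4) := by gcongr
    have e : m * (m * 4) = 4 * (m * m) := by ring
    have h2 : m ≤ m * m := Nat.le_mul_of_pos_left _ hm
    have h3 : m * m ≤ m * m * n := Nat.le_mul_of_pos_right _ (by omega)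
    omega
  have a4 : r * (t * (1 + (r + 1) * 2)) ≤ m * (n * (3 * m)) := by gcongr
  have a5 : t * (r * 3) ≤ n * (m * m * 3) := by
    gcongr
    exact hr'.trans (Nat.le_mul_of_pos_left _ hm)
  have a6 : (r + 1) * (r * (1 + (r + 1) * 2)) ≤ m * (n * (3 * m)) := by
    gcongr; omega
  have a7 : r * (r * (1 + (r + 1) * 2)) ≤ m * (n * (3 * m)) := by
    gcongr; omega
  have a8 : m * (r * (1 + (r + 1) * 2)) ≤ m * (n * (3 * m)) := by
    gcongr; omega
  have a9 : r * (2 + r * (r * 3)) ≤ n * (5 * (m * m)) := by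
    gcongr
    · omega
    · have : r * r ≤ m * m := by gcongr
      have h2 : 1 ≤ m * m := Nat.mul_pos hm hm
      nlinarith
  nlinarith

/-- Removal of short columns keeps the invariants, if `R` is bounded by `M`. -/
theorem removeShort_spec (hmn : m ≤ n) (hθ : 0 < θ) (hA : HasMargin A₀ θ) (hM : 0 ≤ M)
    (c : ℕ → ℕ) {calls r t : ℕ} {A : Matrix (Fin r) (Fin t) ℝ}
    {R Q : Matrix (Fin r) (Fin r) ℝ} {U : Matrix (Fin m) (Fin r) ℝ}
    (h : IsValid A₀ M ⟨calls, r, t, A, R, Q, U⟩)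
    (hRM : ∀ w, w ⬝ᵥ R *ᵥ w ≤ M * (w ⬝ᵥ w)) :
    ∃ s' k, removeShort c θ calls r t A R Q U = ⟨s', k⟩ ∧ IsValid A₀ M s' ∧ IsLong θ s' ∧
      s'.calls = calls ∧ k + 50 * (m * m * n) * s'.rows ≤ 50 * (m * m * n) * (r + 1) := by
  induction r generalizing t with
  | zero =>
    refine ⟨_, _, rfl, h, fun j => ?_, rfl, ?_⟩
    -- In dimension zero every vector is zero, so no nonzero columns are left.
    · exact absurd (Subsingleton.elim _ _) (h.col_ne j)
    · simp
  | succ r ih =>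
    have hcost := removal_cost_le h.rows_le h.cols_le hmn
    simp only at hcost
    have hsc := shortColumns_cost_le θ A (Q * A)
    have hmem := fun k => mem_shortColumns (θ := θ) (A := A) (Q := Q) (k := k)
    rcases hl : (shortColumns θ A (Q * A)).val with _ | ⟨k₀, ks⟩
    · refine ⟨⟨calls, r + 1, t, A, R, Q, U⟩, (matMul Q A).cost + (shortColumns θ A (Q * A)).cost,
        ?_, h, fun j => ?_, rfl, ?_⟩
      · rw [removeShort_succ]
        ext1
        · simp [hl]
        · simp [hl]
      · have hj := hmem j
        rw [hl] at hj
        have h1 := not_lt.1 (mt hj.2 (by simp))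
        have hc : 0 < A.col j ⬝ᵥ A.col j := by
          simpa using dotProduct_star_self_pos_iff.2 (h.col_ne j)
        rw [le_div_iff₀ (Real.sqrt_pos.2 hc)] at h1
        have hQ : 0 ≤ A.col j ⬝ᵥ Q *ᵥ A.col j := by
          have h2 := PosDef.nonneg h.posDef.inv (A.col j)
          have h3 := h.inv
          simp only at h2 h3
          rwa [← h3] at h2
        have h4 := pow_le_pow_left₀ (by positivity) h1 2
        rw [mul_pow, Real.sq_sqrt hc.le, Real.sq_sqrt hQ] at h4
        exact h4
      · simp only [matMul_cost]
        rw [mul_add _ (r + 1) 1]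
        omega
    · set k := pick (c r) k₀ ks with hk
      have hks : k ∈ (shortColumns θ A (Q * A)).val := hl ▸ pick_mem _ _ _
      have horth : ∀ z, IsFeasible A₀ z → A.col k ⬝ᵥ Uᵀ *ᵥ z = 0 := fun z hz =>
        h.orthogonal_of_short hθ hA ((hmem k).1 hks) hz
      set W := (complementBasis (A.col k)).val with hW
      set keep := (nonzeroColumns (Wᵀ * A)).val with hkeep
      obtain ⟨h1, h2⟩ := h.compress hM hRM horth hW hkeep
      obtain ⟨s', q, hq, hv, hlong, hcalls, hle⟩ := ih h1 h2
      have hinv : (inverse (Wᵀ * (R * W))).val = (Wᵀ * (R * W))⁻¹ := inverse_val h1.posDef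
      refine ⟨s', (matMul Q A).cost + ((shortColumns θ A (Q * A)).cost
        + ((complementBasis (A.col k)).cost + ((matMul Wᵀ A).cost + ((nonzeroColumns (Wᵀ * A)).cost
        + ((matMul R W).cost + ((matMul Wᵀ (R * W)).cost + ((matMul U W).cost
        + ((inverse (Wᵀ * (R * W))).cost + q)))))))), ?_, hv, hlong, hcalls, ?_⟩
      · rw [removeShort_succ]
        have hcol : (fun i => A i k) = A.col k := rfl
        ext1
        · simp only [bind_val, matMul_val, hl, ← hk, hcol, ← hW, hinv]
          rw [hq]
        · simp only [bind_cost, matMul_val, hl, ← hk, hcol, ← hW, hinv]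
          rw [hq]
      -- A removal costs at most `50 m² n` and is paid for by the row that disappears. The 1 in `r +
      -- 1` pays for the last search, which finds nothing.
      · have b1 := complementBasis_cost_le (A.col k)
        have b2 := nonzeroColumns_cost_le (Wᵀ * A)
        have b3 := inverse_cost_le (Wᵀ * (R * W))
        simp only [matMul_cost]
        rw [mul_add _ (r + 1) 1]
        omega

end States

end MaxSupport

namespace MaxSupport

open Timed Matrix

/-! ### Rounds of the main loop -/

section Rounds

variable {m n : ℕ} {A₀ : Matrix (Fin m) (Fin n) ℝ} {M θ : ℝ}

/-- Every input column either survives as a column of `A`, where the inequality is strict, or has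
projection zero. In the latter case it vanishes on all solutions, as these lie in the range of `U`.
-/
theorem IsValid.isMaxSupportSolution {s : State ℝ m} (h : IsValid A₀ M s) {v : Fin s.rows → ℝ}
    (hv : ∀ j, 0 < s.A.col j ⬝ᵥ v) : IsMaxSupportSolution A₀ (s.U *ᵥ v) := by
  have happ : ∀ (z : Fin m → ℝ) i, (A₀ᵀ *ᵥ z) i = A₀.col i ⬝ᵥ z := fun z i => rfl
  have hzero : ∀ i, s.Uᵀ *ᵥ A₀.col i = 0 ∨ 0 < A₀.col i ⬝ᵥ s.U *ᵥ v := fun i => by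
    by_cases h0 : s.Uᵀ *ᵥ A₀.col i = 0
    · exact Or.inl h0
    · obtain ⟨j, hj⟩ := h.col_of i h0
      refine Or.inr ?_
      rw [← transpose_mulVec_dotProduct, ← hj]
      exact hv j
  refine ⟨fun i => ?_, fun z hz i hi => ?_⟩
  · rw [happ, Pi.zero_apply]
    rcases hzero i with h0 | h0
    · rw [← transpose_mulVec_dotProduct, h0, zero_dotProduct]
    · exact h0.le
  · have hi' : A₀.col i ⬝ᵥ z ≠ 0 := hi
    change A₀.col i ⬝ᵥ s.U *ᵥ v ≠ 0
    rcases hzero i with h0 | h0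
    · refine absurd ?_ hi'
      rw [← h.dotProduct_transpose (fun j => hz j), h0, zero_dotProduct]
    · exact h0.ne'

/-- Rescaling after an unsuccessful call of the first order method. -/
theorem IsValid.rescale {calls r t : ℕ} {A : Matrix (Fin r) (Fin (t + 1)) ℝ}
    {R Q : Matrix (Fin r) (Fin r) ℝ} {U : Matrix (Fin m) (Fin r) ℝ}
    (h : IsValid A₀ M ⟨calls, r, t + 1, A, R, Q, U⟩) (hm : 1 ≤ m) (hM : 0 ≤ M)
    {x : Fin (t + 1) → ℝ} {y : Fin r → ℝ} (hx : ∀ i, 0 ≤ x i) (hx1 : ∑ i, x i = 1)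
    (hy : y = ∑ i, (x i / √(A.col i ⬝ᵥ Q *ᵥ A.col i)) • A.col i)
    (hyε : √(y ⬝ᵥ Q *ᵥ y) ≤ 1 / (11 * m)) :
    IsValid A₀ M ⟨calls + 1, r, t + 1, A, (rescale (1 / (11 * (m : ℝ))) A R Q x).val,
      (rescale (1 / (11 * (m : ℝ))) A R Q x).val⁻¹, U⟩ := by
  have hm0 : (1 : ℝ) ≤ m := by exact_mod_cast hm
  set ε : ℝ := 1 / (11 * (m : ℝ)) with hε
  have hε0 : 0 < ε := by positivity
  have hR := h.posDef
  have hQ := h.inv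
  have hcol := h.col_ne
  have hr := h.rows_le
  have hvol := h.vol
  simp only at hR hQ hcol hr hvol
  have hκ : ∀ i, 0 < A.col i ⬝ᵥ Q *ᵥ A.col i := fun i => hQ ▸ PosDef.pos hR.inv (hcol i)
  refine ⟨hr, h.cols_le, h.orth, hcol, h.col_eq, h.col_of, h.feas, ?_, rfl, fun z hz hz1 => ?_, ?_⟩
  · obtain ⟨α, γ, hα, hα1, hγ, hRe⟩ := h.repr
    simp only at hRe
    -- Each current column is assigned to one input column. Several may share the same one, so their
    -- weights are added up over the fibers of `f`.
    choose f hf using h.col_eq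
    simp only at f hf
    set κ : Fin (t + 1) → ℝ := fun j => x j / (A.col j ⬝ᵥ Q *ᵥ A.col j) with hκdef
    have hκ0 : ∀ j, 0 ≤ κ j := fun j => div_nonneg (hx j) (hκ j).le
    have hinv0 : 0 ≤ (1 + ε)⁻¹ := by positivity
    refine ⟨(1 + ε)⁻¹ * α, fun i => (1 + ε)⁻¹ * (γ i + ∑ j with f j = i, κ j), by positivity,
      ?_, fun i => ?_, ?_⟩
    · exact mul_le_one₀ (inv_le_one_of_one_le₀ (by linarith)) hα.le hα1
    · exact mul_nonneg hinv0 (add_nonneg (hγ i) (Finset.sum_nonneg fun j _ => hκ0 j))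
    · simp only
      rw [rescale_val, hRe]
      have h1 : ∑ j, κ j • vecMulVec (A.col j) (A.col j)
          = ∑ i, (∑ j with f j = i, κ j) • vecMulVec (Uᵀ *ᵥ A₀.col i) (Uᵀ *ᵥ A₀.col i) := by
        rw [← Finset.sum_fiberwise Finset.univ f]
        refine Finset.sum_congr rfl fun i _ => ?_
        rw [Finset.sum_smul]
        refine Finset.sum_congr rfl fun j hj => ?_
        rw [hf j, (Finset.mem_filter.1 hj).2]
      rw [h1, add_assoc, ← Finset.sum_add_distrib, smul_add, smul_smul, Finset.smul_sum]
      congr 1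
      refine Finset.sum_congr rfl fun i _ => ?_
      rw [← add_smul, smul_smul]
  · refine form_rescale_le_one hε0 hR hQ hcol hx hy hyε (h.ell z hz hz1) fun j => ?_
    obtain ⟨i, hi⟩ := h.col_eq j
    have h1 := h.dotProduct_transpose hz (A₀.col i)
    rw [← hi] at h1
    simp only at h1
    rw [h1]
    exact hz i
  · have h1 := det_rescale_ge hm hr hε hR hQ hcol hx hx1
    simp only
    rw [pow_succ]
    calc _ ≤ R.det * M ^ (m - r) * (16 / 9) := by gcongr
      _ = 16 / 9 * R.det * M ^ (m - r) := by ring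
      _ ≤ _ := by gcongr

theorem mainRound_succ (fom : FirstOrderMethod ℝ) (c : ℕ → ℕ) (fuel : ℕ) (θ ε : ℝ)
    (calls r t : ℕ) (A : Matrix (Fin r) (Fin (t + 1)) ℝ) (R Q : Matrix (Fin r) (Fin r) ℝ)
    (U : Matrix (Fin m) (Fin r) ℝ) :
    mainRound fom c fuel θ ε ⟨calls, r, t + 1, A, R, Q, U⟩ = (do
      let o ← fom calls fuel r t A Q ε
      match o with
      | none => pure none
      | some (x, y) => do
        let Qy ← matVec Q y
        let z ← matVec A.transpose Qy
        let feas ← allPos z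
        if feas then do
          let ybar ← matVec U Qy
          pure (some (Sum.inr ybar))
        else do
          let R' ← rescale ε A R Q x
          let Q' ← inverse R'
          let s ← removeShort c θ (calls + 1) r (t + 1) A R' Q' U
          pure (some (Sum.inl s))) := by
  simp only [mainRound]
  congr 1
  funext o
  rcases o with _ | ⟨x, y⟩ <;> rfl

theorem round_cost_le {r t : ℕ} (hm : 1 ≤ m) (hr : r ≤ m) (ht : t ≤ n) (hmn : m ≤ n) :
    r * (1 + r * 2) + t * (1 + r * 2) + t * 2 + m * (1 + r * 2)
      + (r * (t * (1 + r * 2)) + (t * (1 + r * 2 + 1) + (1 + (1 + r * (r * (1 + t * 3 + 1 + 1))))))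
      + r * (2 + r * (r * 3)) ≤ 50 * (m * m * n) := by
  have h1 : 1 + r * 2 ≤ 3 * m := by omega
  have h2 : 1 + r * 2 + 1 ≤ 4 * m := by omega
  have h3 : 1 + t * 3 + 1 + 1 ≤ 6 * n := by omega
  have hmm : m ≤ m * m := Nat.le_mul_of_pos_left _ hm
  have a1 : r * (1 + r * 2) ≤ n * (3 * (m * m)) := by
    gcongr
    · omega
    · omega
  have a2 : t * (1 + r * 2) ≤ n * (3 * (m * m)) := by
    gcongr; omega
  have a3 : t * 2 ≤ n * (2 * (m * m)) := by
    gcongr; omega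
  have a4 : m * (1 + r * 2) ≤ n * (3 * (m * m)) := by
    gcongr; omega
  have a5 : r * (t * (1 + r * 2)) ≤ m * (n * (3 * m)) := by gcongr
  have a6 : t * (1 + r * 2 + 1) ≤ n * (4 * (m * m)) := by
    gcongr; omega
  have a7 : r * (r * (1 + t * 3 + 1 + 1)) ≤ m * (m * (6 * n)) := by gcongr
  have a8 : r * (2 + r * (r * 3)) ≤ n * (5 * (m * m)) := by
    gcongr
    · omega
    · have : r * (r * 3) ≤ m * (m * 3) := by gcongr
      have e : m * (m * 3) = 3 * (m * m) := by ring
      omega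
  have a9 : 1 ≤ m * m * n := Nat.mul_pos (Nat.mul_pos hm hm) (by omega)
  nlinarith

/-- A round of the main loop with a correct first order method. -/
theorem mainRound_spec {fom : FirstOrderMethod ℝ} {N F : ℕ}
    (hfom : ∀ (calls r t : ℕ) (A : Matrix (Fin r) (Fin (t + 1)) ℝ) (Q : Matrix (Fin r) (Fin r) ℝ),
      r ≤ m → t + 1 ≤ n → Q.PosDef → (∀ i, A.col i ≠ 0) →
      ∃ x y c, (∀ fuel ≥ N, fom calls fuel r t A Q (1 / (11 * m)) = ⟨some (x, y), c⟩) ∧ c ≤ F ∧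
        IsFirstOrderResult A Q (1 / (11 * m)) x y)
    (hm : 1 ≤ m) (hmn : m ≤ n) (hθ : 0 < θ) (hA : HasMargin A₀ θ)
    (hM : 2 * (1 + n / θ ^ 2) ≤ M) (c : ℕ → ℕ) {s : State ℝ m} (h : IsValid A₀ M s)
    (hs : IsLong θ s) :
    ∃ o k, (∀ fuel ≥ N, mainRound fom c fuel θ (1 / (11 * m)) s = ⟨some o, k⟩) ∧
      (∀ s', o = Sum.inl s' → IsValid A₀ M s' ∧ IsLong θ s' ∧ s'.calls = s.calls + 1 ∧
        k + 50 * (m * m * n) * s'.rows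
          ≤ F + 100 * (m * m * n) + 50 * (m * m * n) * s.rows) ∧
      (∀ b, o = Sum.inr b → IsMaxSupportSolution A₀ b ∧ k ≤ F + 100 * (m * m * n)) := by
  have hM1 : 0 ≤ 1 + n / θ ^ 2 := by positivity
  have hM0 : 0 ≤ M := le_trans (by positivity) hM
  obtain ⟨calls, r, t, A, R, Q, U⟩ := s
  cases t with
  | zero =>
    -- Without columns, zero satisfies all remaining strict inequalities vacuously.
    refine ⟨Sum.inr 0, m, fun fuel _ => ?_, by simp, fun b hb => ?_⟩
    · simp only [mainRound]
      ext1
      · simp; rfl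
      · simp
    · cases hb
      have h1 := h.isMaxSupportSolution (v := 0) fun j => j.elim0
      rw [mulVec_zero] at h1
      refine ⟨h1, ?_⟩
      have : m ≤ m * (m * n) := Nat.le_mul_of_pos_right _ (Nat.mul_pos hm (by omega))
      rw [mul_assoc m m n]
      omega
  | succ t =>
    have hR := h.posDef
    have hQ := h.inv
    have hRM := h.form_le hθ hs
    have hcol := h.col_ne
    have hr := h.rows_le
    simp only at hR hQ hRM hcol hr
    have hcost := round_cost_le hm hr h.cols_le hmn
    obtain ⟨x, y, k, hf, hk, hres⟩ := hfom calls r t A Q hr h.cols_le (hQ ▸ hR.inv) hcol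
    have hz : ∀ i, (Aᵀ *ᵥ Q *ᵥ y) i = A.col i ⬝ᵥ Q *ᵥ y := fun i => rfl
    have c1 := allPos_cost_le (Aᵀ *ᵥ Q *ᵥ y)
    by_cases hpos : ∀ i, 0 < (Aᵀ *ᵥ Q *ᵥ y) i
    · have hp := (allPos_val _).2 hpos
      refine ⟨Sum.inr (U *ᵥ Q *ᵥ y), k + ((matVec Q y).cost + ((matVec Aᵀ (Q *ᵥ y)).cost
        + ((allPos (Aᵀ *ᵥ Q *ᵥ y)).cost + (matVec U (Q *ᵥ y)).cost))), fun fuel hfu => ?_,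
        by simp, fun b hb => ?_⟩
      · rw [mainRound_succ]
        ext1
        · simp only [bind_val, hf fuel hfu, matVec_val, hp, if_true, pure_val]
        · simp only [bind_cost, hf fuel hfu, matVec_val, hp, if_true, pure_cost, add_zero]
      · cases hb
        refine ⟨h.isMaxSupportSolution hpos, ?_⟩
        simp only [matVec_cost] at hcost ⊢
        omega
    · have hp : (allPos (Aᵀ *ᵥ Q *ᵥ y)).val = false := by
        rw [← Bool.not_eq_true, allPos_val]; exact hpos
      rcases hres with hres | ⟨hx, hx1, hy, hyε⟩
      · exact absurd hres hpos
      have hv := h.rescale hm hM0 hx hx1 hy hyε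
      set ε : ℝ := 1 / (11 * (m : ℝ)) with hε
      have hε0 : 0 < ε := by
        have : (1 : ℝ) ≤ m := by exact_mod_cast hm
        positivity
      have hinv : (inverse (rescale ε A R Q x).val).val = (rescale ε A R Q x).val⁻¹ :=
        inverse_val hv.posDef
      -- The columns are known to be long only with respect to the old `Q`; this is why `M` has an
      -- extra factor 2.
      have hbound : ∀ w, w ⬝ᵥ (rescale ε A R Q x).val *ᵥ w ≤ M * (w ⬝ᵥ w) := fun w => by
        have hww : 0 ≤ w ⬝ᵥ w := by simpa using dotProduct_star_self_nonneg w
        calc _ ≤ 2 * (w ⬝ᵥ R *ᵥ w) := form_rescale_le hε0 hR hQ hcol hx hx1 w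
          _ ≤ 2 * ((1 + n / θ ^ 2) * (w ⬝ᵥ w)) := by gcongr; exact hRM w
          _ = 2 * (1 + n / θ ^ 2) * (w ⬝ᵥ w) := by ring
          _ ≤ _ := by gcongr
      obtain ⟨s', q, hq, hv', hlong, hcalls, hle⟩ := removeShort_spec hmn hθ hA hM0 c hv hbound
      refine ⟨Sum.inl s', k + ((matVec Q y).cost + ((matVec Aᵀ (Q *ᵥ y)).cost
        + ((allPos (Aᵀ *ᵥ Q *ᵥ y)).cost + ((rescale ε A R Q x).cost
        + ((inverse (rescale ε A R Q x).val).cost + q))))), fun fuel hfu => ?_, fun s'' hs'' => ?_,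
        by simp⟩
      · rw [mainRound_succ]
        ext1
        · simp only [bind_val, hf fuel hfu, matVec_val, hp, pure_val, hinv, hq, Bool.false_eq_true,
            if_false]
        · simp only [bind_cost, hf fuel hfu, matVec_val, hp, pure_cost, hinv, hq,
            Bool.false_eq_true, if_false, add_zero]
      · cases hs''
        refine ⟨hv', hlong, hcalls, ?_⟩
        have c2 := inverse_cost_le (rescale ε A R Q x).val
        simp only [matVec_cost, rescale_cost] at hcost ⊢
        rw [mul_add _ r 1] at hle
        omega

end Rounds

end MaxSupport

namespace MaxSupport

open Timed Matrix

/-! ### The maximum support image algorithm -/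

section Main

variable {m n : ℕ}

theorem mul_le_encodingLength (A : Matrix (Fin m) (Fin n) ℤ) : m * n ≤ encodingLength A := by
  calc m * n = ∑ _i : Fin m, ∑ _j : Fin n, 1 := by simp
    _ ≤ _ := Finset.sum_le_sum fun i _ => Finset.sum_le_sum fun j _ => Nat.le_add_right _ _

theorem isValid_initial {A₀ : Matrix (Fin m) (Fin n) ℝ} {M : ℝ} {keep : List (Fin n)}
    (hkeep : keep = (nonzeroColumns A₀).val) :
    IsValid A₀ M ⟨0, m, keep.length, A₀.submatrix id keep.get, 1, 1, 1⟩ := by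
  have hone : ∀ v : Fin m → ℝ, (1 : Matrix (Fin m) (Fin m) ℝ)ᵀ *ᵥ v = v := fun v => by
    rw [transpose_one, one_mulVec]
  refine ⟨le_rfl, ?_, ?_, fun j => ?_, fun j => ⟨keep.get j, ?_⟩, fun i hi => ?_, fun z _ => ?_,
    ⟨1, 0, one_pos, le_rfl, fun _ => le_rfl, ?_⟩, ?_, fun z _ hz1 => ?_, ?_⟩
  · exact hkeep ▸ nonzeroColumns_length_le A₀
  · simp
  · have h1 : keep.get j ∈ (nonzeroColumns A₀).val := hkeep ▸ List.get_mem keep j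
    have h2 := (mem_nonzeroColumns _ _).1 h1
    exact h2
  · exact (hone _).symm
  · simp only [hone] at hi ⊢
    rw [← mem_nonzeroColumns, ← hkeep] at hi
    obtain ⟨l, hl⟩ := List.get_of_mem hi
    exact ⟨l, hl ▸ rfl⟩
  · simp
  · simp
  · simp
  · simpa using hz1
  · simp

/-- The bound on the matrices `R`, in terms of the encoding length. -/
theorem bound_le_two_pow {L : ℕ} {P : ℝ} (hm : 1 ≤ m) (hL : m * n ≤ L) (hn : 1 ≤ n) (hP : 1 ≤ P)
    (hPL : P ≤ 4 ^ L) : 2 * (1 + n / (1 / (m * m * P)) ^ 2) ≤ (2 : ℝ) ^ (11 * L) := by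
  have hmL : m ≤ L := (Nat.le_mul_of_pos_right _ hn).trans hL
  have hnL : n ≤ L := (Nat.le_mul_of_pos_left _ hm).trans hL
  have h2 : (L : ℝ) ≤ 2 ^ L := by exact_mod_cast Nat.lt_two_pow_self.le
  have hm' : (m : ℝ) ≤ 2 ^ L := le_trans (by exact_mod_cast hmL) h2
  have hn' : (n : ℝ) ≤ 2 ^ L := le_trans (by exact_mod_cast hnL) h2
  have hP0 : 0 ≤ P := by linarith
  have hL1 : 1 ≤ L := hm.trans hmL
  have hP' : P ≤ 2 ^ (2 * L) := by rw [pow_mul]; norm_num; exact hPL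
  have h3 : (n : ℝ) / (1 / (m * m * P)) ^ 2 ≤ 2 ^ (9 * L) := by
    calc (n : ℝ) / (1 / (m * m * P)) ^ 2 = n * (m * m * P) ^ 2 := by
          rw [div_pow, one_pow, div_div_eq_mul_div, div_one]
      _ ≤ 2 ^ L * (2 ^ L * 2 ^ L * 2 ^ (2 * L)) ^ 2 := by gcongr
      _ = 2 ^ (9 * L) := by ring
  have h4 : (1 : ℝ) ≤ 2 ^ (9 * L) := one_le_pow₀ (by norm_num)
  calc _ ≤ 2 ^ (9 * L) * (2 : ℝ) ^ 2 := by linarith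
    _ = 2 ^ (9 * L + 2) := (pow_add _ _ _).symm
    _ ≤ 2 ^ (11 * L) := pow_le_pow_right₀ (by norm_num) (by omega)

/-- It is enough that `(16 / 9)² ≥ 2`. -/
theorem le_of_pow_le_two_pow {k N : ℕ} (h : (16 / 9 : ℝ) ^ k ≤ 2 ^ N) : k ≤ 2 * N := by
  have h1 : (16 / 9 : ℝ) ^ k ≤ (16 / 9) ^ (2 * N) := by
    refine h.trans ?_
    rw [pow_mul]
    gcongr
    norm_num
  exact (pow_le_pow_iff_right₀ (by norm_num)).1 h1

theorem overhead_le (hm : 1 ≤ m) (hmn : m ≤ n) :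
    m * n + (5 + n * (1 + m * 2) + m * (7 * (m * n) + 3 * n + 2 * m + 2)) + 3 + n * (m * 3) + m * m
      + 50 * (m * m * n) * m ≤ 100 * (m * m * m * n) := by
  have h1 : n ≤ m * n := Nat.le_mul_of_pos_left _ hm
  have h2 : m * n ≤ m * (m * n) := Nat.le_mul_of_pos_left _ hm
  have h3 : m * (m * n) ≤ m * (m * (m * n)) := Nat.le_mul_of_pos_left _ hm
  have h4 : m * m ≤ m * n := by gcongr
  nlinarith

/-- The algorithm with a correct first order method of cost at most `F`. -/
theorem maxSupportImage_spec {fom : FirstOrderMethod ℝ} {F : ℕ} (hfom : FirstOrderCorrect fom m n F)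
    {A : Matrix (Fin m) (Fin n) ℤ} (hm : 1 ≤ m) (hmn : m ≤ n) (hA : (toReal A).rank = m)
    (c : ℕ → ℕ) :
    ∃ y k, HaltsWith (maxSupportImage fom c A) y k ∧ IsMaxSupportSolution (toReal A) y ∧
      k ≤ (22 * (m * encodingLength A) + 1) * (F + 100 * (m * m * n))
        + 100 * (m * m * m * n) := by
  obtain ⟨N, hN⟩ := hfom
  obtain ⟨P, hθP, hP1, hPL, hPB⟩ := exists_threshold A
  set L := encodingLength A
  set θ : ℝ := 1 / (m * m * P) with hθdef
  have hm0 : (1 : ℝ) ≤ m := by exact_mod_cast hm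
  have hθ : 0 < θ := by positivity
  have hθ1 : θ ≤ 1 := by
    rw [hθdef, div_le_one (by positivity)]
    exact one_le_mul_of_one_le_of_one_le (one_le_mul_of_one_le_of_one_le hm0 hm0) hP1
  have hmargin : HasMargin (toReal A) θ := fun z hz i hi => exists_margin hm hA hPB hz hi
  set M : ℝ := 2 ^ (11 * L) with hMdef
  have hM : 2 * (1 + n / θ ^ 2) ≤ M :=
    bound_le_two_pow hm (mul_le_encodingLength A) (hm.trans hmn) hP1 hPL
  set K := 22 * (m * L) with hK
  -- From `(16 / 9)^calls ≤ M^m = 2^(11 L m)`; the factor 2 in `22 = 2 · 11` comes from the change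
  -- of base.
  have hcalls : ∀ s : State ℝ m, IsValid (toReal A) M s → IsLong θ s → s.calls ≤ K := by
    intro s h hs
    have hM0 : 0 ≤ M := by positivity
    have h1 := h.pow_calls_le hM0 fun w => (h.form_le hθ hs w).trans <| by
      have hww : 0 ≤ w ⬝ᵥ w := by simpa using dotProduct_star_self_nonneg w
      have h2 : 0 ≤ n / θ ^ 2 := by positivity
      gcongr
      linarith
    rw [hMdef, ← pow_mul] at h1
    have := le_of_pow_le_two_pow h1
    calc s.calls ≤ 2 * (11 * L * m) := this
      _ = K := by rw [hK]; ring
  set keep := (nonzeroColumns (toReal A)).val with hkeep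
  set s₀ : State ℝ m := ⟨0, m, keep.length, (toReal A).submatrix id keep.get, 1, 1, 1⟩ with hs₀
  have hvalid : IsValid (toReal A) M s₀ := isValid_initial hkeep
  -- Initially both norms agree, and `θ ≤ 1`.
  have hlong : IsLong θ s₀ := fun j => by
    change θ ^ 2 * (s₀.A.col j ⬝ᵥ s₀.A.col j) ≤ s₀.A.col j ⬝ᵥ 1 *ᵥ s₀.A.col j
    rw [one_mulVec]
    have h1 : 0 ≤ s₀.A.col j ⬝ᵥ s₀.A.col j := by
      simpa using dotProduct_star_self_nonneg (s₀.A.col j)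
    exact mul_le_of_le_one_left h1 (pow_le_one₀ hθ.le hθ1)
  obtain ⟨y, k, hloop, hy, hk⟩ := loop_halts
    (round := fun fuel => mainRound fom c fuel θ (1 / (11 * m))) (N := N)
    (fun s : State ℝ m => IsValid (toReal A) M s ∧ IsLong θ s)
    (IsMaxSupportSolution (toReal A)) (fun s => K - s.calls)
    -- Each remaining round is paid for separately, with one extra round for the return. Removals
    -- are paid for by the rows, at most `m` over the whole run, and not per round.
    (fun s => (K - s.calls + 1) * (F + 100 * (m * m * n)) + 50 * (m * m * n) * s.rows)
    (fun s hs => by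
      obtain ⟨o, k, h1, h2, h3⟩ := mainRound_spec hN hm hmn hθ hmargin hM c hs.1 hs.2
      refine ⟨o, k, h1, fun s' hs' => ?_, fun b hb => ⟨(h3 b hb).1, ?_⟩⟩
      · obtain ⟨hv, hl, hc, hcost⟩ := h2 s' hs'
        have := hcalls s' hv hl
        refine ⟨⟨hv, hl⟩, by omega, ?_⟩
        have e : K - s.calls + 1 = (K - s'.calls + 1) + 1 := by omega
        rw [e, add_mul (K - s'.calls + 1), one_mul]
        omega
      · have := (h3 b hb).2
        rw [add_mul (K - s.calls), one_mul]
        omega) s₀ ⟨hvalid, hlong⟩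
  refine ⟨y, m * n + ((threshold (toReal A)).cost + (1 + (1 + (1
    + ((nonzeroColumns (toReal A)).cost + (m * m + k)))))), ⟨max N (K + 1), fun fuel hf => ?_⟩, hy,
    ?_⟩
  · have hrun := hloop fuel (le_of_max_le_left hf) fuel (by
      have := le_of_max_le_right hf
      omega)
    have hA₀ : (mat fun i j => RealRAM.lit (A i j) : Timed (Matrix (Fin m) (Fin n) ℝ)).val
        = toReal A := rfl
    have hmat : (mat fun i j => RealRAM.lit (A i j) : Timed (Matrix (Fin m) (Fin n) ℝ)).cost
        = m * n := by simp
    have hε : ((1 : ℤ) : ℝ) / ((11 * (m : ℤ) : ℤ) : ℝ) = 1 / (11 * m) := by push_cast; rfl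
    ext1
    · simp only [maxSupportImage, bind_val, hA₀, hθP, lit_val, div_val, idMat_val, hε]
      rw [hrun]
    · simp only [maxSupportImage, bind_cost, hmat, hA₀, hθP, lit_val, lit_cost, div_val, div_cost,
        idMat_val, idMat_cost, hε]
      rw [hrun]
  · have h1 := threshold_cost_le (toReal A)
    have h2 := nonzeroColumns_cost_le (toReal A)
    have h3 := overhead_le hm hmn
    simp only [hs₀, Nat.sub_zero] at hk
    omega

theorem le_of_rank_eq {A : Matrix (Fin m) (Fin n) ℝ} (hA : A.rank = m) : m ≤ n := by
  have := A.rank_le_width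
  omega

/-! ### Total operation counts -/

theorem vonNeumann_total_le {L : ℕ} (hm : 1 ≤ m) (hmn : m ≤ n) (hL : m * n ≤ L) :
    (22 * (m * L) + 1) * (6 * (m * n * n) + 3200 * (m * m * n) + 4 * n + 100 * (m * m * n))
      + 100 * (m * m * m * n) ≤ 100000 * (m ^ 2 * n ^ 2 * L) := by
  have hn : 1 ≤ n := hm.trans hmn
  have hL1 : 1 ≤ L := (Nat.mul_pos hm hn).trans_le hL
  have h1 : m * m * n ≤ m * n * n := by gcongr
  have h2 : n ≤ m * n * n := Nat.le_mul_of_pos_left _ (Nat.mul_pos hm hn)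
  have h3 : 6 * (m * n * n) + 3200 * (m * m * n) + 4 * n + 100 * (m * m * n)
      ≤ 3310 * (m * n * n) := by omega
  have h4 : 22 * (m * L) + 1 ≤ 23 * (m * L) := by
    have := Nat.mul_pos hm hL1
    omega
  have h5 : m * m * m * n ≤ m * m * n * n * L := by
    calc m * m * m * n ≤ m * m * n * n := by gcongr
      _ ≤ _ := Nat.le_mul_of_pos_right _ hL1
  calc _ ≤ 23 * (m * L) * (3310 * (m * n * n)) + 100 * (m * m * n * n * L) := by gcongr
    _ = 76230 * (m ^ 2 * n ^ 2 * L) := by ring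
    _ ≤ _ := by gcongr; norm_num

theorem entropy_total_le {L : ℕ} (hm : 1 ≤ m) (hn : 2 ≤ n) (hL : m * n ≤ L) :
    (((22 * (m * L) + 1) * (100 * (m * m * n) + (entropyRounds m n + 1) * (100 * (m * n))
      + 100 * (m * m * n)) + 100 * (m * m * m * n) : ℕ) : ℝ)
      ≤ 100000 * ((m : ℝ) ^ 3 * n * √(Real.log n) * L) := by
  have hL1 : 1 ≤ L := (Nat.mul_pos hm (by omega)).trans_le hL
  have hm' : (1 : ℝ) ≤ m := by exact_mod_cast hm
  have hL' : (1 : ℝ) ≤ L := by exact_mod_cast hL1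
  set s := √(Real.log n) with hs
  -- For `n ≥ 2` the factor `√(log n)` is at least `1 / 2`, so terms without it are absorbed.
  have hs1 : 1 ≤ 2 * s := by
    have h1 : Real.log 2 ≤ Real.log n := Real.log_le_log (by norm_num) (by exact_mod_cast hn)
    have h2 : (1 / 2 : ℝ) ≤ s := Real.le_sqrt_of_sq_le (by
      have := Real.log_two_gt_d9
      norm_num at this ⊢
      linarith)
    linarith
  have hs0 : 0 ≤ s := Real.sqrt_nonneg _
  have he : (entropyRounds m n : ℝ) ≤ 32 * m * s := Nat.floor_le (by positivity)
  push_cast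
  have h4 : 22 * ((m : ℝ) * L) + 1 ≤ 23 * (m * L) := by nlinarith
  have h5 : (entropyRounds m n : ℝ) + 1 ≤ 34 * m * s := by nlinarith
  have h6 : (m : ℝ) * m * n ≤ m * m * n * (2 * s) := le_mul_of_one_le_right (by positivity) hs1
  have h7 : (m : ℝ) * m * m * n ≤ m * m * m * n * (2 * s) * L := by
    calc (m : ℝ) * m * m * n ≤ m * m * m * n * (2 * s) :=
          le_mul_of_one_le_right (by positivity) hs1
      _ ≤ _ := le_mul_of_one_le_right (by positivity) hL'
  calc _ ≤ 23 * ((m : ℝ) * L) * (100 * (m * m * n * (2 * s)) + 34 * m * s * (100 * (m * n))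
        + 100 * (m * m * n * (2 * s))) + 100 * (m * m * m * n * (2 * s) * L) := by gcongr
    _ = 87600 * ((m : ℝ) ^ 3 * n * s * L) := by ring
    _ ≤ _ := by gcongr; norm_num

end Main

end MaxSupport

theorem theorem4p12 :
    -- the von Neumann algorithm as first order method
    (∃ C : ℝ, ∀ (m n : ℕ) (A : Matrix (Fin m) (Fin n) ℤ), 1 ≤ m → (toReal A).rank = m →
      ∀ (pivot : ℕ → ℕ → ℕ) (removal : ℕ → ℕ),
        ∃ (y : Fin m → ℝ) (c : ℕ),
          HaltsWith (maxSupportImage (vonNeumann pivot) removal A) y c ∧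
          IsMaxSupportSolution (toReal A) y ∧
          (c : ℝ) ≤ C * ((m : ℝ) ^ 2 * (n : ℝ) ^ 2 * (encodingLength A : ℝ))) ∧
    -- the smoothed perceptron or mirror prox instead
    (∃ C : ℝ, ∀ fom ∈ ({smoothedPerceptron, mirrorProx} : Set (FirstOrderMethod ℝ)),
      ∀ (m n : ℕ) (A : Matrix (Fin m) (Fin n) ℤ), 1 ≤ m → 2 ≤ n → (toReal A).rank = m →
      ∀ removal : ℕ → ℕ,
        ∃ (y : Fin m → ℝ) (c : ℕ),
          HaltsWith (maxSupportImage fom removal A) y c ∧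
          IsMaxSupportSolution (toReal A) y ∧
          (c : ℝ) ≤
            C * ((m : ℝ) ^ 3 * (n : ℝ) * Real.sqrt (Real.log n) * (encodingLength A : ℝ))) := by
  refine ⟨⟨100000, fun m n A hm hA pivot removal => ?_⟩,
    ⟨100000, fun fom hfom m n A hm hn hA removal => ?_⟩⟩
  · have hmn := le_of_rank_eq hA
    obtain ⟨y, c, h1, h2, h3⟩ :=
      maxSupportImage_spec (vonNeumann_correct pivot hm hmn) hm hmn hA removal
    refine ⟨y, c, h1, h2, ?_⟩
    exact_mod_cast h3.trans (vonNeumann_total_le hm hmn (mul_le_encodingLength A))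
  · have hmn := le_of_rank_eq hA
    have hcorrect : FirstOrderCorrect fom m n (100 * (m * m * n)
        + (entropyRounds m n + 1) * (100 * (m * n))) := by
      rcases hfom with rfl | rfl
      · exact smoothedPerceptron_correct hm hmn
      · exact mirrorProx_correct hm hmn hn
    obtain ⟨y, c, h1, h2, h3⟩ := maxSupportImage_spec hcorrect hm hmn hA removal
    exact ⟨y, c, h1, h2, (Nat.cast_le.2 h3).trans
      (entropy_total_le hm hn (mul_le_encodingLength A))⟩
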